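/- **Setting.** Let $R=\mathbb C[u_1,\dots,u_p,\upsilon_1,\dots,\upsilon_q]$ be the freely generated supercommutative algebra with $u_i$ even, $\upsilon_i$ odd, and let $r\ge 0$. Consider $r$ formal super discs over $R$ with Ramond coordinates $(z_a\,|\,\theta_a)$, $a\in[r]$, on which the superconformal covering is $x=z_a^2$, $\phi=\sqrt2\,z_a\theta_a$ (up to an additive constant in $x$), with involution $\sigma_a(z_a|\theta_a)=(-z_a|-\theta_a)$. Differentials are written with even generator $[dz_a]=[d\theta_a]\theta_a z_a$ and odd generator $[d\theta_a]$, coefficients to the right; $[d\phi]=\sqrt2\,z_a[d\theta_a]$. **Data.** Let $t_{a,k},B^{ab}_{kl},V^{ab}_{kl}\in R$ be even and $\tau_{a,k},\phi^{ab}_{kl}\in R$ odd ($k\in\mathbb Z$ for $t,\tau$, and $k,l\ge0$ otherwise), with $t_{a,k}=\tau_{a,k}=0$ for $k\ll0$, $t_{a,0}=B^{ab}_{0l}=B^{ab}_{k0}=\phi^{ab}_{0l}=V^{ab}_{00}=0$, $B^{ab}_{kl}=B^{ba}_{lk}$, $V^{ab}_{kl}=-V^{ba}_{lk}$. Put $$\omega_{0,1}=\sum_k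 [dz_a]t_{a,k}z_a^{k-1}+[d\theta_a]\tau_{a,k}z_a^k\quad\text{on the disc } a,$$ and, for $z_1$ in the disc $a$ and $z_2$ in the disc $b$, $$\mathbf B=\delta_{ab}\mathbf B^{\rm R}+\sum_{k,l>0}[dz_{1}][dz_{2}]B^{ab}_{kl}z_1^{k-1}z_2^{l-1}+\sum_{k>0,l\ge0}[dz_1][d\theta_2]\bigl(1-\tfrac{\delta_{l0}}2\bigr)\phi^{ab}_{kl}z_1^{k-1}z_2^l+\sum_{k\ge0,l>0}[d\theta_1][dz_2]\bigl(1-\tfrac{\delta_{k0}}2\bigr)\phi^{ba}_{lk}z_1^kz_2^{l-1}+\sum_{k,l\ge0}[d\theta_1][d\theta_2]\bigl(1-\tfrac{\delta_{k0}}2-\tfrac{\delta_{l0}}2\bigr)V^{ab}_{kl}z_1^kz_2^l,$$ $$\mathbf B^{\rm R}=[d\theta_1][d\theta_2]\Bigl(-\frac{\theta_1\theta_2z_1z_2}{(z_1-z_2)^2}-\frac{z_1+z_2}{2(z_1-z_2)}\Bigr).$$ For a symmetric bidifferential $[d\theta_1][d\theta_2]g$ and $D^*_\theta=\partial_\theta+\theta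 z\partial_z$, the twisted super quadratic Casimir operator is $$\mathcal C^{\sigma_a}([d\theta_1][d\theta_2]g)=\tfrac12[d\theta_a]^3\bigl(D^*_{\theta_1}g|_{\mathbf z_1=\sigma_a(\mathbf z_2)=\mathbf z_a}-D^*_{\theta_1}g|_{\sigma_a(\mathbf z_1)=\mathbf z_2=\mathbf z_a}\bigr).$$ Assume that $s_a=\min\{k\text{ odd}: t_{a,k}\text{ invertible}\}$ exists and lies in $\{1,3\}$, and that near each puncture $$\omega_{0,1}(\mathbf z_a)+\omega_{0,1}(\sigma_a\mathbf z_a)=[d\theta_a]\mathcal O(z_a),\qquad \mathcal C^{\sigma_a}(\omega_{0,1}\boxtimes\omega_{0,1})=[d\theta_a]^3\mathcal O(z_a^{s_a}).$$ **Partition function.** On $R[x^{a,k}\,(k\ge1),\theta^{a,k}\,(k\ge0)]$ let $J_{a,k}=\hbar\partial_{x^{a,k}}$, $J_{a,0}=0$, $J_{a,-k}=\hbar k x^{a,k}$, $\Gamma_{a,k}=\hbar\partial_{\theta^{a,k}}$, $\Gamma_{a,0}=\hbar(\tfrac12\theta^{a,0}+\partial_{\theta^{a,0}})$, $\Gamma_{a,-k}=\hbar\theta^{a,k}$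 ($k>0$), and, where $:XY:$ is $XY$ minus its vacuum expectation value, $$L_{a,2n}=\tfrac12\sum_{j\in\mathbb Z}(-1)^{j-1}:J_{a,-j}J_{a,2n+j}:+\tfrac12\sum_{j\in\mathbb Z}(-1)^j(j+n):\Gamma_{a,-j}\Gamma_{a,2n+j}:+\tfrac{\hbar^2}4\delta_{n,0},\qquad G_{a,2n+1}=\sum_{j\in\mathbb Z}(-1)^{j-1}J_{a,-j}\Gamma_{a,2n+1+j},$$ $$T=\exp\Bigl(\hbar^{-2}\sum_{a,\,k\ne0} J_{a,k}\tfrac{t_{a,k}}k-\hbar^{-2}\sum_{a,k}\Gamma_{a,k}\tau_{a,k}\Bigr),\quad \Phi=\exp\Bigl(\tfrac1{2\hbar^2}\sum_{a,b,k,l}\tfrac{J_{a,k}J_{b,l}}{kl}B^{ab}_{kl}-2\tfrac{J_{a,k}\Gamma_{b,l}}k\phi^{ab}_{kl}+\Gamma_{a,k}\Gamma_{b,l}V^{ab}_{kl}\Bigr)$$ (terms in which $J_{a,0}$ is divided by $0$ are absent). Let $$Z=\exp\Bigl(\sum_{g\ge0,\,n\ge1,\,2g-2+n\ge0}\frac{\hbar^{2g-2+n}}{n!}\sum_{i_1,\dots,i_n}x^{i_1}\cdots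 x^{i_n}F_{g,n}[i_1,\dots,i_n]\Bigr)$$ be any partition function of the partial super Airy structure $\{J_{a,2j},\Gamma_{a,2j-1},\Phi TL_{a,2j-s_a-1}T^{-1}\Phi^{-1},\Phi TG_{a,2j-s_a}T^{-1}\Phi^{-1}\mid a\in[r],j\ge1\}$, that is, $Z$ is annihilated by all these operators. Here $g$ runs through integers, the indices $i$ run over $(a,B,k)$, $k\ge1$ (with $x^{i}=x^{a,k}$) and $(a,F,k)$, $k\ge0$ (with $x^i=\theta^{a,k}$), the exponents are even polynomials, and the coefficients $F_{g,n}[i_1,\dots,i_n]\in R$ are supersymmetric in their indices. **Multidifferentials.** For $k>0$ put $$d\xi_{a,-k}=\frac{[dz_a]}{z_a^{k+1}}+\frac1k\sum_b\Bigl(\sum_{l>0}[dz_b]\bigl(B^{ab}_{kl}+\tfrac12\textstyle\sum_c\phi^{bc}_{l0}\phi^{ac}_{k0}\bigr)z_b^{l-1}+\sum_{l\ge0}[d\theta_b]\bigl(\phi^{ab}_{kl}+\tfrac12\sum_cV^{cb}_{0l}\phi^{ac}_{k0}\bigr)z_b^l\Bigr),$$ and for $k\ge0$ $$d\eta_{a,-k}=\frac{[d\theta_a]}{z_a^k}+\sum_b\Bigl(\sum_{l>0}[dz_b]\bigl(\phi^{ba}_{lk}+\tfrac12\textstyle\sum_cV^{ac}_{k0}\phi^{bc}_{l0}\bigr)z_b^{l-1}+\sum_{l\ge0}[d\theta_b]\bigl(V^{ab}_{kl}+\tfrac12\sum_cV^{ac}_{k0}V^{cb}_{0l}\bigr)z_b^l\Bigr).$$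 Write $d\xi_{-i}$ for $d\xi_{a,-k}$ if $i=(a,B,k)$ and for $d\eta_{a,-k}$ if $i=(a,F,k)$. For $n\ge1$, $2g-2+n\ge0$ define $$\omega_{g,n}(\mathbf z_1,\dots,\mathbf z_n)=\delta_{g,0}\delta_{n,2}\mathbf B(\mathbf z_1,\mathbf z_2)+\sum_{i_1,\dots,i_n}d\xi_{-i_1}(\mathbf z_1)\cdots d\xi_{-i_n}(\mathbf z_n)F_{g,n}[i_1,\dots,i_n].$$ **Theorem.** For all $g,n\ge0$ and $a\in[r]$, the multidifferentials $\omega_{g,n}$ satisfy the abstract super loop equations at the puncture $a$: for $\mathbf z$ in the disc $a$, $$\omega_{g,n+1}(\mathbf z,\mathbf z_{[n]})+\omega_{g,n+1}(\sigma_a(\mathbf z),\mathbf z_{[n]})=[d\phi]\,\mathcal O(x^0),$$ $$\mathcal C^{\sigma_a}(\omega_{g-1,n+2})(\mathbf z;\mathbf z_{[n]})+\mathcal C^{\sigma_a}\Bigl(\sum_{g_1+g_2=g,\ I\sqcup J=[n]}\omega_{g_1,|I|+1}\otimes\omega_{g_2,|J|+1}\Bigr)(\mathbf z;\mathbf z_I;\mathbf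 z_J)=[d\phi]^3\,\mathcal O\bigl(x^{(s_a-3)/2}\bigr),$$ where the first term is absent for $g=0$, $\mathcal C^{\sigma_a}$ acts on the first entries of the two factors, and $\mathcal O(x^e)$ means $x^e$ times a power series in $(x|\phi)$ whose coefficients are formal $n$-differentials in $\mathbf z_{[n]}$, all expressions being expanded as $\mathbf z$ tends to the puncture with $\mathbf z_{[n]}$ fixed (so $\mathbf B(\mathbf z,\mathbf z_j)$ is expanded for $|z|<|z_j|$). -/

import Mathlib

open scoped TensorProduct

noncomputable section

namespace SuperTR

/-! ### Free supercommutative algebras and their derivations -/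

/-- The supercommutative `ℂ`-algebra freely generated by even generators indexed by `I` and odd
generators indexed by `O`. -/
abbrev SuperPoly (I O : Type) : Type := MvPolynomial I ℂ ⊗[ℂ] ExteriorAlgebra ℂ (O →₀ ℂ)

section SuperPoly

variable {I O : Type}

/-- An even generator. -/
def evenVar (i : I) : SuperPoly I O := MvPolynomial.X i ⊗ₜ[ℂ] 1

/-- An odd generator. -/
def oddVar (o : O) : SuperPoly I O := 1 ⊗ₜ[ℂ] ExteriorAlgebra.ι ℂ (Finsupp.single o 1)

/-- The partial derivative with respect to an even generator. -/
def evenDeriv (i : I) : Module.End ℂ (SuperPoly I O) :=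
  LinearMap.rTensor (ExteriorAlgebra ℂ (O →₀ ℂ)) (MvPolynomial.pderiv (R := ℂ) i).toLinearMap

/-- The (left) partial derivative with respect to an odd generator: the odd derivation which kills
all other generators. -/
def oddDeriv (o : O) : Module.End ℂ (SuperPoly I O) :=
  LinearMap.lTensor (MvPolynomial I ℂ)
    (CliffordAlgebra.contractLeft (Q := (0 : QuadraticForm ℂ (O →₀ ℂ))) (Finsupp.lapply o))

/-- The parity automorphism: `+1` on even and `-1` on odd elements. -/
def parityAut : SuperPoly I O →ₐ[ℂ] SuperPoly I O :=
  Algebra.TensorProduct.map (AlgHom.id ℂ (MvPolynomial I ℂ))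
    (CliffordAlgebra.involute (Q := (0 : QuadraticForm ℂ (O →₀ ℂ))))

/-- `f` is homogeneous of parity `d mod 2`. -/
def HasParity (d : ℕ) (f : SuperPoly I O) : Prop := parityAut f = (-1 : ℂ) ^ d • f

end SuperPoly

/-- The base ring `R = ℂ[u_1, …, u_p, υ_1, …, υ_q]`. -/
abbrev BaseRing (p q : ℕ) : Type := SuperPoly (Fin p) (Fin q)

/-- The polynomial superalgebra over `R` in the even variables `x^{a,k}` (`k ≥ 1`) and the odd
variables `θ^{a,k}` (`k ≥ 0`), `a ∈ [r]`. -/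
abbrev Fock (p q r : ℕ) : Type := SuperPoly (Fin p ⊕ Fin r × ℕ+) (Fin q ⊕ Fin r × ℕ)

/-- The inclusion of the base ring in the polynomial algebra over it. -/
def baseIncl (p q r : ℕ) : BaseRing p q →ₐ[ℂ] Fock p q r :=
  Algebra.TensorProduct.map (MvPolynomial.rename Sum.inl)
    (ExteriorAlgebra.map (Finsupp.lmapDomain ℂ ℂ Sum.inl))

/-- The indices of the variables: `inl (a, k)` for `x^{a,k}` and `inr (a, k)` for `θ^{a,k}`. -/
abbrev Coord (r : ℕ) : Type := (Fin r × ℕ+) ⊕ (Fin r × ℕ)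

/-- The parity of an index: `0` for the left (even), `1` for the right (odd) kind. -/
def par {α β : Type} : α ⊕ β → ℕ := Sum.elim (fun _ => 0) (fun _ => 1)

/-- The variable with a given index. -/
def coordVar {p q r : ℕ} : Coord r → Fock p q r :=
  Sum.elim (fun i => evenVar (Sum.inr i)) (fun i => oddVar (Sum.inr i))

/-! ### Operators -/

/-- The sum of a family of operators of which only finitely many are nonzero on any given
polynomial. -/
def opSum {M ι : Type} [AddCommGroup M] [Module ℂ M] (f : ι → Module.End ℂ M) :
    Module.End ℂ M :=
  open Classical in
  if h : ∀ v : M, (Function.support fun i => f i v).Finite then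
    { toFun := fun v => ∑ᶠ i, f i v
      map_add' := fun v w => by
        simp only [map_add]
        exact finsum_add_distrib (h v) (h w)
      map_smul' := fun c v => by
        simp only [map_smul, RingHom.id_apply]
        exact (smul_finsum c fun i => f i v).symm }
  else 0

/-- Multiplication by an element of the base ring. -/
def mulBase {p q r : ℕ} (c : BaseRing p q) : Module.End ℂ (Fock p q r) :=
  LinearMap.mulLeft ℂ (baseIncl p q r c)

/-- The Heisenberg modes without their factor `ħ`: `J_{a,k} = ħ • modeJ a k`. -/
def modeJ {p q r : ℕ} (a : Fin r) : ℤ → Module.End ℂ (Fock p q r)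
  | .ofNat 0 => 0
  | .ofNat (k + 1) => evenDeriv (Sum.inr (a, k.succPNat))
  | .negSucc k => ((k : ℂ) + 1) • LinearMap.mulLeft ℂ (evenVar (Sum.inr (a, k.succPNat)))

/-- The Clifford modes without their factor `ħ`: `Γ_{a,k} = ħ • modeG a k`. -/
def modeG {p q r : ℕ} (a : Fin r) : ℤ → Module.End ℂ (Fock p q r)
  | .ofNat 0 =>
      (1 / 2 : ℂ) • LinearMap.mulLeft ℂ (oddVar (Sum.inr (a, 0))) + oddDeriv (Sum.inr (a, 0))
  | .ofNat (k + 1) => oddDeriv (Sum.inr (a, k + 1))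
  | .negSucc k => LinearMap.mulLeft ℂ (oddVar (Sum.inr (a, k + 1)))

/-- The normal ordered product `:J_{a,k} J_{a,l}:`, with the vacuum expectation value
subtracted. -/
def normJJ {p q r : ℕ} (a : Fin r) (k l : ℤ) : Module.End ℂ (Fock p q r) :=
  modeJ a k * modeJ a l - (if k + l = 0 ∧ 0 < k then (k : ℂ) else 0) • 1

/-- The normal ordered product `:Γ_{a,k} Γ_{a,l}:`, with the vacuum expectation value
subtracted. -/
def normGG {p q r : ℕ} (a : Fin r) (k l : ℤ) : Module.End ℂ (Fock p q r) :=
  modeG a k * modeG a l -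
    (if k + l = 0 then (if 0 < k then (1 : ℂ) else if k = 0 then 1 / 2 else 0) else 0) • 1

/-- `ħ^{-2} L_{a,2n}`. -/
def opL {p q r : ℕ} (a : Fin r) (n : ℤ) : Module.End ℂ (Fock p q r) :=
  (1 / 2 : ℂ) • opSum (fun j : ℤ => (-1 : ℂ) ^ (j - 1) • normJJ a (-j) (2 * n + j)) +
    (1 / 2 : ℂ) •
      opSum (fun j : ℤ => ((-1 : ℂ) ^ j * ((j : ℂ) + n)) • normGG a (-j) (2 * n + j)) +
    (if n = 0 then (1 / 4 : ℂ) else 0) • 1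

/-- `ħ^{-2} G_{a,2n+1}`. -/
def opG {p q r : ℕ} (a : Fin r) (n : ℤ) : Module.End ℂ (Fock p q r) :=
  opSum (fun j : ℤ => (-1 : ℂ) ^ (j - 1) • (modeJ a (-j) * modeG a (2 * n + 1 + j)))

/-- Laurent series in `ħ` with operator coefficients. -/
abbrev HOp (p q r : ℕ) : Type := HahnSeries ℤ (Module.End ℂ (Fock p q r))

set_option maxSynthPendingDepth 6 in
instance instRingHOp (p q r : ℕ) : Ring (HOp p q r) := inferInstance

/-- `exp(X) H exp(-X) = ∑_m ad_X^m(H) / m!`, for even `X` such that the sum is finite. -/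
def conjExp {p q r : ℕ} (X H : HOp p q r) : HOp p q r :=
  ∑ᶠ m : ℕ, ((m.factorial : ℂ)⁻¹) • ((fun Y => X * Y - Y * X)^[m] H)

/-! ### Formal differentials and the twisted super quadratic Casimir operator -/

/-- The monomial basis of residueless differentials on the discs: `inl (a, k)` stands for
`[dz_a] z_a^{k-1} = [dθ_a] θ_a z_a^k` (even), `inr (a, k)` for `[dθ_a] z_a^k` (odd). -/
abbrev Mode (r : ℕ) : Type := (Fin r × ℤ) ⊕ (Fin r × ℤ)

/-- Formal `n`-differentials `∑_m e_{m_1}(z_1) ⋯ e_{m_n}(z_n) c(m)`, given by their coefficients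
`c(m)`, written to the right of the basis elements. -/
abbrev MultiDiff (p q r n : ℕ) : Type := (Fin n → Mode r) → BaseRing p q

/-- The sign of the pullback of `e_m` under `σ_a : (z_a | θ_a) ↦ (-z_a | -θ_a)` on the disc `a` of
`m`. -/
def sigmaSign {r : ℕ} : Mode r → ℂ :=
  Sum.elim (fun m => (-1 : ℂ) ^ m.2) (fun m => (-1 : ℂ) ^ (m.2 + 1))

/-- A function `g00 + θ₁ g10 + θ₂ g01 + θ₁ θ₂ g11` of two points `(z₁ | θ₁)`, `(z₂ | θ₂)`, with
components in a space `𝓕` of functions of `z₁, z₂`. -/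
structure SuperFun₂ (𝓕 : Type) where
  (g00 g10 g01 g11 : 𝓕)

/-- `D*_{θ₁} = ∂_{θ₁} + θ₁ z₁ ∂_{z₁}`, where `E` is `z₁ ∂_{z₁}` on `𝓕`. -/
def SuperFun₂.Dstar {𝓕 : Type} (E : 𝓕 → 𝓕) (g : SuperFun₂ 𝓕) : SuperFun₂ 𝓕 :=
  ⟨g.g10, E g.g00, g.g11, E g.g01⟩

/-- The restriction to `(z₁ | θ₁) = (εz | εθ)`, `(z₂ | θ₂) = (-εz | -εθ)`, where `ev` is the
restriction to `z₁ = εz`, `z₂ = -εz` on `𝓕`: the coefficients of `1` and of `θ`. -/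
def SuperFun₂.restrict {𝓕 𝓖 : Type} [AddCommGroup 𝓖] [Module ℂ 𝓖] (ε : ℂ) (ev : 𝓕 → 𝓖)
    (g : SuperFun₂ 𝓕) : 𝓖 × 𝓖 :=
  (ev g.g00, ε • ev g.g10 - ε • ev g.g01)

/-- The twisted super quadratic Casimir operator at a Ramond puncture, in Ramond coordinates:
the image of `[dθ₁][dθ₂] g` is `[dθ]³` times
`½ (D*_{θ₁} g |_{z₁ = σ(z₂) = z} - D*_{θ₁} g |_{σ(z₁) = z₂ = z})`. -/
def SuperFun₂.casimir {𝓕 𝓖 : Type} [AddCommGroup 𝓖] [Module ℂ 𝓖] (E : 𝓕 → 𝓕)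
    (ev : ℂ → 𝓕 → 𝓖) (g : SuperFun₂ 𝓕) : 𝓖 × 𝓖 :=
  (1 / 2 : ℂ) •
    ((g.Dstar E).restrict 1 (ev 1) - (g.Dstar E).restrict (-1) (ev (-1)))

/-- The Casimir of a formal bidifferential `∑ e_m(z₁) e_{m'}(z₂) c(m, m')` on the disc `a`: the
coefficients of `[dθ_a]³ z_a^N` and of `[dθ_a]³ θ_a z_a^N`. The series is first written as
`[dθ₁][dθ₂] g`, where moving `[dθ₂]` to the left past `θ₁` gives a sign. -/
def casimir {r : ℕ} {M : Type} [AddCommGroup M] [Module ℂ M] (a : Fin r)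
    (c : Mode r → Mode r → M) : (ℤ → M) × (ℤ → M) :=
  SuperFun₂.casimir
    (E := fun f : ℤ → ℤ → M => fun k l => (k : ℂ) • f k l)
    (ev := fun ε f => fun N => ∑ᶠ k : ℤ, (ε ^ k * (-ε) ^ (N - k)) • f k (N - k))
    ⟨fun k l => c (.inr (a, k)) (.inr (a, l)), fun k l => -c (.inl (a, k)) (.inr (a, l)),
     fun k l => c (.inr (a, k)) (.inl (a, l)), fun k l => -c (.inl (a, k)) (.inl (a, l))⟩

/-- The standard bidifferential at a Ramond puncture is `[dθ₁][dθ₂]` times this function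
`-θ₁ θ₂ z₁ z₂ / (z₁ - z₂)² - (z₁ + z₂) / (2 (z₁ - z₂))`. -/
def ramondFun : SuperFun₂ (ℂ → ℂ → ℂ) :=
  ⟨fun z w => -(z + w) / (2 * (z - w)), 0, 0, fun z w => -(z * w) / (z - w) ^ 2⟩

/-- The Casimir of the standard bidifferential at a Ramond puncture, as a pair of functions
of `z`. -/
def casimirRamondFun : (ℂ → ℂ) × (ℂ → ℂ) :=
  ramondFun.casimir (E := fun f z w => z * deriv (fun y => f y w) z)
    (ev := fun ε f z => f (ε * z) (-ε * z))

/-- It is `-½ [dθ]³ θ`. -/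
theorem casimirRamondFun_apply (z : ℂ) (hz : z ≠ 0) :
    casimirRamondFun.1 z = 0 ∧ casimirRamondFun.2 z = -1 / 2 := by
  have key : ∀ y w : ℂ, y ≠ w →
      deriv (fun y : ℂ => -(y + w) / (2 * (y - w))) y = w / (y - w) ^ 2 := by
    intro y w h
    have h' : y - w ≠ 0 := sub_ne_zero.mpr h
    have h1 : HasDerivAt (fun y : ℂ => -(y + w)) (-1) y := ((hasDerivAt_id y).add_const w).neg
    have h2 : HasDerivAt (fun y : ℂ => 2 * (y - w)) (2 * 1) y :=
      ((hasDerivAt_id y).sub_const w).const_mul 2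
    refine (h1.div h2 (by simpa using h')).deriv.trans ?_
    field_simp
    ring
  have hz2 : z ≠ -z := fun h => hz (by
    have : (2 : ℂ) * z = 0 := by linear_combination h
    simpa using this)
  refine ⟨?_, ?_⟩
  · simp [casimirRamondFun, SuperFun₂.casimir, SuperFun₂.restrict, SuperFun₂.Dstar, ramondFun]
  · simp only [casimirRamondFun, SuperFun₂.casimir, SuperFun₂.restrict, SuperFun₂.Dstar, ramondFun]
    simp only [Prod.smul_snd, Prod.snd_sub, Pi.smul_apply, Pi.sub_apply, smul_eq_mul, one_mul,
      neg_mul, neg_neg]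
    rw [key z (-z) hz2, key (-z) z hz2.symm]
    have : z - -z ≠ 0 := sub_ne_zero.mpr hz2
    have : -z - z ≠ 0 := sub_ne_zero.mpr hz2.symm
    field_simp
    ring

/-- The Casimir of the standard bidifferential at a Ramond puncture as a Laurent series. -/
def casimirRamond (p q : ℕ) : (ℤ → BaseRing p q) × (ℤ → BaseRing p q) :=
  (0, fun N => if N = 0 then algebraMap ℂ (BaseRing p q) (-1 / 2) else 0)

/-- The expansion of the standard bidifferential at each Ramond puncture for `|z₁| < |z₂|`:
`∑_{k>0} k [dz₁][dz₂] z₁^{k-1} z₂^{-k-1} + ½ [dθ₁][dθ₂] + ∑_{k>0} [dθ₁][dθ₂] z₁^k z₂^{-k}`. -/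
def ramondB {p q r : ℕ} : Mode r → Mode r → BaseRing p q
  | .inl (a, k), .inl (b, l) =>
      if a = b ∧ 0 < k ∧ l = -k then algebraMap ℂ (BaseRing p q) k else 0
  | .inr (a, k), .inr (b, l) =>
      if a = b ∧ l = -k then
        (if 0 < k then 1 else if k = 0 then algebraMap ℂ (BaseRing p q) (1 / 2) else 0)
      else 0
  | _, _ => 0

/-- A formal section of the `d`-th power of `[dθ]`, with coefficients `c₀ N` of `z^N` and `c₁ N` of
`θ z^N`, is `[dφ]^d O(x^e)`: it is the pullback of `[dφ]^d x^e (∑_j f_j x^j + φ ∑_j h_j x^j)` under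
`x = z²`, `φ = √2 z θ`, hence `[dφ] = √2 z [dθ]`. -/
def IsBigO {M : Type} [AddCommGroup M] [Module ℂ M] (d : ℕ) (e : ℤ) (c₀ c₁ : ℤ → M) : Prop :=
  ∃ f h : ℕ → M, ∀ N : ℤ,
    c₀ N = ∑ᶠ j : ℕ, (if N = d + 2 * (e + j) then ((√2 : ℝ) : ℂ) ^ d • f j else 0) ∧
    c₁ N = ∑ᶠ j : ℕ, (if N = d + 2 * (e + j) + 1 then ((√2 : ℝ) : ℂ) ^ (d + 1) • h j else 0)

/-! ### Super spectral curves -/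

/-- The dilaton shift and polarisation constants. -/
structure CurveData (p q r : ℕ) where
  t : Fin r → ℤ → BaseRing p q
  τ : Fin r → ℤ → BaseRing p q
  B : Fin r → Fin r → ℕ → ℕ → BaseRing p q
  φ : Fin r → Fin r → ℕ → ℕ → BaseRing p q
  V : Fin r → Fin r → ℕ → ℕ → BaseRing p q
  t_even : ∀ a k, HasParity 0 (t a k)
  τ_odd : ∀ a k, HasParity 1 (τ a k)
  B_even : ∀ a b k l, HasParity 0 (B a b k l)
  φ_odd : ∀ a b k l, HasParity 1 (φ a b k l)
  V_even : ∀ a b k l, HasParity 0 (V a b k l)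
  t_bdd : ∃ K : ℤ, ∀ a, ∀ k < K, t a k = 0
  τ_bdd : ∃ K : ℤ, ∀ a, ∀ k < K, τ a k = 0
  t_zero : ∀ a, t a 0 = 0
  B_zero_left : ∀ a b l, B a b 0 l = 0
  B_zero_right : ∀ a b k, B a b k 0 = 0
  φ_zero_left : ∀ a b l, φ a b 0 l = 0
  V_zero_zero : ∀ a b, V a b 0 0 = 0
  B_symm : ∀ a b k l, B a b k l = B b a l k
  V_antisymm : ∀ a b k l, V a b k l = -V b a l k

namespace CurveData

variable {p q r : ℕ} (S : CurveData p q r)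

/-- `ω_{0,1} = ∑_k [dz_a] t_{a,k} z_a^{k-1} + [dθ_a] τ_{a,k} z_a^k` on the disc `a`. -/
def omega01 : Mode r → BaseRing p q := Sum.elim (fun m => S.t m.1 m.2) (fun m => S.τ m.1 m.2)

/-- The bidifferential `ω_{0,1}(z₁) ω_{0,1}(z₂)`. -/
def omega01Sq (m m' : Mode r) : BaseRing p q :=
  (-1 : ℂ) ^ (par m * par m') • (S.omega01 m * S.omega01 m')

/-- The holomorphic part of the bidifferential `𝐁`, that is, `𝐁` minus the standard bidifferential
on every disc. -/
def regB : Mode r → Mode r → BaseRing p q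
  | .inl (a, k), .inl (b, l) => if 0 < k ∧ 0 < l then S.B a b k.toNat l.toNat else 0
  | .inl (a, k), .inr (b, l) =>
      if 0 < k ∧ 0 ≤ l then
        (1 - (if l = 0 then 1 / 2 else 0) : ℂ) • S.φ a b k.toNat l.toNat else 0
  | .inr (a, k), .inl (b, l) =>
      if 0 ≤ k ∧ 0 < l then
        (1 - (if k = 0 then 1 / 2 else 0) : ℂ) • S.φ b a l.toNat k.toNat else 0
  | .inr (a, k), .inr (b, l) =>
      if 0 ≤ k ∧ 0 ≤ l then
        (1 - (if k = 0 then 1 / 2 else 0) - (if l = 0 then 1 / 2 else 0) : ℂ) •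
          S.V a b k.toNat l.toNat else 0

/-- The polarised basis: `S.dxi i` is the differential dual to the variable with index `i`, i.e.
`dξ_{a,-k}` for `i = inl (a, k)` and `dη_{a,-k}` for `i = inr (a, k)`, including `dη_{a,0}`.
A pair `(b, l)` with `l` in the wrong range has coefficient zero. -/
def dxi : Coord r → Mode r → BaseRing p q
  | .inl (a, k), .inl (b, l) =>
      (if b = a ∧ l = -(k : ℤ) then 1 else 0) +
        if 0 < l then
          ((k : ℂ)⁻¹) • (S.B a b k l.toNat +
            (1 / 2 : ℂ) • ∑ c, S.φ b c l.toNat 0 * S.φ a c k 0) else 0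
  | .inl (a, k), .inr (b, l) =>
      if 0 ≤ l then
        ((k : ℂ)⁻¹) • (S.φ a b k l.toNat +
          (1 / 2 : ℂ) • ∑ c, S.V c b 0 l.toNat * S.φ a c k 0) else 0
  | .inr (a, k), .inl (b, l) =>
      if 0 < l then
        S.φ b a l.toNat k + (1 / 2 : ℂ) • ∑ c, S.V a c k 0 * S.φ b c l.toNat 0 else 0
  | .inr (a, k), .inr (b, l) =>
      (if b = a ∧ l = -(k : ℤ) then 1 else 0) +
        if 0 ≤ l then
          S.V a b k l.toNat + (1 / 2 : ℂ) • ∑ c, S.V a c k 0 * S.V c b 0 l.toNat else 0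

/-- `log T`, the logarithm of the dilaton shift. -/
def logT : HOp p q r :=
  HahnSeries.single (-1) (opSum fun i : Fin r × ℤ =>
    ((i.2 : ℂ)⁻¹) • (modeJ i.1 i.2 * mulBase (S.t i.1 i.2)) -
      modeG i.1 i.2 * mulBase (S.τ i.1 i.2))

/-- `log Φ`, the logarithm of the change of polarisation. -/
def logPhi : HOp p q r :=
  HahnSeries.single 0 ((1 / 2 : ℂ) • opSum fun i : (Fin r × ℕ) × (Fin r × ℕ) =>
    ((i.1.2 : ℂ) * i.2.2)⁻¹ •
        (modeJ i.1.1 i.1.2 * modeJ i.2.1 i.2.2 * mulBase (S.B i.1.1 i.2.1 i.1.2 i.2.2)) -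
      (2 * (i.1.2 : ℂ)⁻¹) •
        (modeJ i.1.1 i.1.2 * modeG i.2.1 i.2.2 * mulBase (S.φ i.1.1 i.2.1 i.1.2 i.2.2)) +
      modeG i.1.1 i.1.2 * modeG i.2.1 i.2.2 * mulBase (S.V i.1.1 i.2.1 i.1.2 i.2.2))

/-- `Φ T H T⁻¹ Φ⁻¹`. -/
def conj (H : HOp p q r) : HOp p q r := conjExp S.logPhi (conjExp S.logT H)

end CurveData

/-- A local super spectral curve with `r` discs in Ramond coordinates in which `x = z_a²` and
`φ = √2 z_a θ_a` (up to an additive constant in `x`). -/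
structure SuperSpectralCurve (p q r : ℕ) extends CurveData p q r where
  s : Fin r → ℤ
  s_isLeast : ∀ a, IsLeast {k : ℤ | Odd k ∧ IsUnit (t a k)} (s a)
  s_mem : ∀ a, s a = 1 ∨ s a = 3
  /-- `ω_{0,1}(z) + ω_{0,1}(σ_a z) = [dθ_a] O(z_a)` -/
  linear : ∀ a, ∀ N < (1 : ℤ), ∀ m : Mode r, (m = .inl (a, N) ∨ m = .inr (a, N)) →
    toCurveData.omega01 m + sigmaSign m • toCurveData.omega01 m = 0
  /-- `C^{σ_a}(ω_{0,1} ⊠ ω_{0,1}) = [dθ_a]³ O(z_a^{s_a})` -/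
  quadratic : ∀ a, ∀ N < s a, (casimir a toCurveData.omega01Sq).1 N = 0 ∧
    (casimir a toCurveData.omega01Sq).2 N = 0

namespace SuperSpectralCurve

variable {p q r : ℕ} (S : SuperSpectralCurve p q r)

/-- The generators `J_{a,2j}`, `Γ_{a,2j-1}`, `Φ T L_{a,2j-s-1} T⁻¹ Φ⁻¹`, `Φ T G_{a,2j-s} T⁻¹ Φ⁻¹`
(`j ≥ 1`) of the partial super Airy structure of the curve. -/
inductive IsGenerator : HOp p q r → Prop
  | J (a : Fin r) (j : ℤ) (hj : 1 ≤ j) : IsGenerator (HahnSeries.single 1 (modeJ a (2 * j)))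
  | G (a : Fin r) (j : ℤ) (hj : 1 ≤ j) : IsGenerator (HahnSeries.single 1 (modeG a (2 * j - 1)))
  | L (a : Fin r) (j n : ℤ) (hj : 1 ≤ j) (hn : 2 * n = 2 * j - S.s a - 1) :
      IsGenerator (S.conj (HahnSeries.single 2 (opL a n)))
  | SG (a : Fin r) (j n : ℤ) (hj : 1 ≤ j) (hn : 2 * n + 1 = 2 * j - S.s a) :
      IsGenerator (S.conj (HahnSeries.single 2 (opG a n)))

end SuperSpectralCurve

/-! ### The partition function -/

/-- The coefficients `F_{g,n}[i_1, …, i_n]` of even polynomials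
`F_{g,n} = 1/n! ∑ x^{i_1} ⋯ x^{i_n} F_{g,n}[i_1, …, i_n]`. -/
structure FreeEnergies (p q r : ℕ) where
  F : (g n : ℕ) → (Fin n → Coord r) → BaseRing p q
  finite : ∀ g n, (Function.support (F g n)).Finite
  parity : ∀ g n i, HasParity (∑ k, par (i k)) (F g n i)
  /-- supersymmetry -/
  swap : ∀ g n i (k : ℕ) (hk : k + 1 < n),
    F g n (i ∘ Equiv.swap ⟨k, by omega⟩ ⟨k + 1, hk⟩) =
      (-1 : ℂ) ^ (par (i ⟨k, by omega⟩) * par (i ⟨k + 1, hk⟩)) • F g n i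

namespace FreeEnergies

variable {p q r : ℕ} (Z : FreeEnergies p q r)

/-- The polynomial `F_{g,n}`. -/
def poly (g n : ℕ) : Fock p q r :=
  ((n.factorial : ℂ)⁻¹) •
    ∑ᶠ i : Fin n → Coord r, (List.ofFn fun k => coordVar (i k)).prod * baseIncl p q r (Z.F g n i)

/-- `log Z = ∑_{g ≥ 0, n ≥ 1, 2g-2+n ≥ 0} ħ^{2g-2+n} F_{g,n}`, as a multiplication operator. -/
def logZ : HOp p q r :=
  HahnSeries.ofPowerSeries ℤ _ (PowerSeries.mk fun χ : ℕ => LinearMap.mulLeft ℂ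
    (∑ g ∈ Finset.range (χ + 2), ∑ n ∈ Finset.Icc 1 (χ + 2),
      if 2 * g + n = χ + 2 then Z.poly g n else 0))

/-- `H Z = 0`, i.e. `(Z⁻¹ H Z) 1 = 0`. -/
def IsAnnihilatedBy (H : HOp p q r) : Prop :=
  ∀ d : ℤ, (conjExp (-Z.logZ) H).coeff d 1 = 0

/-- `Z` is a partition function of the partial super Airy structure of the curve. -/
def IsPartitionFunction (S : SuperSpectralCurve p q r) : Prop :=
  ∀ H : HOp p q r, S.IsGenerator H → Z.IsAnnihilatedBy H

end FreeEnergies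

/-! ### Multidifferentials and loop equations -/

section LoopEquations

variable {p q r : ℕ} (S : CurveData p q r) (Z : FreeEnergies p q r)

/-- `∑_i dξ_{-i_1}(z_1) ⋯ dξ_{-i_n}(z_n) F_{g,n}[i_1, …, i_n]`; the sign comes from moving all
coefficients to the right of the basis elements. -/
def stableDiff (g n : ℕ) : MultiDiff p q r n := fun m =>
  ∑ᶠ i : Fin n → Coord r,
    (-1 : ℂ) ^ (∑ k : Fin n, ∑ l ∈ Finset.Ioi k, (par (i k) + par (m k)) * par (m l)) •
      ((List.ofFn fun k => S.dxi (i k) (m k)).prod * Z.F g n i)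

/-- The multidifferentials `ω_{g,n}`, where the standard bidifferentials at the punctures are left
out of `ω_{0,2}`. -/
def omegaReg : (g n : ℕ) → MultiDiff p q r n
  | 0, 1 => fun m => S.omega01 (m 0)
  | 0, 2 => fun m => S.regB (m 0) (m 1) + stableDiff S Z 0 2 m
  | g, n => stableDiff S Z g n

/-- The multidifferentials `ω_{g,n}(z_1, …, z_n)`, expanded for `|z_1| < |z_2|` in the case
of `ω_{0,2}`. -/
def omega : (g n : ℕ) → MultiDiff p q r n
  | 0, 2 => fun m => ramondB (m 0) (m 1) + omegaReg S Z 0 2 m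
  | g, n => omegaReg S Z g n

/-- `ω_{g,n+1}(z, z_[n]) + ω_{g,n+1}(σ_a(z), z_[n])` with `z` in the disc of the mode `m₀`: the
coefficient of `e_{m₀}(z) e_{m_1}(z_1) ⋯ e_{m_n}(z_n)`. -/
def loop1 (g n : ℕ) (m₀ : Mode r) : MultiDiff p q r n := fun m =>
  omega S Z g (n + 1) (Fin.cons m₀ m) + sigmaSign m₀ • omega S Z g (n + 1) (Fin.cons m₀ m)

/-- The coefficient of `e_{m₀}(z) e_{m₀'}(z') e_{m_1}(z_1) ⋯ e_{m_n}(z_n)` in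
`ω_{g₁,|I|+1}(z, z_I) ω_{g₂,|J|+1}(z', z_J)`, where `J` is the complement of `I`. -/
def omegaProd (g₁ g₂ n : ℕ) (I : Finset (Fin n)) (m : Fin n → Mode r) (m₀ m₀' : Mode r) :
    BaseRing p q :=
  (-1 : ℂ) ^ (par m₀ * par m₀' + (par m₀ + ∑ i ∈ I, par (m i)) * (∑ j ∈ Iᶜ, par (m j)) +
      ∑ i ∈ I, ∑ j ∈ Iᶜ, if j < i then par (m i) * par (m j) else 0) •
    (omega S Z g₁ (I.card + 1) (Fin.cons m₀ (m ∘ I.orderEmbOfFin rfl)) *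
      omega S Z g₂ (Iᶜ.card + 1) (Fin.cons m₀' (m ∘ Iᶜ.orderEmbOfFin rfl)))

/-- `C^{σ_a}(ω_{g,n+2})(z; z_[n])`: the coefficients of `[dθ_a]³ z^N` and `[dθ_a]³ θ_a z^N` times
`e_{m_1}(z_1) ⋯ e_{m_n}(z_n)`. -/
def casimirOmega (a : Fin r) (g n : ℕ) (m : Fin n → Mode r) :
    (ℤ → BaseRing p q) × (ℤ → BaseRing p q) :=
  casimir a (fun m₀ m₀' => omegaReg S Z g (n + 2) (Fin.cons m₀ (Fin.cons m₀' m))) +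
    if g = 0 ∧ n = 0 then casimirRamond p q else 0

/-- `C^{σ_a}(ω_{g-1,n+2})(z; z_[n])
+ C^{σ_a}(∑_{g₁+g₂=g, I⊔J=[n]} ω_{g₁,|I|+1} ⊗ ω_{g₂,|J|+1})(z; z_I; z_J)`, where the first term is
absent for `g = 0`. -/
def loop2 (a : Fin r) (g n : ℕ) (m : Fin n → Mode r) :
    (ℤ → BaseRing p q) × (ℤ → BaseRing p q) :=
  (if g = 0 then 0 else casimirOmega S Z a (g - 1) n m) +
    casimir a (fun m₀ m₀' => ∑ h ∈ Finset.HasAntidiagonal.antidiagonal g, ∑ I : Finset (Fin n),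
      omegaProd S Z h.1 h.2 n I m m₀ m₀')

end LoopEquations

end SuperTR

end

open scoped TensorProduct

noncomputable section

namespace SuperTR

/-! ### Derivations and supercommutativity of the free superalgebra -/

section SuperPolyLemmas

variable {I O : Type}

-- The loop equations are the constraints on `Z` rewritten in terms of currents. To each basis
-- differential `m` on a disc belongs a current `cur m`, the mode of `J` or `Γ` that multiplies it.
-- Conjugating `ħ cur m` by the dilaton shift, the change of polarisation and `Z⁻¹` gives
-- `ω_{0,1}(m) + ħ (∂_m + src_m) + ∑_χ ħ^{χ+1} ∂_m F_χ`, where `∂_m = dOp S m` is the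
-- superderivation with coefficients `dξ_{-i}(m)` and `src_m` is linear in the variables
-- (`innerDer_opT_cur`, `expInner_opPhi_cur`, `dressOne_cur`). Log `Φ` is quadratic in nonnegative
-- modes, and all of these commute with it except `Γ_{a,0}`. Therefore its commutators with a
-- current stop after the second, and the second one produces the quadratic corrections in `dξ` and
-- `dη`.
--
-- The derivations `∂_m` generate the multidifferentials: applying `∂_{m_1}, …, ∂_{m_n}` to
-- `F_{g,n}` and setting the variables to zero gives the coefficient of the polarised expansion, and
-- `∂_{m'} src_m` is the fundamental bidifferential (`vacuum_dSeq_poly`, `dOp_src`). Hence iterated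
-- derivatives of the conjugated current `m_0` in `ħ`-degree `2g + n` are the coefficients of
-- `ω_{g,n+1}` (`vacuum_dSeq_current`).
--
-- A product of two conjugated currents, acting on `1`, is a product of their multiplication parts
-- plus one derivative of the second by the first. By the Leibniz rule the former becomes the sum of
-- `ω_{g₁} ⊗ ω_{g₂}`, and the latter becomes `ω_{g-1,n+2}`, from which normal ordering removes the
-- standard bidifferential (`vacuum_dSeq_normQuad`). The signs and weights in `L_{a,2n}` and
-- `G_{a,2n+1}` are those of the Casimir operator in the coefficients of `θ z^{-2n}` and
-- `z^{-2n-1}`. The constant `ħ²/4` in `L_{a,0}` compensates the Casimir `-½` of the standard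
-- bidifferential. So the constraints of the Airy structure say that the coefficients of the
-- quadratic loop equation below order `z^{s}` vanish (`loop2_fst_eq_zero`, `loop2_snd_eq_zero`).
--
-- The remaining coefficients have the wrong parity under `σ_a` and cancel automatically. The linear
-- loop equation is the same statement for the modes `J_{a,2j}` and `Γ_{a,2j-1}`, which commute with
-- the polarisation (`loop1_eq_zero`).

scoped instance superRing : Ring (SuperPoly I O) := Algebra.TensorProduct.instRing

scoped instance superAlgebra : Algebra ℂ (SuperPoly I O) := Algebra.TensorProduct.instAlgebra

/-- Every element is a linear combination of words in the generators, built from `1` by left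
multiplications. Identities between derivations, parity and variables can therefore be checked one
generator at a time. -/
theorem SuperPoly.induction {P : SuperPoly I O → Prop} (one : P 1)
    (add : ∀ f g, P f → P g → P (f + g)) (smul : ∀ (c : ℂ) f, P f → P (c • f))
    (even : ∀ i f, P f → P (evenVar i * f)) (odd : ∀ o f, P f → P (oddVar o * f))
    (f : SuperPoly I O) : P f := by
  have h0 : P 0 := by simpa using smul 0 1 one
  have ext : ∀ w : ExteriorAlgebra ℂ (O →₀ ℂ), P ((1 : MvPolynomial I ℂ) ⊗ₜ[ℂ] w) := by
    intro w
    induction w using CliffordAlgebra.left_induction with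
    | algebraMap r =>
      rw [Algebra.algebraMap_eq_smul_one, TensorProduct.tmul_smul]
      exact smul _ _ one
    | add x y hx hy => rw [TensorProduct.tmul_add]; exact add _ _ hx hy
    | ι_mul x m hx =>
      induction m using Finsupp.induction_linear with
      | zero => simpa using h0
      | add v w hv hw =>
        rw [map_add, add_mul, TensorProduct.tmul_add]; exact add _ _ hv hw
      | single o c =>
        have : (1 : MvPolynomial I ℂ) ⊗ₜ[ℂ] (CliffordAlgebra.ι
              (0 : QuadraticForm ℂ (O →₀ ℂ)) (Finsupp.single o c) * x) =
            c • (oddVar o * ((1 : MvPolynomial I ℂ) ⊗ₜ[ℂ] x)) := by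
          rw [oddVar, Algebra.TensorProduct.tmul_mul_tmul, ← TensorProduct.tmul_smul,
            ← smul_mul_assoc, one_mul, ← map_smul, Finsupp.smul_single, smul_eq_mul, mul_one]
        rw [this]
        exact smul _ _ (odd _ _ hx)
  induction f using TensorProduct.induction_on with
  | zero => exact h0
  | add f g hf hg => exact add _ _ hf hg
  | tmul p w =>
    induction p using MvPolynomial.induction_on with
    | C a =>
      rw [← mul_one (MvPolynomial.C a), ← MvPolynomial.smul_eq_C_mul, ← TensorProduct.smul_tmul']
      exact smul _ _ (ext w)
    | add p q hp hq => rw [TensorProduct.add_tmul]; exact add _ _ hp hq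
    | mul_X p i hp =>
      have : (p * MvPolynomial.X i) ⊗ₜ[ℂ] w = evenVar i * (p ⊗ₜ[ℂ] w) := by
        rw [evenVar, Algebra.TensorProduct.tmul_mul_tmul, one_mul, mul_comm]
      rw [this]
      exact even _ _ hp

theorem evenDeriv_mul (i : I) (f g : SuperPoly I O) :
    evenDeriv i (f * g) = evenDeriv i f * g + f * evenDeriv i g := by
  induction f using TensorProduct.induction_on with
  | zero => simp
  | add f f' hf hf' => simp only [add_mul, map_add, hf, hf']; abel
  | tmul p v =>
    induction g using TensorProduct.induction_on with
    | zero => simp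
    | add g g' hg hg' => simp only [mul_add, map_add, hg, hg']; abel
    | tmul p' v' =>
      simp [evenDeriv, Algebra.TensorProduct.tmul_mul_tmul, Derivation.leibniz,
        TensorProduct.add_tmul, mul_comm, add_comm]

/-- Contraction is an antiderivation: each vector of the first factor that it is moved across
contributes one sign. -/
theorem contractLeft_mul_involute {M : Type} [AddCommGroup M] [Module ℂ M]
    (d : Module.Dual ℂ M) (f g : ExteriorAlgebra ℂ M) :
    CliffordAlgebra.contractLeft (Q := (0 : QuadraticForm ℂ M)) d (f * g) =
      CliffordAlgebra.contractLeft (Q := (0 : QuadraticForm ℂ M)) d f * g +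
        CliffordAlgebra.involute (Q := (0 : QuadraticForm ℂ M)) f *
          CliffordAlgebra.contractLeft (Q := (0 : QuadraticForm ℂ M)) d g := by
  induction f using CliffordAlgebra.left_induction with
  | algebraMap r => simp [CliffordAlgebra.contractLeft_algebraMap_mul]
  | add x y hx hy => simp only [add_mul, map_add, hx, hy]; abel
  | ι_mul x m hx =>
    rw [mul_assoc, CliffordAlgebra.contractLeft_ι_mul, hx, CliffordAlgebra.contractLeft_ι_mul,
      map_mul, CliffordAlgebra.involute_ι]
    simp only [mul_add, sub_mul, smul_mul_assoc, neg_mul, mul_assoc]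
    abel

theorem oddDeriv_mul (o : O) (f g : SuperPoly I O) :
    oddDeriv o (f * g) = oddDeriv o f * g + parityAut f * oddDeriv o g := by
  induction f using TensorProduct.induction_on with
  | zero => simp
  | add f f' hf hf' => simp only [add_mul, map_add, hf, hf']; abel
  | tmul p v =>
    induction g using TensorProduct.induction_on with
    | zero => simp
    | add g g' hg hg' => simp only [mul_add, map_add, hg, hg']; abel
    | tmul p' v' =>
      simp only [oddDeriv, parityAut, LinearMap.lTensor_tmul, Algebra.TensorProduct.map_tmul,
        Algebra.TensorProduct.tmul_mul_tmul, contractLeft_mul_involute, TensorProduct.tmul_add,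
        AlgHom.coe_id, id]

@[simp] theorem evenDeriv_one (i : I) : evenDeriv i (1 : SuperPoly I O) = 0 := by
  simp [evenDeriv, Algebra.TensorProduct.one_def]

@[simp] theorem oddDeriv_one (o : O) : oddDeriv o (1 : SuperPoly I O) = 0 := by
  simp [oddDeriv, Algebra.TensorProduct.one_def, CliffordAlgebra.contractLeft_one]

@[simp] theorem evenDeriv_oddVar (i : I) (o : O) :
    evenDeriv i (oddVar o : SuperPoly I O) = 0 := by
  simp [evenDeriv, oddVar]

@[simp] theorem oddDeriv_evenVar (i : I) (o : O) :
    oddDeriv o (evenVar i : SuperPoly I O) = 0 := by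
  simp [oddDeriv, evenVar, CliffordAlgebra.contractLeft_one]

theorem evenDeriv_evenVar [DecidableEq I] (i j : I) :
    evenDeriv i (evenVar j : SuperPoly I O) = if i = j then 1 else 0 := by
  simp [evenDeriv, evenVar, MvPolynomial.pderiv_X, Pi.single_apply, Algebra.TensorProduct.one_def]
  split_ifs <;> simp_all

theorem oddDeriv_oddVar [DecidableEq O] (i j : O) :
    oddDeriv i (oddVar j : SuperPoly I O) = if i = j then 1 else 0 := by
  have : CliffordAlgebra.contractLeft (Q := (0 : QuadraticForm ℂ (O →₀ ℂ))) (Finsupp.lapply i)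
      (CliffordAlgebra.ι (0 : QuadraticForm ℂ (O →₀ ℂ)) (Finsupp.single j 1)) =
      algebraMap ℂ _ (if i = j then 1 else 0) := by
    rw [CliffordAlgebra.contractLeft_ι]
    simp [Finsupp.single_apply, eq_comm]
  simp only [oddDeriv, oddVar, LinearMap.lTensor_tmul]
  erw [this]
  split_ifs <;> simp [Algebra.TensorProduct.one_def]

@[simp] theorem parityAut_evenVar (i : I) :
    parityAut (evenVar i : SuperPoly I O) = evenVar i := by
  simp [parityAut, evenVar]

@[simp] theorem parityAut_oddVar (o : O) :
    parityAut (oddVar o : SuperPoly I O) = -oddVar o := by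
  simp only [parityAut, oddVar, Algebra.TensorProduct.map_tmul, map_one]
  erw [CliffordAlgebra.involute_ι]
  rw [TensorProduct.tmul_neg]

@[simp] theorem parityAut_parityAut (f : SuperPoly I O) : parityAut (parityAut f) = f := by
  induction f using SuperPoly.induction <;> simp_all

theorem parityAut_evenDeriv (i : I) (f : SuperPoly I O) :
    parityAut (evenDeriv i f) = evenDeriv i (parityAut f) := by
  classical
  induction f using SuperPoly.induction with
  | one => simp
  | add f g hf hg => simp [hf, hg]
  | smul c f hf => simp [hf]
  | even j f hf =>
    simp only [evenDeriv_mul, evenDeriv_evenVar, map_add, map_mul, parityAut_evenVar, hf]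
    split_ifs <;> simp
  | odd j f hf => simp [evenDeriv_mul, hf]

theorem parityAut_oddDeriv (o : O) (f : SuperPoly I O) :
    parityAut (oddDeriv o f) = -oddDeriv o (parityAut f) := by
  classical
  induction f using SuperPoly.induction with
  | one => simp
  | add f g hf hg => simp [hf, hg, add_comm]
  | smul c f hf => simp [hf]
  | even j f hf => simp [oddDeriv_mul, hf]
  | odd j f hf =>
    simp only [oddDeriv_mul, oddDeriv_oddVar, map_add, map_mul, parityAut_oddVar, hf, map_neg,
      neg_mul, mul_neg, neg_neg]
    split_ifs <;> simp

theorem evenDeriv_comm (i j : I) (f : SuperPoly I O) :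
    evenDeriv i (evenDeriv j f) = evenDeriv j (evenDeriv i f) := by
  classical
  induction f using SuperPoly.induction with
  | one => simp
  | add f g hf hg => simp [hf, hg]
  | smul c f hf => simp [hf]
  | even k f hf =>
    simp only [evenDeriv_mul, evenDeriv_evenVar, map_add, hf]
    split_ifs <;> simp <;> abel
  | odd k f hf => simp [evenDeriv_mul, hf]

theorem evenDeriv_oddDeriv (i : I) (o : O) (f : SuperPoly I O) :
    evenDeriv i (oddDeriv o f) = oddDeriv o (evenDeriv i f) := by
  classical
  induction f using SuperPoly.induction with
  | one => simp
  | add f g hf hg => simp [hf, hg]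
  | smul c f hf => simp [hf]
  | even k f hf =>
    simp only [evenDeriv_mul, oddDeriv_mul, evenDeriv_evenVar, oddDeriv_evenVar, map_add, hf,
      parityAut_evenVar, zero_mul, zero_add]
    split_ifs <;> simp
  | odd k f hf =>
    simp only [evenDeriv_mul, oddDeriv_mul, oddDeriv_oddVar, map_add, hf, parityAut_oddVar,
      evenDeriv_oddVar, neg_mul, map_neg, zero_mul, zero_add]
    split_ifs <;> simp

theorem oddDeriv_comm (i j : O) (f : SuperPoly I O) :
    oddDeriv i (oddDeriv j f) = -oddDeriv j (oddDeriv i f) := by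
  classical
  induction f using SuperPoly.induction with
  | one => simp
  | add f g hf hg => simp [hf, hg, add_comm]
  | smul c f hf => simp [hf]
  | even k f hf => simp [oddDeriv_mul, hf]
  | odd k f hf =>
    simp only [oddDeriv_mul, oddDeriv_oddVar, map_add, hf, parityAut_oddVar, neg_mul, map_neg,
      mul_neg, neg_neg]
    split_ifs <;> simp [add_assoc]

theorem evenDeriv_finite (f : SuperPoly I O) :
    (Function.support fun i => evenDeriv i f).Finite := by
  classical
  induction f using SuperPoly.induction with
  | one => simp
  | add f g hf hg =>
    refine (hf.union hg).subset fun i hi => ?_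
    by_contra h
    simp_all
  | smul c f hf =>
    refine hf.subset fun i hi => ?_
    by_contra h
    simp_all
  | even k f hf =>
    refine (hf.union (Set.finite_singleton k)).subset fun i hi => ?_
    by_contra h
    simp_all [evenDeriv_mul, evenDeriv_evenVar]
  | odd k f hf =>
    refine hf.subset fun i hi => ?_
    by_contra h
    simp_all [evenDeriv_mul]

theorem oddDeriv_finite (f : SuperPoly I O) :
    (Function.support fun i => oddDeriv i f).Finite := by
  classical
  induction f using SuperPoly.induction with
  | one => simp
  | add f g hf hg =>
    refine (hf.union hg).subset fun i hi => ?_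
    by_contra h
    simp_all
  | smul c f hf =>
    refine hf.subset fun i hi => ?_
    by_contra h
    simp_all
  | odd k f hf =>
    refine (hf.union (Set.finite_singleton k)).subset fun i hi => ?_
    by_contra h
    simp_all [oddDeriv_mul, oddDeriv_oddVar]
  | even k f hf =>
    refine hf.subset fun i hi => ?_
    by_contra h
    simp_all [oddDeriv_mul]

theorem evenVar_mul (i : I) (f : SuperPoly I O) : evenVar i * f = f * evenVar i := by
  induction f using TensorProduct.induction_on with
  | zero => simp
  | add f f' hf hf' => simp only [add_mul, mul_add, hf, hf']
  | tmul p v => simp [evenVar, Algebra.TensorProduct.tmul_mul_tmul, mul_comm]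

theorem oddVar_mul_oddVar (o o' : O) :
    (oddVar o * oddVar o' : SuperPoly I O) = -(oddVar o' * oddVar o) := by
  have := CliffordAlgebra.ι_mul_ι_add_swap (Q := (0 : QuadraticForm ℂ (O →₀ ℂ)))
    (Finsupp.single o 1) (Finsupp.single o' 1)
  simp only [QuadraticMap.polar, zero_apply, sub_zero, map_zero] at this
  have h := eq_neg_of_add_eq_zero_left this
  simp only [oddVar, Algebra.TensorProduct.tmul_mul_tmul, mul_one]
  erw [h]
  rw [TensorProduct.tmul_neg]

theorem oddVar_mul (o : O) (f : SuperPoly I O) : oddVar o * f = parityAut f * oddVar o := by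
  induction f using SuperPoly.induction with
  | one => simp
  | add f g hf hg => simp [add_mul, mul_add, hf, hg]
  | smul c f hf => simp [hf]
  | even k f hf =>
    rw [← mul_assoc, ← evenVar_mul, mul_assoc, hf, map_mul, parityAut_evenVar, mul_assoc]
  | odd k f hf =>
    rw [← mul_assoc, oddVar_mul_oddVar, neg_mul, mul_assoc, hf, map_mul, parityAut_oddVar]
    simp [mul_assoc]

/-- The even part is central and the odd part supercommutes. One induction proves both, because left
multiplication by an odd variable exchanges the sum with the difference. -/
theorem even_part_mul (f g : SuperPoly I O) :
    (f + parityAut f) * g = g * (f + parityAut f) ∧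
      (f - parityAut f) * g = parityAut g * (f - parityAut f) := by
  induction f using SuperPoly.induction generalizing g with
  | one => simp [mul_add, add_mul]
  | add f f' hf hf' =>
    have e1 : f + f' + parityAut (f + f') = (f + parityAut f) + (f' + parityAut f') := by
      rw [map_add]; abel
    have e2 : f + f' - parityAut (f + f') = (f - parityAut f) + (f' - parityAut f') := by
      rw [map_add]; abel
    refine ⟨?_, ?_⟩
    · rw [e1, add_mul, (hf g).1, (hf' g).1, ← mul_add]
    · rw [e2, add_mul, (hf g).2, (hf' g).2, ← mul_add]
  | smul c f hf =>
    rw [map_smul, ← smul_add, ← smul_sub, smul_mul_assoc, mul_smul_comm, smul_mul_assoc,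
      mul_smul_comm, (hf g).1, (hf g).2]
    exact ⟨rfl, rfl⟩
  | even k f hf =>
    rw [map_mul, parityAut_evenVar, ← mul_add, ← mul_sub]
    refine ⟨?_, ?_⟩
    · rw [mul_assoc, (hf g).1, ← mul_assoc, evenVar_mul, mul_assoc]
    · rw [mul_assoc, (hf g).2, ← mul_assoc, evenVar_mul, mul_assoc]
  | odd k f hf =>
    rw [map_mul, parityAut_oddVar, neg_mul, ← sub_eq_add_neg, sub_neg_eq_add, ← mul_sub,
      ← mul_add]
    refine ⟨?_, ?_⟩
    · rw [mul_assoc, (hf g).2, ← mul_assoc, oddVar_mul, parityAut_parityAut, mul_assoc]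
    · rw [mul_assoc, (hf g).1, ← mul_assoc, oddVar_mul, mul_assoc]

namespace HasParity

theorem zero (d : ℕ) : HasParity d (0 : SuperPoly I O) := by simp [HasParity]

theorem one : HasParity 0 (1 : SuperPoly I O) := by simp [HasParity]

theorem congr {d d' : ℕ} {f : SuperPoly I O} (h : HasParity d f) (e : d % 2 = d' % 2) :
    HasParity d' f := by
  rw [HasParity, neg_one_pow_eq_pow_mod_two, ← e, ← neg_one_pow_eq_pow_mod_two]
  exact h

theorem mul {d d' : ℕ} {f g : SuperPoly I O} (hf : HasParity d f) (hg : HasParity d' g) :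
    HasParity (d + d') (f * g) := by
  rw [HasParity, map_mul, hf, hg, smul_mul_assoc, mul_smul_comm, smul_smul, pow_add]

theorem add {d : ℕ} {f g : SuperPoly I O} (hf : HasParity d f) (hg : HasParity d g) :
    HasParity d (f + g) := by
  rw [HasParity, map_add, hf, hg, smul_add]

theorem smul {d : ℕ} {f : SuperPoly I O} (c : ℂ) (hf : HasParity d f) : HasParity d (c • f) := by
  rw [HasParity, map_smul, hf, smul_comm]

theorem sum {ι : Type*} {d : ℕ} {f : ι → SuperPoly I O} (s : Finset ι)
    (hf : ∀ i ∈ s, HasParity d (f i)) : HasParity d (∑ i ∈ s, f i) := by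
  rw [HasParity, map_sum, Finset.smul_sum]
  exact Finset.sum_congr rfl hf

theorem finsum {ι : Type*} {d : ℕ} {f : ι → SuperPoly I O}
    (hf : ∀ i, HasParity d (f i)) : HasParity d (∑ᶠ i, f i) :=
  finsum_induction _ (zero d) (fun _ _ => add) hf

theorem evenVar (i : I) : HasParity 0 (evenVar i : SuperPoly I O) := by simp [HasParity]

theorem oddVar (o : O) : HasParity 1 (oddVar o : SuperPoly I O) := by simp [HasParity]

theorem evenDeriv {d : ℕ} {f : SuperPoly I O} (i : I) (hf : HasParity d f) :
    HasParity d (evenDeriv i f) := by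
  rw [HasParity, parityAut_evenDeriv, hf, map_smul]

theorem oddDeriv {d : ℕ} {f : SuperPoly I O} (o : O) (hf : HasParity d f) :
    HasParity (1 + d) (oddDeriv o f) := by
  rw [HasParity, parityAut_oddDeriv, hf, map_smul, pow_add]
  simp

/-- Homogeneous elements supercommute. -/
theorem mul_comm {d d' : ℕ} {f g : SuperPoly I O} (hf : HasParity d f) (hg : HasParity d' g) :
    f * g = (-1 : ℂ) ^ (d * d') • (g * f) := by
  obtain ⟨h1, h2⟩ := even_part_mul f g
  -- For homogeneous `f` one of `f ± parityAut f` is `2 f`, and the factor 2 can be cancelled.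
  have two : ∀ x y : SuperPoly I O, (2 : ℂ) • x = (2 : ℂ) • y → x = y :=
    fun x y h => smul_right_injective _ (two_ne_zero) h
  rcases Nat.even_or_odd d with hd | hd
  · have e : parityAut f = f := by rw [hf, hd.neg_one_pow, one_smul]
    rw [(hd.mul_right d').neg_one_pow, one_smul]
    rw [e, ← two_smul ℂ f, smul_mul_assoc, mul_smul_comm] at h1
    exact two _ _ h1
  · have e : parityAut f = -f := by rw [hf, hd.neg_one_pow, neg_one_smul]
    rw [pow_mul, hd.neg_one_pow]
    rw [e, sub_neg_eq_add, ← two_smul ℂ f, hg, smul_mul_assoc, mul_smul_comm, smul_mul_assoc] at h2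
    exact two _ _ h2

theorem oddDeriv_mul {d : ℕ} {f : SuperPoly I O} (o : O) (hf : HasParity d f)
    (g : SuperPoly I O) :
    SuperTR.oddDeriv o (f * g) =
      SuperTR.oddDeriv o f * g + (-1 : ℂ) ^ d • (f * SuperTR.oddDeriv o g) := by
  rw [SuperTR.oddDeriv_mul, hf, smul_mul_assoc]

end HasParity

end SuperPolyLemmas


scoped instance opRing {I O : Type} : Ring (Module.End ℂ (SuperPoly I O)) := Module.End.instRing

scoped instance opAlgebra {I O : Type} : Algebra ℂ (Module.End ℂ (SuperPoly I O)) :=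
  Module.End.instAlgebra ℂ ℂ _

/-! ### Pointwise finite sums of operators -/

section HasOpSum

variable {M ι κ : Type} [AddCommGroup M] [Module ℂ M]

/-- `S` is the sum of the pointwise finite family `f` of operators. -/
def HasOpSum (f : ι → Module.End ℂ M) (S : Module.End ℂ M) : Prop :=
  ∀ v : M, (Function.support fun i => f i v).Finite ∧ S v = ∑ᶠ i, f i v

theorem hasOpSum_opSum {f : ι → Module.End ℂ M}
    (h : ∀ v : M, (Function.support fun i => f i v).Finite) : HasOpSum f (opSum f) := by
  intro v
  refine ⟨h v, ?_⟩
  rw [opSum, dif_pos h]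
  rfl

namespace HasOpSum

variable {f g : ι → Module.End ℂ M} {S T : Module.End ℂ M}

theorem opSum_eq (h : HasOpSum f S) : opSum f = S := by
  ext v
  rw [(hasOpSum_opSum fun v => (h v).1) v |>.2, (h v).2]

/-- This is how commutators with infinite sums are computed: the termwise commutator is compared
with a simpler family having the same terms. -/
theorem unique (h : HasOpSum f S) (h' : HasOpSum f T) : S = T := by
  rw [← h.opSum_eq, h'.opSum_eq]

theorem add (hf : HasOpSum f S) (hg : HasOpSum g T) : HasOpSum (fun i => f i + g i) (S + T) := by
  intro v
  have e : (fun i => (f i + g i) v) = fun i => f i v + g i v := rfl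
  refine ⟨?_, ?_⟩
  · rw [e]
    exact ((hf v).1.union (hg v).1).subset (Function.support_add _ _)
  · rw [LinearMap.add_apply, (hf v).2, (hg v).2, e, finsum_add_distrib (hf v).1 (hg v).1]

theorem smul (c : ℂ) (hf : HasOpSum f S) : HasOpSum (fun i => c • f i) (c • S) := by
  intro v
  refine ⟨(hf v).1.subset fun i hi => ?_, ?_⟩
  · simp only [Function.mem_support, LinearMap.smul_apply] at hi ⊢
    exact fun h => hi (by rw [h, smul_zero])
  · simp only [LinearMap.smul_apply, (hf v).2, smul_finsum]

theorem neg (hf : HasOpSum f S) : HasOpSum (fun i => -f i) (-S) := by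
  simpa using hf.smul (-1)

theorem sub (hf : HasOpSum f S) (hg : HasOpSum g T) : HasOpSum (fun i => f i - g i) (S - T) := by
  simpa [sub_eq_add_neg] using hf.add hg.neg

theorem mul_left (X : Module.End ℂ M) (hf : HasOpSum f S) :
    HasOpSum (fun i => X * f i) (X * S) := by
  intro v
  refine ⟨(hf v).1.subset fun i hi => ?_, ?_⟩
  · simp only [Function.mem_support, Module.End.mul_apply] at hi ⊢
    exact fun h => hi (by rw [h, map_zero])
  · simp only [Module.End.mul_apply, (hf v).2]
    exact X.toAddMonoidHom.map_finsum (hf v).1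

theorem mul_right (X : Module.End ℂ M) (hf : HasOpSum f S) :
    HasOpSum (fun i => f i * X) (S * X) := fun v => hf (X v)

theorem commutator (X : Module.End ℂ M) (hf : HasOpSum f S) :
    HasOpSum (fun i => f i * X - X * f i) (S * X - X * S) :=
  (hf.mul_right X).sub (hf.mul_left X)

theorem commutator' (X : Module.End ℂ M) (hf : HasOpSum f S) :
    HasOpSum (fun i => X * f i - f i * X) (X * S - S * X) :=
  (hf.mul_left X).sub (hf.mul_right X)

theorem congr (hf : HasOpSum f S) (h : ∀ i, g i = f i) : HasOpSum g S := by
  rwa [show g = f from funext h]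

theorem finset_sum (s : Finset ι) (h : ∀ i ∉ s, f i = 0) : HasOpSum f (∑ i ∈ s, f i) := by
  intro v
  have hs : (Function.support fun i => f i v) ⊆ s := fun i hi => by
    by_contra hn
    exact hi (by simp [h i hn])
  refine ⟨s.finite_toSet.subset hs, ?_⟩
  rw [finsum_eq_sum_of_support_subset _ hs, LinearMap.sum_apply]

theorem single (i : ι) (h : ∀ j ≠ i, f j = 0) : HasOpSum f (f i) := by
  simpa using finset_sum (f := f) {i} (fun j hj => h j (by simpa using hj))

theorem zero : HasOpSum (fun _ : ι => (0 : Module.End ℂ M)) 0 := by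
  simpa using finset_sum (f := fun _ : ι => (0 : Module.End ℂ M)) ∅ (fun _ _ => rfl)

/-- Terms outside the image of `e` vanish, so sums over different index sets can be brought to a
common one. -/
theorem extend (e : κ → ι) (he : Function.Injective e) (hf : HasOpSum (f ∘ e) S)
    (h0 : ∀ i ∉ Set.range e, f i = 0) : HasOpSum f S := by
  intro v
  have hs : (Function.support fun i => f i v) ⊆ Set.range e := fun i hi => by
    by_contra hn
    exact hi (by simp [h0 i hn])
  have e1 : (Function.support fun i => f i v) =
      e '' (Function.support fun k => (f ∘ e) k v) := by
    ext i
    constructor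
    · intro hi
      obtain ⟨k, rfl⟩ := hs hi
      exact ⟨k, hi, rfl⟩
    · rintro ⟨k, hk, rfl⟩
      exact hk
  refine ⟨?_, ?_⟩
  · rw [e1]
    exact (hf v).1.image _
  · rw [(hf v).2, ← finsum_mem_support (fun i => f i v), e1,
      finsum_mem_image he.injOn]
    exact (finsum_mem_support fun k => (f ∘ e) k v).symm

theorem sumElim {f' : κ → Module.End ℂ M} (hf : HasOpSum f S) (hg : HasOpSum f' T) :
    HasOpSum (Sum.elim f f') (S + T) := by
  have h1 : HasOpSum (Sum.elim f fun _ => 0 : ι ⊕ κ → Module.End ℂ M) S :=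
    extend Sum.inl Sum.inl_injective hf (by rintro (i | i) hi <;> simp_all)
  have h2 : HasOpSum (Sum.elim (fun _ => 0) f' : ι ⊕ κ → Module.End ℂ M) T :=
    extend Sum.inr Sum.inr_injective hg (by rintro (i | i) hi <;> simp_all)
  exact (h1.add h2).congr (by rintro (i | i) <;> simp)

theorem sum {γ : Type} (s : Finset γ) {f : γ → ι → Module.End ℂ M} {S : γ → Module.End ℂ M}
    (h : ∀ c ∈ s, HasOpSum (f c) (S c)) : HasOpSum (fun i => ∑ c ∈ s, f c i) (∑ c ∈ s, S c) := by
  classical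
  induction s using Finset.induction_on with
  | empty => simpa using zero
  | insert c s hc ih =>
    simp only [Finset.sum_insert hc]
    exact (h c (by simp)).add (ih fun d hd => h d (by simp [hd]))

end HasOpSum

end HasOpSum

/-! ### The polynomial superalgebra over the base ring -/

section Fock

variable {p q r : ℕ}

/-- The derivative with respect to the variable with a given index. -/
def coordDeriv : Coord r → Module.End ℂ (Fock p q r) :=
  Sum.elim (fun i => evenDeriv (Sum.inr i)) (fun i => oddDeriv (Sum.inr i))

@[simp] theorem baseIncl_evenVar (i : Fin p) :
    baseIncl p q r (evenVar i) = evenVar (Sum.inl i) := by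
  simp [baseIncl, evenVar]

@[simp] theorem baseIncl_oddVar (i : Fin q) :
    baseIncl p q r (oddVar i) = oddVar (Sum.inl i) := by
  simp only [baseIncl, oddVar, Algebra.TensorProduct.map_tmul, map_one]
  rw [ExteriorAlgebra.map_apply_ι]
  simp [Finsupp.lmapDomain_apply, Finsupp.mapDomain_single]

theorem parityAut_baseIncl (c : BaseRing p q) :
    parityAut (baseIncl p q r c) = baseIncl p q r (parityAut c) := by
  induction c using SuperPoly.induction <;> simp_all

theorem HasParity.baseIncl {d : ℕ} {c : BaseRing p q} (hc : HasParity d c) :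
    HasParity d (baseIncl p q r c) := by
  rw [HasParity, parityAut_baseIncl, hc, map_smul]

theorem HasParity.coordVar (i : Coord r) :
    HasParity (par i) (coordVar i : Fock p q r) := by
  rcases i with i | i
  · exact HasParity.evenVar _
  · exact HasParity.oddVar _

theorem HasParity.coordDeriv {d : ℕ} {f : Fock p q r} (i : Coord r) (hf : HasParity d f) :
    HasParity (par i + d) (coordDeriv i f) := by
  rcases i with i | i
  · simpa [par, SuperTR.coordDeriv] using hf.evenDeriv _
  · exact hf.oddDeriv _

theorem coordDeriv_mul {d : ℕ} {f : Fock p q r} (i : Coord r) (hf : HasParity d f)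
    (g : Fock p q r) :
    coordDeriv i (f * g) =
      coordDeriv i f * g + (-1 : ℂ) ^ (par i * d) • (f * coordDeriv i g) := by
  rcases i with i | i
  · simp [coordDeriv, par, evenDeriv_mul]
  · simp [coordDeriv, par, hf.oddDeriv_mul]

@[simp] theorem evenDeriv_baseIncl (i : Fin r × ℕ+) (c : BaseRing p q) :
    evenDeriv (Sum.inr i) (baseIncl p q r c) = 0 := by
  classical
  induction c using SuperPoly.induction <;> simp_all [evenDeriv_mul, evenDeriv_evenVar]

@[simp] theorem oddDeriv_baseIncl (i : Fin r × ℕ) (c : BaseRing p q) :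
    oddDeriv (Sum.inr i) (baseIncl p q r c) = 0 := by
  classical
  induction c using SuperPoly.induction <;> simp_all [oddDeriv_mul, oddDeriv_oddVar]

@[simp] theorem coordDeriv_baseIncl (i : Coord r) (c : BaseRing p q) :
    coordDeriv i (baseIncl p q r c) = 0 := by
  rcases i with i | i <;> simp [coordDeriv]

theorem coordDeriv_coordVar (i j : Coord r) :
    coordDeriv i (coordVar j : Fock p q r) = if i = j then 1 else 0 := by
  classical
  rcases i with i | i <;> rcases j with j | j <;>
    simp [coordDeriv, coordVar, evenDeriv_evenVar, oddDeriv_oddVar]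

theorem coordDeriv_comm (i j : Coord r) (f : Fock p q r) :
    coordDeriv i (coordDeriv j f) =
      (-1 : ℂ) ^ (par i * par j) • coordDeriv j (coordDeriv i f) := by
  rcases i with i | i <;> rcases j with j | j <;> simp [coordDeriv, par]
  · exact evenDeriv_comm _ _ _
  · exact evenDeriv_oddDeriv _ _ _
  · exact (evenDeriv_oddDeriv _ _ _).symm
  · exact oddDeriv_comm _ _ _

theorem coordDeriv_finite (f : Fock p q r) :
    (Function.support fun i => coordDeriv i f).Finite := by
  have h1 := (evenDeriv_finite f).preimage (Sum.inr_injective.injOn (s := Set.univ) |>.mono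
    (Set.subset_univ _))
  have h2 := (oddDeriv_finite f).preimage (Sum.inr_injective.injOn (s := Set.univ) |>.mono
    (Set.subset_univ _))
  refine ((h1.image Sum.inl).union (h2.image Sum.inr)).subset ?_
  rintro (i | i) hi
  · exact Or.inl ⟨i, hi, rfl⟩
  · exact Or.inr ⟨i, hi, rfl⟩

theorem mulBase_apply (c : BaseRing p q) (v : Fock p q r) :
    mulBase c v = baseIncl p q r c * v := rfl

theorem mulBase_mul (c c' : BaseRing p q) :
    (mulBase c * mulBase c' : Module.End ℂ (Fock p q r)) = mulBase (c * c') := by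
  refine LinearMap.ext fun v => ?_
  simp [mulBase_apply, mul_assoc]

theorem mulBase_add (c c' : BaseRing p q) :
    (mulBase (c + c') : Module.End ℂ (Fock p q r)) = mulBase c + mulBase c' := by
  refine LinearMap.ext fun v => ?_
  simp [mulBase_apply, add_mul]

theorem mulBase_smul (x : ℂ) (c : BaseRing p q) :
    (mulBase (x • c) : Module.End ℂ (Fock p q r)) = x • mulBase c := by
  refine LinearMap.ext fun v => ?_
  simp [mulBase_apply]

theorem mulBase_zero : (mulBase 0 : Module.End ℂ (Fock p q r)) = 0 := by
  refine LinearMap.ext fun v => ?_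
  simp [mulBase_apply]

theorem mulBase_sum {ι : Type} (s : Finset ι) (c : ι → BaseRing p q) :
    (mulBase (∑ i ∈ s, c i) : Module.End ℂ (Fock p q r)) = ∑ i ∈ s, mulBase (c i) := by
  refine LinearMap.ext fun v => ?_
  simp [mulBase_apply, Finset.sum_mul]

/-! ### Relations between the modes -/

theorem int_cases_pnat (k : ℤ) : k = 0 ∨ (∃ n : ℕ+, k = n) ∨ ∃ n : ℕ+, k = -(n : ℤ) := by
  rcases lt_trichotomy k 0 with h | h | h
  · exact Or.inr (Or.inr ⟨⟨(-k).toNat, by omega⟩, by simp; omega⟩)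
  · exact Or.inl h
  · exact Or.inr (Or.inl ⟨⟨k.toNat, by omega⟩, by simp; omega⟩)

@[simp] theorem modeJ_zero (a : Fin r) : (modeJ a 0 : Module.End ℂ (Fock p q r)) = 0 := rfl

@[simp] theorem modeJ_pos (a : Fin r) (k : ℕ+) :
    (modeJ a (k : ℤ) : Module.End ℂ (Fock p q r)) = evenDeriv (Sum.inr (a, k)) := by
  obtain ⟨k, rfl⟩ : ∃ m : ℕ, k = m.succPNat := ⟨k.natPred, by simp⟩
  rfl

@[simp] theorem modeJ_neg (a : Fin r) (k : ℕ+) :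
    (modeJ a (-(k : ℤ)) : Module.End ℂ (Fock p q r)) =
      (k : ℂ) • LinearMap.mulLeft ℂ (evenVar (Sum.inr (a, k))) := by
  obtain ⟨k, rfl⟩ : ∃ m : ℕ, k = m.succPNat := ⟨k.natPred, by simp⟩
  have : -((k.succPNat : ℕ) : ℤ) = Int.negSucc k := by simp [Int.negSucc_eq]
  rw [this]
  simp [modeJ]

theorem modeG_zero (a : Fin r) : (modeG a 0 : Module.End ℂ (Fock p q r)) =
    (1 / 2 : ℂ) • LinearMap.mulLeft ℂ (oddVar (Sum.inr (a, 0))) +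
      oddDeriv (Sum.inr (a, 0)) := rfl

@[simp] theorem modeG_pos (a : Fin r) (k : ℕ+) :
    (modeG a (k : ℤ) : Module.End ℂ (Fock p q r)) = oddDeriv (Sum.inr (a, (k : ℕ))) := by
  obtain ⟨k, rfl⟩ : ∃ m : ℕ, k = m.succPNat := ⟨k.natPred, by simp⟩
  rfl

@[simp] theorem modeG_neg (a : Fin r) (k : ℕ+) :
    (modeG a (-(k : ℤ)) : Module.End ℂ (Fock p q r)) =
      LinearMap.mulLeft ℂ (oddVar (Sum.inr (a, (k : ℕ)))) := by
  obtain ⟨k, rfl⟩ : ∃ m : ℕ, k = m.succPNat := ⟨k.natPred, by simp⟩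
  have : -((k.succPNat : ℕ) : ℤ) = Int.negSucc k := by simp [Int.negSucc_eq]
  rw [this]
  rfl

/-- The central term is `k` because the creation mode carries the factor `k` in `J_{a,-k} = ħ k
x^{a,k}`. -/
theorem modeJ_comm (a b : Fin r) (k l : ℤ) :
    (modeJ a k * modeJ b l : Module.End ℂ (Fock p q r)) =
      modeJ b l * modeJ a k + (if a = b ∧ k + l = 0 then (k : ℂ) else 0) • 1 := by
  classical
  rcases int_cases_pnat k with rfl | ⟨k, rfl⟩ | ⟨k, rfl⟩ <;>
    rcases int_cases_pnat l with rfl | ⟨l, rfl⟩ | ⟨l, rfl⟩ <;> refine LinearMap.ext fun v => ?_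
  · simp
  · simp
  · simp
  · simp
  · have := k.pos; have := l.pos
    rw [if_neg (by omega)]
    simp [evenDeriv_comm (Sum.inr (a, k))]
  · have : (k : ℤ) + -(l : ℤ) = 0 ↔ k = l := by rw [← PNat.coe_inj]; omega
    simp only [modeJ_pos, modeJ_neg, Module.End.mul_apply, LinearMap.smul_apply, map_smul,
      LinearMap.mulLeft_apply, evenDeriv_mul, evenDeriv_evenVar, LinearMap.add_apply, this,
      Sum.inr.injEq, Prod.mk.injEq]
    split_ifs with h
    · rw [h.2]; simp [add_comm]
    · simp
  · simp
  · have : -(k : ℤ) + (l : ℤ) = 0 ↔ k = l := by rw [← PNat.coe_inj]; omega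
    simp only [modeJ_pos, modeJ_neg, Module.End.mul_apply, LinearMap.smul_apply, map_smul,
      LinearMap.mulLeft_apply, evenDeriv_mul, evenDeriv_evenVar, LinearMap.add_apply, this,
      Sum.inr.injEq, Prod.mk.injEq, eq_comm (a := b), eq_comm (a := l)]
    split_ifs with h
    · rw [h.2]; simp
    · simp
  · have := k.pos; have := l.pos
    rw [if_neg (by omega)]
    simp only [modeJ_neg, Module.End.mul_apply, LinearMap.smul_apply, map_smul,
      LinearMap.mulLeft_apply, LinearMap.add_apply, zero_smul, LinearMap.zero_apply, add_zero]
    rw [smul_comm, ← mul_assoc, evenVar_mul, mul_assoc]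

/-- The zero mode fits the same formula: `½θ + ∂` squares to `½`, which is half of the central term.
-/
theorem modeG_anticomm (a b : Fin r) (k l : ℤ) :
    (modeG a k * modeG b l : Module.End ℂ (Fock p q r)) =
      -(modeG b l * modeG a k) + (if a = b ∧ k + l = 0 then (1 : ℂ) else 0) • 1 := by
  classical
  have hoo : ∀ (o o' : Fin q ⊕ Fin r × ℕ) (v : Fock p q r),
      oddVar o * (oddVar o' * v) = -(oddVar o' * (oddVar o * v)) := fun o o' v => by
    rw [← mul_assoc, oddVar_mul_oddVar, neg_mul, mul_assoc]
  rcases int_cases_pnat k with rfl | ⟨k, rfl⟩ | ⟨k, rfl⟩ <;>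
    rcases int_cases_pnat l with rfl | ⟨l, rfl⟩ | ⟨l, rfl⟩ <;> refine LinearMap.ext fun v => ?_
  · simp only [modeG_zero, Module.End.mul_apply, LinearMap.smul_apply, map_smul, map_add,
      LinearMap.mulLeft_apply, oddDeriv_mul, oddDeriv_oddVar, LinearMap.add_apply, smul_add,
      LinearMap.neg_apply, parityAut_oddVar, neg_mul, Sum.inr.injEq, Prod.mk.injEq, and_true,
      add_zero, eq_comm (a := b) (b := a), hoo (Sum.inr (a, 0)) (Sum.inr (b, 0)),
      oddDeriv_comm (Sum.inr (a, 0)) (Sum.inr (b, 0)), Module.End.one_apply, ite_mul, one_mul,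
      zero_mul]
    split_ifs <;> module
  · have := l.pos
    rw [if_neg (by omega)]
    have hl : ¬ ((l : ℕ) = 0) := by omega
    simp only [modeG_zero, modeG_pos, Module.End.mul_apply, LinearMap.smul_apply, map_smul, map_add,
      LinearMap.mulLeft_apply, oddDeriv_mul, oddDeriv_oddVar, LinearMap.add_apply, smul_add,
      LinearMap.neg_apply, parityAut_oddVar, neg_mul, Sum.inr.injEq, Prod.mk.injEq,
      oddDeriv_comm (Sum.inr (a, 0)) (Sum.inr (b, (l : ℕ))), hl, and_false, if_false, zero_mul]
    module
  · have := l.pos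
    rw [if_neg (by omega)]
    have hl : ¬ (0 = (l : ℕ)) := by omega
    simp only [modeG_zero, modeG_neg, Module.End.mul_apply, LinearMap.smul_apply, map_smul, map_add,
      LinearMap.mulLeft_apply, oddDeriv_mul, oddDeriv_oddVar, LinearMap.add_apply, smul_add,
      LinearMap.neg_apply, parityAut_oddVar, neg_mul, Sum.inr.injEq, Prod.mk.injEq, mul_add,
      mul_smul_comm, hoo (Sum.inr (a, 0)), hl, and_false, if_false, zero_mul]
    module
  · have := k.pos
    rw [if_neg (by omega)]
    have hl : ¬ ((k : ℕ) = 0) := by omega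
    simp only [modeG_zero, modeG_pos, Module.End.mul_apply, LinearMap.smul_apply, map_smul, map_add,
      LinearMap.mulLeft_apply, oddDeriv_mul, oddDeriv_oddVar, LinearMap.add_apply, smul_add,
      LinearMap.neg_apply, parityAut_oddVar, neg_mul, Sum.inr.injEq, Prod.mk.injEq,
      oddDeriv_comm (Sum.inr (a, (k : ℕ))) (Sum.inr (b, 0)), hl, and_false, if_false, zero_mul]
    module
  · have := k.pos; have := l.pos
    rw [if_neg (by omega)]
    simp [oddDeriv_comm (Sum.inr (a, (k : ℕ)))]
  · have : (k : ℤ) + -(l : ℤ) = 0 ↔ (k : ℕ) = l := by omega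
    simp only [modeG_pos, modeG_neg, Module.End.mul_apply, LinearMap.smul_apply,
      LinearMap.mulLeft_apply, oddDeriv_mul, oddDeriv_oddVar, LinearMap.add_apply, this,
      Sum.inr.injEq, Prod.mk.injEq, LinearMap.neg_apply, parityAut_oddVar, neg_mul, ite_mul,
      one_mul, zero_mul, Module.End.one_apply]
    split_ifs <;> module
  · have := k.pos
    rw [if_neg (by omega)]
    have hl : ¬ (0 = (k : ℕ)) := by omega
    simp only [modeG_zero, modeG_neg, Module.End.mul_apply, LinearMap.smul_apply, map_smul, map_add,
      LinearMap.mulLeft_apply, oddDeriv_mul, oddDeriv_oddVar, LinearMap.add_apply, smul_add,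
      LinearMap.neg_apply, parityAut_oddVar, neg_mul, Sum.inr.injEq, Prod.mk.injEq, mul_add,
      mul_smul_comm, hoo (Sum.inr (a, (k : ℕ))), hl, and_false, if_false, zero_mul]
    module
  · have : -(k : ℤ) + (l : ℤ) = 0 ↔ (k : ℕ) = l := by omega
    simp only [modeG_pos, modeG_neg, Module.End.mul_apply, LinearMap.smul_apply,
      LinearMap.mulLeft_apply, oddDeriv_mul, oddDeriv_oddVar, LinearMap.add_apply, this,
      Sum.inr.injEq, Prod.mk.injEq, LinearMap.neg_apply, parityAut_oddVar, neg_mul, ite_mul,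
      one_mul, zero_mul, Module.End.one_apply, eq_comm (a := b), eq_comm (a := (l : ℕ))]
    split_ifs <;> module
  · have := k.pos; have := l.pos
    rw [if_neg (by omega)]
    simp [hoo (Sum.inr (a, (k : ℕ)))]

theorem modeJ_modeG (a b : Fin r) (k l : ℤ) :
    (modeJ a k * modeG b l : Module.End ℂ (Fock p q r)) = modeG b l * modeJ a k := by
  have hoe : ∀ (i : Fin p ⊕ Fin r × ℕ+) (o : Fin q ⊕ Fin r × ℕ) (v : Fock p q r),
      evenVar i * (oddVar o * v) = oddVar o * (evenVar i * v) := fun o o' v => by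
    rw [← mul_assoc, evenVar_mul, mul_assoc]
  rcases int_cases_pnat k with rfl | ⟨k, rfl⟩ | ⟨k, rfl⟩ <;>
    rcases int_cases_pnat l with rfl | ⟨l, rfl⟩ | ⟨l, rfl⟩ <;> refine LinearMap.ext fun v => ?_ <;>
    simp [modeG_zero, evenDeriv_mul, oddDeriv_mul, evenDeriv_oddDeriv, hoe, mul_add, smul_add, smul_smul,
      mul_comm]

theorem modeJ_mulBase (a : Fin r) (k : ℤ) (c : BaseRing p q) :
    (modeJ a k * mulBase c : Module.End ℂ (Fock p q r)) = mulBase c * modeJ a k := by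
  rcases int_cases_pnat k with rfl | ⟨k, rfl⟩ | ⟨k, rfl⟩ <;> refine LinearMap.ext fun v => ?_
  · simp
  · simp [mulBase_apply, evenDeriv_mul]
  · simp only [modeJ_neg, Module.End.mul_apply, mulBase_apply, LinearMap.smul_apply,
      LinearMap.mulLeft_apply, mul_smul_comm]
    rw [← mul_assoc, evenVar_mul, mul_assoc]

theorem modeG_mulBase {d : ℕ} (a : Fin r) (k : ℤ) {c : BaseRing p q} (hc : HasParity d c) :
    (modeG a k * mulBase c : Module.End ℂ (Fock p q r)) =
      (-1 : ℂ) ^ d • (mulBase c * modeG a k) := by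
  have h := hc.baseIncl (r := r)
  have hv : ∀ (o : Fin q ⊕ Fin r × ℕ) (v : Fock p q r), oddVar o * (baseIncl p q r c * v) =
      (-1 : ℂ) ^ d • (baseIncl p q r c * (oddVar o * v)) := fun o v => by
    rw [← mul_assoc, oddVar_mul, h, smul_mul_assoc, smul_mul_assoc, mul_assoc]
  rcases int_cases_pnat k with rfl | ⟨k, rfl⟩ | ⟨k, rfl⟩ <;> refine LinearMap.ext fun v => ?_
  · simp only [modeG_zero, Module.End.mul_apply, LinearMap.smul_apply, map_add, map_smul,
      LinearMap.mulLeft_apply, LinearMap.add_apply, smul_add, mulBase_apply, hv, h.oddDeriv_mul,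
      oddDeriv_baseIncl, zero_mul, zero_add, mul_add, mul_smul_comm]
    rw [smul_comm]
  · simp [mulBase_apply, h.oddDeriv_mul]
  · simp [mulBase_apply, hv]

end Fock


/-! ### Truncated exponentials of inner derivations -/

section ExpAd

variable {A : Type*} [Ring A] [Algebra ℂ A]

/-- The inner derivation `[X, ·]`. -/
def innerDer (X : A) : A →ₗ[ℂ] A := LinearMap.mulLeft ℂ X - LinearMap.mulRight ℂ X

theorem innerDer_apply (X a : A) : innerDer X a = X * a - a * X := rfl

/-- The exponential series of the inner derivation, truncated after `N` terms. -/
def expInner (N : ℕ) (X : A) : A →ₗ[ℂ] A :=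
  ∑ m ∈ Finset.range N, ((m.factorial : ℂ)⁻¹) • innerDer X ^ m

theorem expInner_apply (N : ℕ) (X a : A) :
    expInner N X a = ∑ m ∈ Finset.range N, ((m.factorial : ℂ)⁻¹) • (innerDer X ^ m) a := by
  simp [expInner, LinearMap.sum_apply]

/-- Leibniz rule in divided powers: through the multiplication map `ad X` lifts to `ad X ⊗ 1 + 1 ⊗
ad X`, whose summands commute, so the binomial theorem applies. -/
theorem innerDer_pow_mul (X a b : A) (m : ℕ) :
    ((m.factorial : ℂ)⁻¹) • (innerDer X ^ m) (a * b) =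
      ∑ ij ∈ Finset.HasAntidiagonal.antidiagonal m,
        (((ij.1.factorial : ℂ)⁻¹) • (innerDer X ^ ij.1) a) *
          (((ij.2.factorial : ℂ)⁻¹) • (innerDer X ^ ij.2) b) := by
  have hcomm : Commute ((innerDer X).rTensor A) ((innerDer X).lTensor A) := by
    refine TensorProduct.ext' fun a b => ?_
    simp
  have hstep : ∀ t : A ⊗[ℂ] A, innerDer X (LinearMap.mul' ℂ A t) =
      LinearMap.mul' ℂ A (((innerDer X).rTensor A + (innerDer X).lTensor A) t) := by
    intro t
    induction t using TensorProduct.induction_on with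
    | zero => simp
    | add s t hs ht => simp only [map_add, hs, ht]
    | tmul a b => simp [innerDer_apply, mul_sub, sub_mul, mul_assoc]
  have hpow : ∀ (m : ℕ) (t : A ⊗[ℂ] A), (innerDer X ^ m) (LinearMap.mul' ℂ A t) =
      LinearMap.mul' ℂ A ((((innerDer X).rTensor A + (innerDer X).lTensor A) ^ m) t) := by
    intro m
    induction m with
    | zero => simp
    | succ m ih =>
      intro t
      rw [pow_succ, pow_succ, Module.End.mul_apply, hstep, ih, Module.End.mul_apply]
  have := hpow m (a ⊗ₜ b)
  rw [LinearMap.mul'_apply, hcomm.add_pow'] at this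
  rw [this]
  simp only [LinearMap.sum_apply, map_sum, Finset.smul_sum]
  refine Finset.sum_congr rfl fun ij hij => ?_
  have e : m = ij.1 + ij.2 := (Finset.HasAntidiagonal.mem_antidiagonal.mp hij).symm
  have h1 : ∀ k : ℕ, (innerDer X).rTensor A ^ k = (innerDer X ^ k).rTensor A :=
    fun k => LinearMap.rTensor_pow _ k
  have h2 : ∀ k : ℕ, (innerDer X).lTensor A ^ k = (innerDer X ^ k).lTensor A :=
    fun k => LinearMap.lTensor_pow _ k
  rw [h1, h2, LinearMap.smul_apply, Module.End.mul_apply, LinearMap.lTensor_tmul,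
    LinearMap.rTensor_tmul, map_nsmul, LinearMap.mul'_apply, smul_mul_smul_comm,
    ← Nat.cast_smul_eq_nsmul ℂ, smul_smul]
  congr 1
  have := Nat.add_choose_mul_factorial_mul_factorial ij.1 ij.2
  have h3 : (ij.1.factorial : ℂ) ≠ 0 := by exact_mod_cast ij.1.factorial_ne_zero
  have h4 : (ij.2.factorial : ℂ) ≠ 0 := by exact_mod_cast ij.2.factorial_ne_zero
  have h5 : (m.factorial : ℂ) ≠ 0 := by exact_mod_cast m.factorial_ne_zero
  rw [← e] at this
  have h6 : (m.choose ij.1 : ℂ) * ij.1.factorial * ij.2.factorial = m.factorial := by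
    rw [Nat.choose_symm_of_eq_add e]
    exact_mod_cast this
  field_simp
  rw [← h6]

theorem innerDer_pow_eq_zero {X a : A} {k m : ℕ} (h : (innerDer X ^ k) a = 0) (hm : k ≤ m) :
    (innerDer X ^ m) a = 0 := by
  obtain ⟨n, rfl⟩ := Nat.exists_eq_add_of_le hm
  rw [add_comm, pow_add, Module.End.mul_apply, h, map_zero]

/-- For `N ≥ k + l - 1` every splitting of `N` has first part at least `k` or second part at least
`l`. -/
theorem innerDer_pow_mul_eq_zero {X a b : A} {k l N : ℕ} (ha : (innerDer X ^ k) a = 0)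
    (hb : (innerDer X ^ l) b = 0) (hN : k + l ≤ N + 1) : (innerDer X ^ N) (a * b) = 0 := by
  have h := innerDer_pow_mul X a b N
  rw [Finset.sum_eq_zero] at h
  · have h5 : (N.factorial : ℂ)⁻¹ ≠ 0 := inv_ne_zero (by exact_mod_cast N.factorial_ne_zero)
    exact (smul_eq_zero.mp h).resolve_left h5
  · intro ij hij
    have e := Finset.HasAntidiagonal.mem_antidiagonal.mp hij
    by_cases hk : k ≤ ij.1
    · rw [innerDer_pow_eq_zero ha hk, smul_zero, zero_mul]
    · rw [innerDer_pow_eq_zero hb (by omega), smul_zero, mul_zero]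

/-- The exponential of a derivation is multiplicative, and nilpotency makes this exact for the
truncations: the Leibniz terms outside the rectangle `k × l` vanish. -/
theorem expInner_mul {X a b : A} {k l N : ℕ} (ha : (innerDer X ^ k) a = 0)
    (hb : (innerDer X ^ l) b = 0) (hN : k + l ≤ N + 1) :
    expInner N X (a * b) = expInner k X a * expInner l X b := by
  simp only [expInner_apply, innerDer_pow_mul, Finset.sum_mul_sum]
  rw [← Finset.sum_product', ← Finset.sum_fiberwise_of_maps_to (s := Finset.range k ×ˢ Finset.range l)
    (t := Finset.range N) (g := fun ij => ij.1 + ij.2)]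
  · refine Finset.sum_congr rfl fun m _ => ?_
    refine (Finset.sum_subset ?_ ?_).symm
    · intro ij hij
      exact Finset.HasAntidiagonal.mem_antidiagonal.mpr (Finset.mem_filter.mp hij).2
    · intro ij hij hn
      have e := Finset.HasAntidiagonal.mem_antidiagonal.mp hij
      by_cases hk : k ≤ ij.1
      · rw [innerDer_pow_eq_zero ha hk, smul_zero, zero_mul]
      · by_cases hl : l ≤ ij.2
        · rw [innerDer_pow_eq_zero hb hl, smul_zero, mul_zero]
        · exact absurd (Finset.mem_filter.mpr ⟨Finset.mem_product.mpr
            ⟨Finset.mem_range.mpr (by omega), Finset.mem_range.mpr (by omega)⟩, e⟩) hn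
  · intro ij hij
    have := Finset.mem_product.mp hij
    have h1 := Finset.mem_range.mp this.1
    have h2 := Finset.mem_range.mp this.2
    exact Finset.mem_range.mpr (by omega)

theorem map_innerDer_pow {B : Type*} [Ring B] [Algebra ℂ B] (φ : A →+* B) (X a : A) (m : ℕ) :
    (innerDer (φ X) ^ m) (φ a) = φ ((innerDer X ^ m) a) := by
  induction m with
  | zero => rfl
  | succ m ih =>
    rw [pow_succ', Module.End.mul_apply, ih, pow_succ', Module.End.mul_apply, innerDer_apply,
      innerDer_apply, map_sub, map_mul, map_mul]

end ExpAd

/-! ### Power series of operators -/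

section HasPSum

variable {M ι : Type} [AddCommGroup M] [Module ℂ M]

/-- Coefficientwise and pointwise finite sums of power series of operators. -/
def HasPSum (f : ι → PowerSeries (Module.End ℂ M)) (S : PowerSeries (Module.End ℂ M)) : Prop :=
  ∀ d, HasOpSum (fun i => PowerSeries.coeff d (f i)) (PowerSeries.coeff d S)

namespace HasPSum

variable {f g : ι → PowerSeries (Module.End ℂ M)} {S T : PowerSeries (Module.End ℂ M)}

theorem add (hf : HasPSum f S) (hg : HasPSum g T) : HasPSum (fun i => f i + g i) (S + T) :=
  fun d => ((hf d).add (hg d)).congr fun _ => map_add _ _ _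

theorem smul (c : ℂ) (hf : HasPSum f S) : HasPSum (fun i => c • f i) (c • S) :=
  fun d => ((hf d).smul c).congr fun _ => rfl

theorem sub (hf : HasPSum f S) (hg : HasPSum g T) : HasPSum (fun i => f i - g i) (S - T) := by
  simpa [sub_eq_add_neg] using hf.add (hg.smul (-1))

theorem mul_left (X : PowerSeries (Module.End ℂ M)) (hf : HasPSum f S) :
    HasPSum (fun i => X * f i) (X * S) := by
  intro d
  rw [PowerSeries.coeff_mul]
  refine (HasOpSum.sum _ fun ij _ => (hf ij.2).mul_left (PowerSeries.coeff ij.1 X)).congr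
    fun i => ?_
  rw [PowerSeries.coeff_mul]

theorem mul_right (X : PowerSeries (Module.End ℂ M)) (hf : HasPSum f S) :
    HasPSum (fun i => f i * X) (S * X) := by
  intro d
  rw [PowerSeries.coeff_mul]
  refine (HasOpSum.sum _ fun ij _ => (hf ij.1).mul_right (PowerSeries.coeff ij.2 X)).congr
    fun i => ?_
  rw [PowerSeries.coeff_mul]

theorem innerDer_pow (X : PowerSeries (Module.End ℂ M)) (m : ℕ) (hf : HasPSum f S) :
    HasPSum (fun i => (innerDer X ^ m) (f i)) ((innerDer X ^ m) S) := by
  induction m with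
  | zero => exact hf
  | succ m ih =>
    simp only [pow_succ', Module.End.mul_apply, innerDer_apply]
    exact (ih.mul_left X).sub (ih.mul_right X)

theorem sum {γ : Type} (s : Finset γ) {f : γ → ι → PowerSeries (Module.End ℂ M)}
    {S : γ → PowerSeries (Module.End ℂ M)}
    (h : ∀ c ∈ s, HasPSum (f c) (S c)) : HasPSum (fun i => ∑ c ∈ s, f c i) (∑ c ∈ s, S c) := by
  intro d
  rw [map_sum]
  exact (HasOpSum.sum s fun c hc => h c hc d).congr fun i => map_sum _ _ _

theorem expInner (X : PowerSeries (Module.End ℂ M)) (N : ℕ) (hf : HasPSum f S) :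
    HasPSum (fun i => expInner N X (f i)) (expInner N X S) := by
  simp only [expInner_apply]
  exact HasPSum.sum _ fun m _ => (hf.innerDer_pow X m).smul _

theorem eq_zero (hf : HasPSum f S) (h : ∀ i, f i = 0) : S = 0 := by
  ext1 d
  rw [map_zero]
  exact (hf d).unique (HasOpSum.zero.congr fun i => by rw [h i, map_zero])

end HasPSum

theorem monomial_smul {A : Type*} [Ring A] [Algebra ℂ A] (n : ℕ) (c : ℂ) (a : A) :
    PowerSeries.monomial n (c • a) = c • PowerSeries.monomial n a := by
  ext1 d
  change _ = c • PowerSeries.coeff d (PowerSeries.monomial n a)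
  rw [PowerSeries.coeff_monomial, PowerSeries.coeff_monomial]
  split_ifs <;> simp

/-- Conjugation of `ħ² Q` by `exp(x / ħ)`. -/
def shiftTwo (x : Module.End ℂ M) : Module.End ℂ M →ₗ[ℂ] PowerSeries (Module.End ℂ M) where
  toFun Q := PowerSeries.monomial 2 Q + PowerSeries.monomial 1 (innerDer x Q) +
    PowerSeries.monomial 0 ((1 / 2 : ℂ) • innerDer x (innerDer x Q))
  map_add' Q Q' := by simp only [map_add, smul_add]; abel
  map_smul' c Q := by
    rw [map_smul (innerDer x), map_smul (innerDer x), smul_comm, monomial_smul, monomial_smul,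
      monomial_smul 0 c, RingHom.id_apply, smul_add, smul_add]

/-- Conjugation of `ħ A` by `exp(x / ħ)`. -/
def shiftOne (x A : Module.End ℂ M) : PowerSeries (Module.End ℂ M) :=
  PowerSeries.monomial 1 A + PowerSeries.monomial 0 (innerDer x A)

/-- When `ad x` squares to zero on both factors, half of its square on the product is the product of
the two first commutators. The degree-two truncation is thus multiplicative. -/
theorem shiftTwo_mul {x A B : Module.End ℂ M} (hA : (innerDer x ^ 2) A = 0)
    (hB : (innerDer x ^ 2) B = 0) : shiftTwo x (A * B) = shiftOne x A * shiftOne x B := by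
  have hA' : innerDer x (innerDer x A) = 0 := by simpa [pow_two] using hA
  have hB' : innerDer x (innerDer x B) = 0 := by simpa [pow_two] using hB
  have leib : ∀ U V : Module.End ℂ M,
      innerDer x (U * V) = innerDer x U * V + U * innerDer x V := fun U V => by
    simp only [innerDer_apply]; noncomm_ring
  simp only [shiftTwo, shiftOne, LinearMap.coe_mk, AddHom.coe_mk, add_mul, mul_add,
    PowerSeries.monomial_mul_monomial, leib, map_add, hA', hB', zero_mul, mul_zero, zero_add,
    add_zero, ← two_smul ℂ (innerDer x A * innerDer x B), smul_smul]
  norm_num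
  abel

theorem HasPSum.shiftTwo (x : Module.End ℂ M) {f : ι → Module.End ℂ M} {S : Module.End ℂ M}
    (hf : HasOpSum f S) : HasPSum (fun i => shiftTwo x (f i)) (shiftTwo x S) := by
  have mono : ∀ (n : ℕ) {g : ι → Module.End ℂ M} {T : Module.End ℂ M}, HasOpSum g T →
      HasPSum (fun i => PowerSeries.monomial n (g i)) (PowerSeries.monomial n T) := by
    intro n g T h d
    by_cases hd : d = n
    · simpa [PowerSeries.coeff_monomial, hd] using h
    · simpa [PowerSeries.coeff_monomial, hd] using HasOpSum.zero
  have hx : ∀ {g : ι → Module.End ℂ M} {T : Module.End ℂ M}, HasOpSum g T →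
      HasOpSum (fun i => innerDer x (g i)) (innerDer x T) := fun h => h.commutator' x
  exact ((mono 2 hf).add (mono 1 (hx hf))).add (mono 0 ((hx (hx hf)).smul _))

/-- The conjugation by `exp(x / ħ)`, `exp y` and `exp W`. -/
def dress (x y : Module.End ℂ M) (W : PowerSeries (Module.End ℂ M)) (Q : Module.End ℂ M) :
    PowerSeries (Module.End ℂ M) :=
  expInner 3 W (expInner 5 (PowerSeries.monomial 0 y) (shiftTwo x Q))

/-- The exponential series of the three conjugations terminate. -/
def DressFinite (x y : Module.End ℂ M) (W : PowerSeries (Module.End ℂ M))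
    (Q : Module.End ℂ M) : Prop :=
  (innerDer x ^ 3) Q = 0 ∧ (innerDer (PowerSeries.monomial 0 y) ^ 5) (shiftTwo x Q) = 0 ∧
    (innerDer W ^ 3) (expInner 5 (PowerSeries.monomial 0 y) (shiftTwo x Q)) = 0

section dress

variable {x y : Module.End ℂ M} {W : PowerSeries (Module.End ℂ M)}

theorem HasPSum.dress (x y : Module.End ℂ M) (W : PowerSeries (Module.End ℂ M))
    {f : ι → Module.End ℂ M} {S : Module.End ℂ M}
    (hf : HasOpSum f S) : HasPSum (fun i => dress x y W (f i)) (dress x y W S) :=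
  ((HasPSum.shiftTwo x hf).expInner _ 5).expInner _ 3

theorem dress_add (Q Q' : Module.End ℂ M) :
    dress x y W (Q + Q') = dress x y W Q + dress x y W Q' := by simp [dress]

theorem dress_smul (c : ℂ) (Q : Module.End ℂ M) :
    dress x y W (c • Q) = c • dress x y W Q := by simp [dress]

/-- The orders of nilpotency are the same for all terms, so termination survives infinite sums. -/
theorem DressFinite.hasOpSum {f : ι → Module.End ℂ M} {S : Module.End ℂ M}
    (h : ∀ i, DressFinite x y W (f i)) (hf : HasOpSum f S) : DressFinite x y W S := by
  have hpow : ∀ m, HasOpSum (fun i => (innerDer x ^ m) (f i)) ((innerDer x ^ m) S) := by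
    intro m
    induction m with
    | zero => exact hf
    | succ m ih =>
      simp only [pow_succ', Module.End.mul_apply]
      exact ih.commutator' x
  refine ⟨?_, ?_, ?_⟩
  · exact (hpow 3).unique (HasOpSum.zero.congr fun i => (h i).1)
  · exact ((HasPSum.shiftTwo x hf).innerDer_pow _ 5).eq_zero fun i => (h i).2.1
  · exact (((HasPSum.shiftTwo x hf).expInner _ 5).innerDer_pow _ 3).eq_zero fun i => (h i).2.2

theorem DressFinite.add {Q Q' : Module.End ℂ M} (h : DressFinite x y W Q)
    (h' : DressFinite x y W Q') : DressFinite x y W (Q + Q') := by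
  refine ⟨?_, ?_, ?_⟩
  · rw [map_add, h.1, h'.1, add_zero]
  · rw [map_add, map_add, h.2.1, h'.2.1, add_zero]
  · rw [map_add, map_add, map_add, h.2.2, h'.2.2, add_zero]

theorem DressFinite.smul {Q : Module.End ℂ M} (c : ℂ) (h : DressFinite x y W Q) :
    DressFinite x y W (c • Q) := by
  refine ⟨?_, ?_, ?_⟩
  · rw [map_smul, h.1, smul_zero]
  · rw [map_smul, map_smul, h.2.1, smul_zero]
  · rw [map_smul, map_smul, map_smul, h.2.2, smul_zero]

theorem innerDer_one {A : Type*} [Ring A] [Algebra ℂ A] (X : A) : innerDer X 1 = 0 := by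
  simp [innerDer_apply]

theorem shiftTwo_one : shiftTwo x 1 = PowerSeries.X ^ 2 := by
  simp [shiftTwo, innerDer_one, PowerSeries.X_pow_eq]

theorem innerDer_X_pow {A : Type*} [Ring A] [Algebra ℂ A] (V : PowerSeries A) (n : ℕ) :
    innerDer V (PowerSeries.X ^ n) = 0 := by
  rw [innerDer_apply, (PowerSeries.commute_X_pow V n).eq, sub_self]

theorem expInner_X_pow {A : Type*} [Ring A] [Algebra ℂ A] (V : PowerSeries A) (n N : ℕ) :
    expInner (N + 1) V (PowerSeries.X ^ n) = PowerSeries.X ^ n := by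
  rw [expInner_apply, Finset.sum_range_succ', Finset.sum_eq_zero]
  · simp
  · intro m _
    rw [pow_succ, Module.End.mul_apply, innerDer_X_pow, map_zero, smul_zero]

theorem dress_one : dress x y W 1 = PowerSeries.X ^ 2 := by
  rw [dress, shiftTwo_one, expInner_X_pow, expInner_X_pow]

theorem DressFinite.one : DressFinite x y W 1 := by
  refine ⟨?_, ?_, ?_⟩
  · rw [pow_succ, Module.End.mul_apply, innerDer_one, map_zero]
  · rw [shiftTwo_one, pow_succ, Module.End.mul_apply, innerDer_X_pow, map_zero]
  · rw [shiftTwo_one, expInner_X_pow, pow_succ, Module.End.mul_apply, innerDer_X_pow, map_zero]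

/-- The conjugate of a current. -/
def dressOne (x y : Module.End ℂ M) (W : PowerSeries (Module.End ℂ M)) (A : Module.End ℂ M) :
    PowerSeries (Module.End ℂ M) :=
  expInner 2 W (expInner 3 (PowerSeries.monomial 0 y) (shiftOne x A))

/-- The exponential series of the three conjugations of a current terminate. -/
def DressOneFinite (x y : Module.End ℂ M) (W : PowerSeries (Module.End ℂ M))
    (A : Module.End ℂ M) : Prop :=
  (innerDer x ^ 2) A = 0 ∧ (innerDer (PowerSeries.monomial 0 y) ^ 3) (shiftOne x A) = 0 ∧
    (innerDer W ^ 2) (expInner 3 (PowerSeries.monomial 0 y) (shiftOne x A)) = 0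

/-- Currents are annihilated by the commutator powers 2, 3 and 2 of the three conjugations. Products
then need the orders `k + l - 1`, that is 3, 5 and 3, which are the truncations used in `dress`. -/
theorem dress_mul {A B : Module.End ℂ M} (hA : DressOneFinite x y W A)
    (hB : DressOneFinite x y W B) :
    dress x y W (A * B) = dressOne x y W A * dressOne x y W B := by
  rw [dress, shiftTwo_mul hA.1 hB.1, expInner_mul hA.2.1 hB.2.1 (by norm_num),
    expInner_mul hA.2.2 hB.2.2 (by norm_num)]
  rfl

theorem DressFinite.mul {A B : Module.End ℂ M} (hA : DressOneFinite x y W A)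
    (hB : DressOneFinite x y W B) : DressFinite x y W (A * B) := by
  refine ⟨innerDer_pow_mul_eq_zero hA.1 hB.1 (by norm_num), ?_, ?_⟩
  · rw [shiftTwo_mul hA.1 hB.1]
    exact innerDer_pow_mul_eq_zero hA.2.1 hB.2.1 (by norm_num)
  · rw [shiftTwo_mul hA.1 hB.1, expInner_mul hA.2.1 hB.2.1 (by norm_num)]
    exact innerDer_pow_mul_eq_zero hA.2.2 hB.2.2 (by norm_num)

end dress

end HasPSum

/-! ### Conjugation of Laurent series of operators -/

section conj

variable {p q r : ℕ}

/-- Nilpotency gives the `finsum` in `conjExp` finite support, so that it is the exponential series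
and not a default value. -/
theorem conjExp_eq_expInner {X H : HOp p q r} {N : ℕ} (h : (innerDer X ^ N) H = 0) :
    conjExp X H = expInner N X H := by
  have e : ∀ m : ℕ, (fun Y => X * Y - Y * X)^[m] H = (innerDer X ^ m) H := fun m => by
    rw [Module.End.pow_apply]; rfl
  simp only [conjExp, e, expInner_apply]
  refine finsum_eq_sum_of_support_subset _ fun m hm => ?_
  simp only [Function.mem_support] at hm
  by_contra hn
  exact hm (by rw [innerDer_pow_eq_zero h (by simpa using hn), smul_zero])

/-- Power series of operators as Laurent series. -/
abbrev toHOp (p q r : ℕ) : PowerSeries (Module.End ℂ (Fock p q r)) →+* HOp p q r :=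
  HahnSeries.ofPowerSeries ℤ _

theorem toHOp_monomial (n : ℕ) (A : Module.End ℂ (Fock p q r)) :
    toHOp p q r (PowerSeries.monomial n A) = HahnSeries.single (n : ℤ) A := by
  have : PowerSeries.monomial n A = PowerSeries.C A * PowerSeries.X ^ n := by
    ext1 d
    rw [PowerSeries.coeff_C_mul, PowerSeries.coeff_X_pow, PowerSeries.coeff_monomial]
    split_ifs <;> simp
  rw [this, map_mul, HahnSeries.ofPowerSeries_C, HahnSeries.ofPowerSeries_X_pow, HahnSeries.C_apply,
    HahnSeries.single_mul_single, zero_add, mul_one]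

theorem toHOp_smul (c : ℂ) (f : PowerSeries (Module.End ℂ (Fock p q r))) :
    toHOp p q r (c • f) = c • toHOp p q r f :=
  map_smul (HahnSeries.ofPowerSeriesAlg ℤ ℂ) c f

theorem toHOp_expInner (N : ℕ) (X a : PowerSeries (Module.End ℂ (Fock p q r))) :
    expInner N (toHOp p q r X) (toHOp p q r a) = toHOp p q r (expInner N X a) := by
  rw [expInner_apply, expInner_apply, map_sum]
  exact Finset.sum_congr rfl fun m _ => by rw [map_innerDer_pow, toHOp_smul]

theorem conjExp_toHOp {X a : PowerSeries (Module.End ℂ (Fock p q r))} {N : ℕ}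
    (h : (innerDer X ^ N) a = 0) :
    conjExp (toHOp p q r X) (toHOp p q r a) = toHOp p q r (expInner N X a) := by
  rw [conjExp_eq_expInner (N := N) (by rw [map_innerDer_pow, h, map_zero]), toHOp_expInner]

/-- Each commutator with `x / ħ` lowers the power of `ħ` by one. As at most two act nontrivially on
`ħ² Q`, no negative powers appear and the rest of the computation takes place in power series. -/
theorem conjExp_shift {x Q : Module.End ℂ (Fock p q r)} (h : (innerDer x ^ 3) Q = 0) :
    conjExp (HahnSeries.single (-1) x) (HahnSeries.single 2 Q) = toHOp p q r (shiftTwo x Q) := by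
  have e : ∀ (n : ℤ) (P : Module.End ℂ (Fock p q r)),
      innerDer (HahnSeries.single (-1) x : HOp p q r) (HahnSeries.single n P) =
        HahnSeries.single (-1 + n) (innerDer x P) := fun n P => by
    rw [innerDer_apply, HahnSeries.single_mul_single, HahnSeries.single_mul_single, innerDer_apply,
      add_comm n, HahnSeries.single_sub]
  have h3 : innerDer x (innerDer x (innerDer x Q)) = 0 := by simpa [pow_succ'] using h
  rw [conjExp_eq_expInner (N := 3) (by simp [pow_succ', e, h3]), expInner_apply]
  simp only [Finset.sum_range_succ, Finset.sum_range_zero, pow_zero, pow_one, pow_two,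
    Module.End.mul_apply, e, shiftTwo, LinearMap.coe_mk, AddHom.coe_mk, map_add, toHOp_monomial]
  norm_num [Nat.factorial]
  ext1
  ext1 d
  simp [HahnSeries.coeff_single]

/-- The passage from annihilation of `Z`, stated with Laurent series, to the vanishing of each
coefficient of the truncated conjugation on the vacuum `1`. -/
theorem coeff_conj_apply (S : CurveData p q r) (Z : FreeEnergies p q r)
    {x y Q : Module.End ℂ (Fock p q r)} {W : PowerSeries (Module.End ℂ (Fock p q r))}
    (hx : S.logT = HahnSeries.single (-1) x) (hy : S.logPhi = HahnSeries.single 0 y)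
    (hW : -Z.logZ = toHOp p q r W) (hQ : DressFinite x y W Q)
    (h : Z.IsAnnihilatedBy (S.conj (HahnSeries.single 2 Q))) (d : ℕ) :
    PowerSeries.coeff d (dress x y W Q) 1 = 0 := by
  have h := h d
  have hy' : S.logPhi = toHOp p q r (PowerSeries.monomial 0 y) := by
    rw [hy, toHOp_monomial]; rfl
  rw [CurveData.conj, hx, conjExp_shift hQ.1, hy', conjExp_toHOp hQ.2.1, hW,
    conjExp_toHOp hQ.2.2, HahnSeries.ofPowerSeries_apply_coeff] at h
  exact h

end conj


/-! ### Currents and the dilaton shift -/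

section Currents

variable {p q r : ℕ}

/-- The currents: the mode of `J_a` or `Γ_a` multiplying a basis differential. -/
def cur : Mode r → Module.End ℂ (Fock p q r) :=
  Sum.elim (fun m => modeJ m.1 (-m.2)) (fun m => modeG m.1 (-m.2))

/-- A polynomial involves finitely many variables, so all sufficiently high annihilation modes kill
it. The pointwise finiteness of sums of modes rests on this. -/
theorem modes_bdd (v : Fock p q r) :
    ∃ B : ℕ, ∀ (a : Fin r) (k : ℤ), (B : ℤ) < k → modeJ a k v = 0 ∧ modeG a k v = 0 := by
  obtain ⟨B, hB⟩ := ((coordDeriv_finite v).image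
    (Sum.elim (fun i => (i.2 : ℕ)) fun i => i.2)).bddAbove
  refine ⟨B, fun a k hk => ?_⟩
  obtain ⟨n, rfl⟩ : ∃ n : ℕ+, k = n := ⟨⟨k.toNat, by omega⟩, by simp; omega⟩
  rw [modeJ_pos, modeG_pos]
  constructor
  · by_contra h
    have := hB ⟨Sum.inl (a, n), h, rfl⟩
    simp at this
    omega
  · by_contra h
    have := hB ⟨Sum.inr (a, (n : ℕ)), h, rfl⟩
    simp at this
    omega

theorem finite_of_bdd {s : Set (Fin r × ℕ)} (B : ℕ) (h : ∀ i ∈ s, i.2 ≤ B) : s.Finite :=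
  (Set.finite_univ.prod (Set.finite_Iic B)).subset fun i hi => ⟨trivial, h i hi⟩

theorem hasOpSum_annihilators (α β : Fin r × ℕ → BaseRing p q) :
    HasOpSum (fun i => (mulBase (α i) * modeJ i.1 i.2 + mulBase (β i) * modeG i.1 i.2 :
      Module.End ℂ (Fock p q r)))
      (opSum fun i => mulBase (α i) * modeJ i.1 i.2 + mulBase (β i) * modeG i.1 i.2) := by
  refine hasOpSum_opSum fun v => ?_
  obtain ⟨B, hB⟩ := modes_bdd v
  refine finite_of_bdd B fun i hi => ?_
  by_contra hn
  obtain ⟨h1, h2⟩ := hB i.1 i.2 (by omega)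
  exact hi (by simp [h1, h2])

theorem hasOpSum_coordDeriv (α : Coord r → BaseRing p q) :
    HasOpSum (fun i => (mulBase (α i) * coordDeriv i : Module.End ℂ (Fock p q r)))
      (opSum fun i => mulBase (α i) * coordDeriv i) := by
  refine hasOpSum_opSum fun v => (coordDeriv_finite v).subset fun i hi => ?_
  by_contra hn
  exact hi (by simp [Function.notMem_support.mp hn])

variable (S : CurveData p q r)

/-- The terms of `log T`. -/
def termT (i : Fin r × ℤ) : Module.End ℂ (Fock p q r) :=
  ((i.2 : ℂ)⁻¹) • (modeJ i.1 i.2 * mulBase (S.t i.1 i.2)) - modeG i.1 i.2 * mulBase (S.τ i.1 i.2)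

/-- The coefficient of `log T`. -/
def opT : Module.End ℂ (Fock p q r) := opSum (termT S)

theorem logT_eq : S.logT = HahnSeries.single (-1) (opT S) := rfl

theorem hasOpSum_opT : HasOpSum (termT S) (opT S) := by
  refine hasOpSum_opSum fun v => ?_
  obtain ⟨B, hB⟩ := modes_bdd v
  obtain ⟨K, hK⟩ := S.t_bdd
  obtain ⟨K', hK'⟩ := S.τ_bdd
  -- Below `min K K'` the coefficients `t` and `τ` vanish, and above `B` the modes kill `v`.
  refine (Set.finite_univ.prod (Set.finite_Icc (min K K') (B : ℤ))).subset fun i hi => ?_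
  refine ⟨trivial, ?_⟩
  by_contra hn
  rw [Set.mem_Icc, not_and_or, not_le, not_le, lt_min_iff] at hn
  refine hi ?_
  change termT S i v = 0
  rw [termT, modeJ_mulBase, modeG_mulBase _ _ (S.τ_odd _ _)]
  rcases hn with hn | hn
  · simp [hK _ _ hn.1, hK' _ _ hn.2, mulBase_zero]
  · obtain ⟨h1, h2⟩ := hB i.1 i.2 hn
    simp [h1, h2]

theorem omega01_parity (m : Mode r) : HasParity (par m) (S.omega01 m) := by
  rcases m with m | m
  · exact S.t_even _ _
  · exact S.τ_odd _ _

theorem mulBase_even_comm {c : BaseRing p q} (hc : HasParity 0 c) (c' : BaseRing p q) :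
    (mulBase c * mulBase c' : Module.End ℂ (Fock p q r)) = mulBase c' * mulBase c := by
  have h := (even_part_mul c c').1
  rw [hc, pow_zero, one_smul, ← two_smul ℂ c, smul_mul_assoc, mul_smul_comm] at h
  rw [mulBase_mul, mulBase_mul, smul_right_injective _ (two_ne_zero (α := ℂ)) h]

/-- `Γ` and its odd coefficient together form an even operator on scalars, so the two signs cancel.
-/
theorem oddPair_comm_mulBase {d : ℕ} {c c' : BaseRing p q} (hc : HasParity 1 c)
    (hc' : HasParity d c') (a : Fin r) (k : ℤ) :
    (modeG a k * mulBase c * mulBase c' : Module.End ℂ (Fock p q r)) =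
      mulBase c' * (modeG a k * mulBase c) := by
  rw [mul_assoc, mulBase_mul, hc.mul_comm hc', mulBase_smul, mul_smul_comm, ← mulBase_mul,
    ← mul_assoc, modeG_mulBase a k hc', smul_mul_assoc, smul_smul, one_mul, ← pow_add,
    Even.neg_one_pow ⟨d, rfl⟩, one_smul, mul_assoc]

theorem innerDer_opT_mulBase {d : ℕ} {c : BaseRing p q} (hc : HasParity d c) :
    innerDer (opT S) (mulBase c) = 0 := by
  refine ((hasOpSum_opT S).commutator (mulBase c)).unique (HasOpSum.zero.congr fun i => ?_)
  rw [termT, sub_mul, mul_sub, oddPair_comm_mulBase (S.τ_odd _ _) hc, smul_mul_assoc,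
    mul_smul_comm, mul_assoc, mulBase_even_comm (S.t_even _ _), ← mul_assoc, modeJ_mulBase,
    mul_assoc, sub_self]

/-- Only the term of log `T` whose mode is conjugate to the current contributes. For `J` the factor
`1/k` cancels the `k` of the Heisenberg relation. -/
theorem innerDer_opT_cur (m : Mode r) :
    innerDer (opT S) (cur m) = mulBase (S.omega01 m) := by
  have h := (hasOpSum_opT S).commutator (cur m)
  rcases m with ⟨b, l⟩ | ⟨b, l⟩
  · have key : ∀ i : Fin r × ℤ, termT S i * cur (Sum.inl (b, l)) - cur (Sum.inl (b, l)) *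
        termT S i = if i = (b, l) then mulBase (S.t b l) else 0 := by
      rintro ⟨a, k⟩
      have e1 : modeJ a k * mulBase (S.t a k) * cur (Sum.inl (b, l)) - cur (Sum.inl (b, l)) *
          (modeJ a k * mulBase (S.t a k)) = ((if a = b ∧ k + -l = 0 then (k : ℂ) else 0) •
            mulBase (S.t a k) : Module.End ℂ (Fock p q r)) := by
        simp only [cur, Sum.elim_inl]
        rw [mul_assoc, ← modeJ_mulBase, ← mul_assoc, modeJ_comm a b k (-l), add_mul, ← mul_assoc,
          smul_mul_assoc, one_mul, add_sub_cancel_left]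
      have e2 : modeG a k * mulBase (S.τ a k) * cur (Sum.inl (b, l)) - cur (Sum.inl (b, l)) *
          (modeG a k * mulBase (S.τ a k)) = (0 : Module.End ℂ (Fock p q r)) := by
        simp only [cur, Sum.elim_inl]
        rw [mul_assoc, ← modeJ_mulBase, ← mul_assoc, ← modeJ_modeG, mul_assoc, sub_self]
      rw [termT, sub_mul, mul_sub, smul_mul_assoc, mul_smul_comm, sub_sub_sub_comm, ← smul_sub, e1,
        e2, sub_zero]
      by_cases hi : (a, k) = (b, l)
      · obtain ⟨rfl, rfl⟩ := Prod.mk.inj hi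
        rw [if_pos ⟨rfl, by omega⟩, if_pos rfl]
        by_cases hk : k = 0
        · subst hk; rw [S.t_zero]; simp [mulBase_zero]
        · rw [smul_smul, inv_mul_cancel₀ (by exact_mod_cast hk), one_smul]
      · rw [if_neg hi, if_neg (fun h => hi (by rw [h.1, show k = l by omega])), zero_smul,
          smul_zero]
    have h' := HasOpSum.single (f := fun i : Fin r × ℤ => if i = (b, l) then
      (mulBase (S.t b l) : Module.End ℂ (Fock p q r)) else 0) (b, l) (fun j hj => if_neg hj)
    rw [if_pos rfl] at h'
    exact h.unique (h'.congr key)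
  · have key : ∀ i : Fin r × ℤ, termT S i * cur (Sum.inr (b, l)) - cur (Sum.inr (b, l)) *
        termT S i = if i = (b, l) then mulBase (S.τ b l) else 0 := by
      rintro ⟨a, k⟩
      have e1 : modeJ a k * mulBase (S.t a k) * cur (Sum.inr (b, l)) - cur (Sum.inr (b, l)) *
          (modeJ a k * mulBase (S.t a k)) = (0 : Module.End ℂ (Fock p q r)) := by
        have := modeG_mulBase b (-l) (S.t_even a k)
        rw [pow_zero, one_smul] at this
        simp only [cur, Sum.elim_inr]
        rw [mul_assoc, ← this, ← mul_assoc, modeJ_modeG, mul_assoc, sub_self]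
      -- Moving the odd `τ` past `Γ` gives a sign, which cancels the minus sign in front of `Γ τ` in
      -- log `T`.
      have e2 : modeG a k * mulBase (S.τ a k) * cur (Sum.inr (b, l)) - cur (Sum.inr (b, l)) *
          (modeG a k * mulBase (S.τ a k)) = (-((if a = b ∧ k + -l = 0 then (1 : ℂ) else 0) •
            mulBase (S.τ a k)) : Module.End ℂ (Fock p q r)) := by
        have := modeG_mulBase b (-l) (S.τ_odd a k)
        rw [pow_one, neg_one_smul] at this
        simp only [cur, Sum.elim_inr]
        rw [mul_assoc, ← neg_eq_iff_eq_neg.mpr this, mul_neg, ← mul_assoc, modeG_anticomm a b k (-l),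
          add_mul, neg_mul, ← mul_assoc, smul_mul_assoc, one_mul]
        abel
      rw [termT, sub_mul, mul_sub, smul_mul_assoc, mul_smul_comm, sub_sub_sub_comm, ← smul_sub, e1,
        e2, smul_zero, zero_sub, neg_neg]
      by_cases hi : (a, k) = (b, l)
      · obtain ⟨rfl, rfl⟩ := Prod.mk.inj hi
        rw [if_pos ⟨rfl, by omega⟩, if_pos rfl, one_smul]
      · rw [if_neg hi, if_neg (fun h => hi (by rw [h.1, show k = l by omega])), zero_smul]
    have h' := HasOpSum.single (f := fun i : Fin r × ℤ => if i = (b, l) then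
      (mulBase (S.τ b l) : Module.End ℂ (Fock p q r)) else 0) (b, l) (fun j hj => if_neg hj)
    rw [if_pos rfl] at h'
    exact h.unique (h'.congr key)

/-! ### The change of polarisation -/

/-- The terms of `2 log Φ`. -/
def termPhi (i : (Fin r × ℕ) × (Fin r × ℕ)) : Module.End ℂ (Fock p q r) :=
  ((i.1.2 : ℂ) * i.2.2)⁻¹ •
      (modeJ i.1.1 i.1.2 * modeJ i.2.1 i.2.2 * mulBase (S.B i.1.1 i.2.1 i.1.2 i.2.2)) -
    (2 * (i.1.2 : ℂ)⁻¹) •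
      (modeJ i.1.1 i.1.2 * modeG i.2.1 i.2.2 * mulBase (S.φ i.1.1 i.2.1 i.1.2 i.2.2)) +
    modeG i.1.1 i.1.2 * modeG i.2.1 i.2.2 * mulBase (S.V i.1.1 i.2.1 i.1.2 i.2.2)

/-- The coefficient of `log Φ`. -/
def opPhi : Module.End ℂ (Fock p q r) := (1 / 2 : ℂ) • opSum (termPhi S)

theorem logPhi_eq : S.logPhi = HahnSeries.single 0 (opPhi S) := rfl

theorem modeG_mulBase_even (a : Fin r) (k : ℤ) {c : BaseRing p q} (hc : HasParity 0 c) :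
    (modeG a k * mulBase c : Module.End ℂ (Fock p q r)) = mulBase c * modeG a k := by
  simpa using modeG_mulBase a k hc

theorem modeG_mulBase_odd (a : Fin r) (k : ℤ) {c : BaseRing p q} (hc : HasParity 1 c) :
    (modeG a k * mulBase c : Module.End ℂ (Fock p q r)) = -(mulBase c * modeG a k) := by
  simpa using modeG_mulBase a k hc

/-- Moving coefficients to the left turns the minus sign of the mixed term into a plus, since `φ` is
odd and passes one `Γ`. -/
theorem termPhi_eq (i j : Fin r × ℕ) : termPhi S (i, j) =
    ((i.2 : ℂ) * j.2)⁻¹ • (mulBase (S.B i.1 j.1 i.2 j.2) * (modeJ i.1 i.2 * modeJ j.1 j.2)) +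
    (2 * (i.2 : ℂ)⁻¹) • (mulBase (S.φ i.1 j.1 i.2 j.2) * (modeJ i.1 i.2 * modeG j.1 j.2)) +
    mulBase (S.V i.1 j.1 i.2 j.2) * (modeG i.1 i.2 * modeG j.1 j.2) := by
  simp only [termPhi]
  congr 1
  · rw [sub_eq_add_neg, ← smul_neg]
    congr 2
    · rw [mul_assoc, modeJ_mulBase, ← mul_assoc, modeJ_mulBase, mul_assoc]
    · rw [mul_assoc, modeG_mulBase_odd _ _ (S.φ_odd _ _ _ _), mul_neg, neg_neg, ← mul_assoc,
        modeJ_mulBase, mul_assoc]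
  · rw [mul_assoc, modeG_mulBase_even _ _ (S.V_even _ _ _ _), ← mul_assoc,
      modeG_mulBase_even _ _ (S.V_even _ _ _ _), mul_assoc]

theorem hasOpSum_opPhi : HasOpSum (fun i => (1 / 2 : ℂ) • termPhi S i) (opPhi S) := by
  refine (hasOpSum_opSum fun v => ?_).smul _
  obtain ⟨B, hB⟩ := modes_bdd v
  refine ((Set.finite_univ.prod (Set.finite_Iic B)).prod
    (Set.finite_univ.prod (Set.finite_Iic B))).subset fun ij hij => ?_
  obtain ⟨i, j⟩ := ij
  have main : i.2 ≤ B ∧ j.2 ≤ B := by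
    by_contra hn
    refine hij ?_
    change termPhi S (i, j) v = 0
    rw [termPhi_eq]
    rw [not_and_or, not_le, not_le] at hn
    rcases hn with hn | hn
    · obtain ⟨h1, h2⟩ := hB i.1 i.2 (by omega)
      -- The high mode is moved next to `v`. There is no central term, as the two indices are
      -- nonnegative and one is positive.
      rw [modeJ_comm, modeJ_modeG, modeG_anticomm, if_neg (by omega), if_neg (by omega)]
      simp [h1, h2]
    · obtain ⟨h1, h2⟩ := hB j.1 j.2 (by omega)
      simp [h1, h2]
  exact ⟨⟨trivial, main.1⟩, ⟨trivial, main.2⟩⟩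

theorem innerDer_opPhi_mulBase {d : ℕ} {c : BaseRing p q} (hc : HasParity d c) :
    innerDer (opPhi S) (mulBase c) = 0 := by
  refine ((hasOpSum_opPhi S).commutator (mulBase c)).unique (HasOpSum.zero.congr fun i => ?_)
  have hJ : ∀ (a : Fin r) (k : ℤ) (X : Module.End ℂ (Fock p q r)), X * mulBase c = mulBase c * X →
      modeJ a k * X * mulBase c = mulBase c * (modeJ a k * X) := fun a k X h => by
    rw [mul_assoc, h, ← mul_assoc, modeJ_mulBase, mul_assoc]
  have hG : ∀ (a b : Fin r) (k l : ℤ), (modeG a k * modeG b l * mulBase c :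
      Module.End ℂ (Fock p q r)) = mulBase c * (modeG a k * modeG b l) := fun a b k l => by
    rw [mul_assoc, modeG_mulBase b l hc, mul_smul_comm, ← mul_assoc, modeG_mulBase a k hc,
      smul_mul_assoc, smul_smul, ← pow_add, Even.neg_one_pow ⟨d, rfl⟩, one_smul, mul_assoc]
  have e1 : ∀ (a b : Fin r) (k l : ℤ) (x : BaseRing p q), HasParity 0 x →
      modeJ a k * modeJ b l * mulBase x * mulBase c =
      mulBase c * (modeJ a k * modeJ b l * mulBase x) := fun a b k l x hx => by
    rw [mul_assoc, mulBase_even_comm hx, ← mul_assoc, hJ _ _ _ (modeJ_mulBase b l c), mul_assoc]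
  have e2 : ∀ (a b : Fin r) (k l : ℤ) (x : BaseRing p q), HasParity 1 x →
      modeJ a k * modeG b l * mulBase x * mulBase c =
      mulBase c * (modeJ a k * modeG b l * mulBase x) := fun a b k l x hx => by
    rw [mul_assoc (modeJ a k)]
    exact hJ _ _ _ (oddPair_comm_mulBase hx hc b l)
  have e3 : ∀ (a b : Fin r) (k l : ℤ) (x : BaseRing p q), HasParity 0 x →
      modeG a k * modeG b l * mulBase x * mulBase c =
      mulBase c * (modeG a k * modeG b l * mulBase x) := fun a b k l x hx => by
    rw [mul_assoc, mulBase_even_comm hx, ← mul_assoc, hG, mul_assoc]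
  rw [smul_mul_assoc, mul_smul_comm, termPhi, add_mul, mul_add, sub_mul, mul_sub, smul_mul_assoc,
    mul_smul_comm, smul_mul_assoc, mul_smul_comm, e1 _ _ _ _ _ (S.B_even _ _ _ _),
    e2 _ _ _ _ _ (S.φ_odd _ _ _ _), e3 _ _ _ _ _ (S.V_even _ _ _ _), sub_self]

/-- The coefficients of the modes `J` in the commutator of `log Φ` with a current. -/
def polEven : Mode r → Fin r × ℕ → BaseRing p q
  | .inl (b, l), (a, k) => if 0 < l then S.B a b k l.toNat else 0
  | .inr (b, l), (a, k) => if 0 ≤ l then S.φ a b k l.toNat else 0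

/-- The coefficients of the modes `Γ` in the commutator of `log Φ` with a current. -/
def polOdd : Mode r → Fin r × ℕ → BaseRing p q
  | .inl (b, l), (a, k) => if 0 < l then S.φ b a l.toNat k else 0
  | .inr (b, l), (a, k) => if 0 ≤ l then S.V a b k l.toNat else 0

theorem polEven_parity (m : Mode r) (i : Fin r × ℕ) : HasParity (par m) (polEven S m i) := by
  rcases m with ⟨b, l⟩ | ⟨b, l⟩ <;> simp only [polEven] <;> split_ifs
  exacts [S.B_even _ _ _ _, HasParity.zero _, S.φ_odd _ _ _ _, HasParity.zero _]

theorem polOdd_parity (m : Mode r) (i : Fin r × ℕ) : HasParity (par m + 1) (polOdd S m i) := by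
  rcases m with ⟨b, l⟩ | ⟨b, l⟩ <;> simp only [polOdd] <;> split_ifs
  exacts [S.φ_odd _ _ _ _, HasParity.zero _, (S.V_even _ _ _ _).congr (by simp [par]), HasParity.zero _]

end Currents


/-! ### Commutators of log `Φ` with the currents -/

section Polarisation

variable {p q r : ℕ} (S : CurveData p q r)

/-- A double sum supported on the two lines `j = i₀` and `i = i₀` collapses to a single sum.
Commutators of the quadratic log `Φ` with one mode have this shape. -/
theorem hasOpSum_pair {α β : Fin r × ℕ → BaseRing p q} {α' β' : Fin r × ℕ → BaseRing p q}
    (i₀ : Fin r × ℕ) {F : (Fin r × ℕ) × (Fin r × ℕ) → Module.End ℂ (Fock p q r)}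
    {T : Module.End ℂ (Fock p q r)} (hF : HasOpSum (fun i => (1 / 2 : ℂ) • F i) T)
    (h : ∀ i j, F (i, j) =
      (if j = i₀ then mulBase (α i) * modeJ i.1 i.2 + mulBase (β i) * modeG i.1 i.2 else 0) +
      (if i = i₀ then mulBase (α' j) * modeJ j.1 j.2 + mulBase (β' j) * modeG j.1 j.2 else 0)) :
    HasOpSum (fun i => mulBase ((1 / 2 : ℂ) • (α i + α' i)) * modeJ i.1 i.2 +
      mulBase ((1 / 2 : ℂ) • (β i + β' i)) * modeG i.1 i.2) T := by
  have h1 := HasOpSum.extend (f := fun ij : (Fin r × ℕ) × (Fin r × ℕ) => if ij.2 = i₀ then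
    (mulBase (α ij.1) * modeJ ij.1.1 ij.1.2 + mulBase (β ij.1) * modeG ij.1.1 ij.1.2 :
      Module.End ℂ (Fock p q r)) else 0) (fun i => (i, i₀))
    (fun i j h => (Prod.mk.inj h).1)
    ((hasOpSum_annihilators α β).congr fun i => if_pos rfl)
    (fun ij hij => if_neg fun h => hij ⟨ij.1, by rw [← h]⟩)
  have h2 := HasOpSum.extend (f := fun ij : (Fin r × ℕ) × (Fin r × ℕ) => if ij.1 = i₀ then
    (mulBase (α' ij.2) * modeJ ij.2.1 ij.2.2 + mulBase (β' ij.2) * modeG ij.2.1 ij.2.2 :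
      Module.End ℂ (Fock p q r)) else 0) (fun i => (i₀, i))
    (fun i j h => (Prod.mk.inj h).2)
    ((hasOpSum_annihilators α' β').congr fun i => if_pos rfl)
    (fun ij hij => if_neg fun h => hij ⟨ij.2, by rw [← h]⟩)
  have h3 := ((h1.add h2).smul (1 / 2)).congr (g := fun i => (1 / 2 : ℂ) • F i)
    fun ij => by rw [← h ij.1 ij.2]
  rw [hF.unique h3]
  refine (((hasOpSum_annihilators α β).add (hasOpSum_annihilators α' β')).smul (1 / 2)).congr
    fun i => ?_
  simp only [mulBase_smul, mulBase_add, smul_mul_assoc, add_mul, smul_add]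
  abel

theorem natCast_smul_inv_mul (k l : ℕ) (hl : l ≠ 0) : ((k : ℂ) * l)⁻¹ * l = (k : ℂ)⁻¹ := by
  have : (l : ℂ) ≠ 0 := by exact_mod_cast hl
  rw [mul_inv, mul_assoc, inv_mul_cancel₀ this, mul_one]

/-- The commutator of the terms of `log Φ` with a mode `J`. -/
theorem termPhi_modeJ (i j : Fin r × ℕ) (b : Fin r) (l : ℤ) :
    termPhi S (i, j) * modeJ b l - modeJ b l * termPhi S (i, j) =
      (((i.2 : ℂ) * j.2)⁻¹ * (if j.1 = b ∧ (j.2 : ℤ) + l = 0 then (j.2 : ℂ) else 0)) •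
          (mulBase (S.B i.1 j.1 i.2 j.2) * modeJ i.1 i.2) +
      ((((i.2 : ℂ) * j.2)⁻¹ * (if i.1 = b ∧ (i.2 : ℤ) + l = 0 then (i.2 : ℂ) else 0)) •
          (mulBase (S.B i.1 j.1 i.2 j.2) * modeJ j.1 j.2) +
        (2 * (i.2 : ℂ)⁻¹ * (if i.1 = b ∧ (i.2 : ℤ) + l = 0 then (i.2 : ℂ) else 0)) •
          (mulBase (S.φ i.1 j.1 i.2 j.2) * modeG j.1 j.2)) := by
  have hB : ∀ c : BaseRing p q, mulBase c * (modeJ i.1 i.2 * modeJ j.1 j.2) * modeJ b l -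
      modeJ b l * (mulBase c * (modeJ i.1 i.2 * modeJ j.1 j.2)) =
      ((if j.1 = b ∧ (j.2 : ℤ) + l = 0 then (j.2 : ℂ) else 0) • (mulBase c * modeJ i.1 i.2) +
      (if i.1 = b ∧ (i.2 : ℤ) + l = 0 then (i.2 : ℂ) else 0) • (mulBase c * modeJ j.1 j.2) :
        Module.End ℂ (Fock p q r)) := by
    intro c
    rw [← mul_assoc (modeJ b l), modeJ_mulBase, mul_assoc, mul_assoc,
      mul_assoc (mulBase c) (modeJ b l), ← mul_sub,
      modeJ_comm j.1 b, mul_add, ← mul_assoc, modeJ_comm i.1 b i.2 l]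
    simp only [Int.cast_natCast, add_mul, mul_smul_comm, smul_mul_assoc, one_mul, mul_one, mul_assoc]
    rw [add_assoc, add_sub_cancel_left, mul_add, mul_smul_comm, mul_smul_comm, add_comm]
  have hφ : ∀ c : BaseRing p q, mulBase c * (modeJ i.1 i.2 * modeG j.1 j.2) * modeJ b l -
      modeJ b l * (mulBase c * (modeJ i.1 i.2 * modeG j.1 j.2)) =
      ((if i.1 = b ∧ (i.2 : ℤ) + l = 0 then (i.2 : ℂ) else 0) • (mulBase c * modeG j.1 j.2) :
        Module.End ℂ (Fock p q r)) := by
    intro c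
    rw [← mul_assoc (modeJ b l), modeJ_mulBase, mul_assoc, mul_assoc,
      mul_assoc (mulBase c) (modeJ b l), ← mul_sub,
      ← modeJ_modeG, ← mul_assoc, modeJ_comm i.1 b i.2 l]
    simp only [Int.cast_natCast, add_mul, smul_mul_assoc, one_mul, mul_assoc, add_sub_cancel_left,
      mul_smul_comm]
  have hV : ∀ c : BaseRing p q, mulBase c * (modeG i.1 i.2 * modeG j.1 j.2) * modeJ b l -
      modeJ b l * (mulBase c * (modeG i.1 i.2 * modeG j.1 j.2)) =
      (0 : Module.End ℂ (Fock p q r)) := by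
    intro c
    rw [← mul_assoc (modeJ b l), modeJ_mulBase, mul_assoc, mul_assoc,
      mul_assoc (mulBase c) (modeJ b l), ← mul_sub,
      ← modeJ_modeG, ← mul_assoc, ← modeJ_modeG, mul_assoc, sub_self,
      mul_zero]
  have split : ∀ (x y : ℂ) (P Q R J : Module.End ℂ (Fock p q r)),
      (x • P + y • Q + R) * J - J * (x • P + y • Q + R) =
        x • (P * J - J * P) + y • (Q * J - J * Q) + (R * J - J * R) := fun x y P Q R J => by
    simp only [add_mul, mul_add, smul_mul_assoc, mul_smul_comm, smul_sub]
    abel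
  rw [termPhi_eq, split, hB, hφ, hV, add_zero, smul_add, smul_smul, smul_smul, smul_smul, add_assoc]

/-- The commutator of the terms of `log Φ` with a mode `Γ`. -/
theorem termPhi_modeG (i j : Fin r × ℕ) (b : Fin r) (l : ℤ) :
    termPhi S (i, j) * modeG b l - modeG b l * termPhi S (i, j) =
      ((2 * (i.2 : ℂ)⁻¹ * (if j.1 = b ∧ (j.2 : ℤ) + l = 0 then 1 else 0)) •
          (mulBase (S.φ i.1 j.1 i.2 j.2) * modeJ i.1 i.2) +
        (if j.1 = b ∧ (j.2 : ℤ) + l = 0 then (1 : ℂ) else 0) •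
          (mulBase (S.V i.1 j.1 i.2 j.2) * modeG i.1 i.2)) +
      (-(if i.1 = b ∧ (i.2 : ℤ) + l = 0 then (1 : ℂ) else 0)) •
          (mulBase (S.V i.1 j.1 i.2 j.2) * modeG j.1 j.2) := by
  have hB : ∀ c : BaseRing p q, HasParity 0 c →
      mulBase c * (modeJ i.1 i.2 * modeJ j.1 j.2) * modeG b l -
      modeG b l * (mulBase c * (modeJ i.1 i.2 * modeJ j.1 j.2)) =
      (0 : Module.End ℂ (Fock p q r)) := by
    intro c hc
    rw [← mul_assoc (modeG b l), modeG_mulBase_even _ _ hc, mul_assoc, mul_assoc,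
      mul_assoc (mulBase c) (modeG b l), ← mul_sub,
      modeJ_modeG, ← mul_assoc, modeJ_modeG, mul_assoc, sub_self,
      mul_zero]
  have hφ : ∀ c : BaseRing p q, HasParity 1 c →
      mulBase c * (modeJ i.1 i.2 * modeG j.1 j.2) * modeG b l -
      modeG b l * (mulBase c * (modeJ i.1 i.2 * modeG j.1 j.2)) =
      ((if j.1 = b ∧ (j.2 : ℤ) + l = 0 then (1 : ℂ) else 0) • (mulBase c * modeJ i.1 i.2) :
        Module.End ℂ (Fock p q r)) := by
    intro c hc
    rw [← mul_assoc (modeG b l), modeG_mulBase_odd _ _ hc, neg_mul, sub_neg_eq_add, mul_assoc,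
      mul_assoc, mul_assoc (mulBase c) (modeG b l), ← mul_add, modeG_anticomm j.1 b, mul_add (modeJ i.1 _), mul_neg,
      ← mul_assoc, ← mul_assoc (modeG b l), modeJ_modeG, mul_smul_comm, mul_one]
    rw [neg_add_eq_sub, sub_add_cancel, mul_smul_comm]
  have hV : ∀ c : BaseRing p q, HasParity 0 c →
      mulBase c * (modeG i.1 i.2 * modeG j.1 j.2) * modeG b l -
      modeG b l * (mulBase c * (modeG i.1 i.2 * modeG j.1 j.2)) =
      ((if j.1 = b ∧ (j.2 : ℤ) + l = 0 then (1 : ℂ) else 0) • (mulBase c * modeG i.1 i.2) +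
      (-(if i.1 = b ∧ (i.2 : ℤ) + l = 0 then (1 : ℂ) else 0)) • (mulBase c * modeG j.1 j.2) :
        Module.End ℂ (Fock p q r)) := by
    intro c hc
    rw [← mul_assoc (modeG b l), modeG_mulBase_even _ _ hc, mul_assoc, mul_assoc,
      mul_assoc (mulBase c) (modeG b l), ← mul_sub,
      modeG_anticomm j.1 b, mul_add, mul_neg, ← mul_assoc,
      modeG_anticomm i.1 b]
    simp only [add_mul, mul_smul_comm, smul_mul_assoc, one_mul, mul_one, mul_assoc, neg_mul,
      neg_add, neg_neg, neg_smul]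
    rw [← mul_smul_comm, ← mul_smul_comm, ← mul_neg, ← mul_add]
    congr 1
    abel
  have split : ∀ (x y : ℂ) (P Q R J : Module.End ℂ (Fock p q r)),
      (x • P + y • Q + R) * J - J * (x • P + y • Q + R) =
        x • (P * J - J * P) + y • (Q * J - J * Q) + (R * J - J * R) := fun x y P Q R J => by
    simp only [add_mul, mul_add, smul_mul_assoc, mul_smul_comm, smul_sub]
    abel
  rw [termPhi_eq, split, hB _ (S.B_even _ _ _ _), hφ _ (S.φ_odd _ _ _ _), hV _ (S.V_even _ _ _ _),
    smul_zero, zero_add, smul_smul, add_assoc]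

/-- The two lines of the double sum contribute equally for `B`, by symmetry, and for `V`, by
antisymmetry and anticommutation, which cancels the `½` of log `Φ`. The mixed term lies on one line
only, whence its coefficient 2. -/
theorem innerDer_opPhi_cur (m : Mode r) :
    HasOpSum (fun i => mulBase ((i.2 : ℂ)⁻¹ • polEven S m i) * modeJ i.1 i.2 +
      mulBase (polOdd S m i) * modeG i.1 i.2) (innerDer (opPhi S) (cur m)) := by
  have h : HasOpSum (fun i => (1 / 2 : ℂ) • (termPhi S i * cur m - cur m * termPhi S i))
      (innerDer (opPhi S) (cur m)) :=
    ((hasOpSum_opPhi S).commutator (cur m)).congr fun i => by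
      rw [smul_mul_assoc, mul_smul_comm, smul_sub]
  -- For annihilation modes other than `Γ_{b,0}`, and for `J_{b,0} = 0`, all commutators and all
  -- coefficients vanish.
  have zero_case : (∀ i j, termPhi S (i, j) * cur m - cur m * termPhi S (i, j) = 0) →
      (∀ i, polEven S m i = 0 ∧ polOdd S m i = 0) →
      HasOpSum (fun i => mulBase ((i.2 : ℂ)⁻¹ • polEven S m i) * modeJ i.1 i.2 +
        mulBase (polOdd S m i) * modeG i.1 i.2) (innerDer (opPhi S) (cur m)) := by
    intro h1 h2
    rw [h.unique (HasOpSum.zero.congr fun ij => by rw [h1 ij.1 ij.2, smul_zero])]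
    exact HasOpSum.zero.congr fun i => by simp [h2 i, mulBase_zero]
  rcases m with ⟨b, l⟩ | ⟨b, l⟩
  · by_cases hl : 0 < l
    · obtain ⟨n, rfl⟩ : ∃ n : ℕ, l = n := ⟨l.toNat, by omega⟩
      have hn : n ≠ 0 := by omega
      have hn' : (n : ℂ) ≠ 0 := by exact_mod_cast hn
      have hcond : ∀ i : Fin r × ℕ, (i.1 = b ∧ (i.2 : ℤ) + -(n : ℤ) = 0) ↔ i = (b, n) := fun i => by
        rw [Prod.ext_iff]; constructor <;> rintro ⟨h1, h2⟩ <;> exact ⟨h1, by omega⟩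
      refine (hasOpSum_pair (b, n) (α := fun i => (i.2 : ℂ)⁻¹ • S.B i.1 b i.2 n) (β := fun _ => 0)
        (α' := fun j => (j.2 : ℂ)⁻¹ • S.B b j.1 n j.2) (β' := fun j => (2 : ℂ) • S.φ b j.1 n j.2)
        h fun i j => ?_).congr fun i => ?_
      · simp only [cur, Sum.elim_inl, termPhi_modeJ, hcond]
        congr 1
        · split_ifs with hj
          · rw [hj, natCast_smul_inv_mul _ _ hn, mulBase_smul, smul_mul_assoc, mulBase_zero, zero_mul,
              add_zero]
          · rw [mul_zero, zero_smul]
        · split_ifs with hi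
          · rw [hi, mul_comm (n : ℂ), natCast_smul_inv_mul _ _ hn, mul_assoc, inv_mul_cancel₀ hn',
              mulBase_smul, mulBase_smul, smul_mul_assoc, smul_mul_assoc, mul_one]
          · simp only [mul_zero, zero_smul, add_zero]
      · simp only [polEven, polOdd, if_pos hl, Int.toNat_natCast, zero_add, smul_smul]
        rw [S.B_symm b i.1, ← two_smul ℂ, smul_smul]
        norm_num
    · refine zero_case (fun i j => ?_) fun i => by simp [polEven, polOdd, hl]
      simp only [cur, Sum.elim_inl, termPhi_modeJ]
      have : ∀ i : Fin r × ℕ, (if i.1 = b ∧ (i.2 : ℤ) + -l = 0 then (i.2 : ℂ) else 0) = 0 := by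
        intro i
        split_ifs with hi
        · have : i.2 = 0 := by omega
          simp [this]
        · rfl
      simp [this]
  · by_cases hl : 0 ≤ l
    · obtain ⟨n, rfl⟩ : ∃ n : ℕ, l = n := ⟨l.toNat, by omega⟩
      have hcond : ∀ i : Fin r × ℕ, (i.1 = b ∧ (i.2 : ℤ) + -(n : ℤ) = 0) ↔ i = (b, n) := fun i => by
        rw [Prod.ext_iff]; constructor <;> rintro ⟨h1, h2⟩ <;> exact ⟨h1, by omega⟩
      refine (hasOpSum_pair (b, n) (α := fun i => (2 * (i.2 : ℂ)⁻¹) • S.φ i.1 b i.2 n)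
        (β := fun i => S.V i.1 b i.2 n)
        (α' := fun j => 0) (β' := fun j => -S.V b j.1 n j.2)
        h fun i j => ?_).congr fun i => ?_
      · simp only [cur, Sum.elim_inr, termPhi_modeG, hcond]
        congr 1
        · split_ifs with hj
          · rw [hj, mulBase_smul, smul_mul_assoc, mul_one, one_smul]
          · rw [mul_zero, zero_smul, zero_smul, add_zero]
        · split_ifs with hi
          · rw [hi, mulBase_zero, zero_mul, zero_add, ← neg_one_smul ℂ (S.V b j.1 n j.2),
              mulBase_smul, smul_mul_assoc]
          · rw [neg_zero, zero_smul]
      · simp only [polEven, polOdd, if_pos hl, Int.toNat_natCast, add_zero, smul_smul]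
        rw [S.V_antisymm b i.1, neg_neg, ← two_smul ℂ, smul_smul, ← mul_assoc]
        norm_num
    · refine zero_case (fun i j => ?_) fun i => by simp [polEven, polOdd, hl]
      simp only [cur, Sum.elim_inr, termPhi_modeG]
      have : ∀ i : Fin r × ℕ, (if i.1 = b ∧ (i.2 : ℤ) + -l = 0 then (1 : ℂ) else 0) = 0 := by
        intro i
        split_ifs with hi
        · omega
        · rfl
      simp [this]

theorem innerDer_mul' {A : Type*} [Ring A] [Algebra ℂ A] (X U V : A) :
    innerDer X (U * V) = innerDer X U * V + U * innerDer X V := by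
  simp only [innerDer_apply]; noncomm_ring

theorem innerDer_opPhi_modeJ (a : Fin r) (k : ℕ) :
    innerDer (opPhi S) (modeJ a k) = 0 := by
  have h := innerDer_opPhi_cur S (Sum.inl (a, -(k : ℤ)))
  have e : (cur (Sum.inl (a, -(k : ℤ))) : Module.End ℂ (Fock p q r)) = modeJ a k := by
    simp [cur]
  rw [e] at h
  refine h.unique (HasOpSum.zero.congr fun i => ?_)
  have : ¬ (0 < -(k : ℤ)) := by omega
  simp only [polEven, polOdd, if_neg this, mulBase_zero, smul_zero, zero_mul, add_zero]

theorem innerDer_opPhi_modeG (a : Fin r) (k : ℕ) (hk : 0 < k) :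
    innerDer (opPhi S) (modeG a k) = 0 := by
  have h := innerDer_opPhi_cur S (Sum.inr (a, -(k : ℤ)))
  have e : (cur (Sum.inr (a, -(k : ℤ))) : Module.End ℂ (Fock p q r)) = modeG a k := by
    simp [cur]
  rw [e] at h
  refine h.unique (HasOpSum.zero.congr fun i => ?_)
  have : ¬ (0 ≤ -(k : ℤ)) := by omega
  simp only [polEven, polOdd, if_neg this, mulBase_zero, smul_zero, zero_mul, add_zero]

/-- Among the nonnegative modes only `Γ_{c,0}` fails to commute with log `Φ`, so the second
commutator sees only the zero-mode coefficients of the first. -/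
theorem innerDer_opPhi_cur_two (m : Mode r) :
    innerDer (opPhi S) (innerDer (opPhi S) (cur m)) =
      ∑ c, mulBase (polOdd S m (c, 0)) * innerDer (opPhi S) (cur (Sum.inr (c, 0))) := by
  have h := (innerDer_opPhi_cur S m).commutator' (opPhi S)
  have key : ∀ i : Fin r × ℕ, opPhi S * (mulBase ((i.2 : ℂ)⁻¹ • polEven S m i) * modeJ i.1 i.2 +
      mulBase (polOdd S m i) * modeG i.1 i.2) - (mulBase ((i.2 : ℂ)⁻¹ • polEven S m i) *
      modeJ i.1 i.2 + mulBase (polOdd S m i) * modeG i.1 i.2) * opPhi S =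
      mulBase (polOdd S m i) * innerDer (opPhi S) (modeG i.1 i.2) := by
    intro i
    rw [← innerDer_apply, map_add, innerDer_mul', innerDer_mul', innerDer_opPhi_modeJ,
      innerDer_opPhi_mulBase S ((polEven_parity S m i).smul _),
      innerDer_opPhi_mulBase S (polOdd_parity S m i)]
    simp
  have h' := HasOpSum.finset_sum (f := fun i : Fin r × ℕ =>
    mulBase (polOdd S m i) * innerDer (opPhi S) (modeG i.1 i.2)) (Finset.univ ×ˢ {0})
    (fun i hi => by
      have : 0 < i.2 := Nat.pos_of_ne_zero fun h0 => hi (Finset.mem_product.mpr ⟨Finset.mem_univ _, by simp [h0]⟩)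
      rw [innerDer_opPhi_modeG S _ _ this, mul_zero])
  rw [innerDer_apply, h.unique (h'.congr key), Finset.sum_product]
  simp [cur]

/-- The third commutator would involve the zero-mode coefficients of `[log Φ, Γ_{c,0}]`, which are
`V_{00} = 0`. -/
theorem innerDer_opPhi_cur_three (m : Mode r) :
    innerDer (opPhi S) (innerDer (opPhi S) (innerDer (opPhi S) (cur m))) = 0 := by
  rw [innerDer_opPhi_cur_two, map_sum]
  refine Finset.sum_eq_zero fun c _ => ?_
  rw [innerDer_mul', innerDer_opPhi_mulBase S (polOdd_parity S m _), zero_mul, zero_add,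
    innerDer_opPhi_cur_two, Finset.sum_eq_zero, mul_zero]
  intro d _
  simp [polOdd, S.V_zero_zero, mulBase_zero]

end Polarisation


/-! ### Currents in the changed polarisation -/

section Dressed

variable {p q r : ℕ} (S : CurveData p q r)

/-- The basis differential with the pole dual to a variable. -/
def dualMode : Coord r → Mode r
  | .inl (a, k) => .inl (a, -(k : ℤ))
  | .inr (a, k) => .inr (a, -(k : ℤ))

/-- The coefficient of the modes `k J_{a,k}` in the conjugate of a current. -/
def regEven (m : Mode r) (i : Fin r × ℕ) : BaseRing p q :=
  polEven S m i + (1 / 2 : ℂ) • ∑ c, polOdd S m (c, 0) * polEven S (Sum.inr (c, 0)) i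

/-- The coefficient of the modes `Γ_{a,k}` in the conjugate of a current. -/
def regOdd (m : Mode r) (i : Fin r × ℕ) : BaseRing p q :=
  polOdd S m i + (1 / 2 : ℂ) • ∑ c, polOdd S m (c, 0) * polOdd S (Sum.inr (c, 0)) i

open Classical in
-- The quadratic corrections in `dξ` are half of the second commutator with log `Φ`, and the pole is
-- the undeformed current.
theorem dxi_inl (i : Fin r × ℕ+) (m : Mode r) : S.dxi (Sum.inl i) m =
    (if m = dualMode (Sum.inl i) then 1 else 0) +
      ((i.2 : ℂ)⁻¹) • regEven S m (i.1, (i.2 : ℕ)) := by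
  rcases m with ⟨b, l⟩ | ⟨b, l⟩
  · by_cases hl : 0 < l <;> simp [CurveData.dxi, regEven, dualMode, polEven, polOdd, hl]
  · by_cases hl : 0 ≤ l <;> simp [CurveData.dxi, regEven, dualMode, polEven, polOdd, hl]

theorem V_comm (a b : Fin r) (k l : ℕ) (x : BaseRing p q) :
    S.V a b k l * x = x * S.V a b k l := by
  have h := (even_part_mul (S.V a b k l) x).1
  rw [S.V_even, pow_zero, one_smul, ← two_smul ℂ (S.V a b k l), smul_mul_assoc,
    mul_smul_comm] at h
  exact smul_right_injective _ (two_ne_zero (α := ℂ)) h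

open Classical in
theorem dxi_inr (i : Fin r × ℕ) (m : Mode r) : S.dxi (Sum.inr i) m =
    (if m = dualMode (Sum.inr i) then 1 else 0) + regOdd S m i := by
  rcases m with ⟨b, l⟩ | ⟨b, l⟩
  · by_cases hl : 0 < l
    · simp only [CurveData.dxi, regOdd, dualMode, polOdd, hl, if_true, le_refl, Int.toNat_zero]
      simp [fun c x => V_comm S i.1 c i.2 0 x]
    · simp [CurveData.dxi, regOdd, dualMode, polOdd, hl]
  · by_cases hl : 0 ≤ l
    · simp only [CurveData.dxi, regOdd, dualMode, polOdd, hl, if_true, le_refl, Int.toNat_zero]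
      simp [fun c x => V_comm S i.1 c i.2 0 x]
    · simp [CurveData.dxi, regOdd, dualMode, polOdd, hl]

/-- The derivation dual to a basis differential, in the changed polarisation. -/
def dOp (m : Mode r) : Module.End ℂ (Fock p q r) :=
  opSum fun i => mulBase (S.dxi i m) * coordDeriv i

theorem hasOpSum_dOp (m : Mode r) :
    HasOpSum (fun i => mulBase (S.dxi i m) * coordDeriv i : Coord r → Module.End ℂ (Fock p q r))
      (dOp S m) :=
  hasOpSum_coordDeriv _

/-- The variable in a creation operator. -/
def creation : Mode r → Fock p q r
  | .inl (b, l) => if h : 0 < l then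
      (l : ℂ) • evenVar (Sum.inr (b, ⟨l.toNat, by omega⟩)) else 0
  | .inr (b, l) => if 0 < l then oddVar (Sum.inr (b, l.toNat)) else 0

/-- The multiplication part of the conjugate of a current. -/
def src (m : Mode r) : Fock p q r :=
  creation m + (1 / 2 : ℂ) •
    ∑ a, baseIncl p q r (S.dxi (Sum.inr (a, 0)) m) * oddVar (Sum.inr (a, 0))

open Classical in
-- According to the sign of its index a current is a partial derivative or a multiplication. Only
-- `Γ_{b,0}` is both, with the factor `½` on its multiplication part.
theorem cur_eq (m : Mode r) : ∃ D : Module.End ℂ (Fock p q r),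
    HasOpSum (fun i => mulBase (if m = dualMode i then 1 else 0) * coordDeriv i) D ∧
      cur m = D + LinearMap.mulLeft ℂ (creation m + (1 / 2 : ℂ) • ∑ a,
        baseIncl p q r (if m = dualMode (Sum.inr (a, 0)) then 1 else 0) *
          oddVar (Sum.inr (a, 0))) := by
  have hone : (mulBase 1 : Module.End ℂ (Fock p q r)) = 1 :=
    LinearMap.ext fun v => by simp [mulBase_apply]
  have hzero : (∀ i, m ≠ dualMode i) →
      HasOpSum (fun i => mulBase (if m = dualMode i then 1 else 0) * coordDeriv i)
        (0 : Module.End ℂ (Fock p q r)) := fun h =>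
    HasOpSum.zero.congr fun i => by rw [if_neg (h i), mulBase_zero, zero_mul]
  have hsing : ∀ i₀, m = dualMode i₀ → (∀ i, m = dualMode i → i = i₀) →
      HasOpSum (fun i => mulBase (if m = dualMode i then 1 else 0) * coordDeriv i)
        (coordDeriv i₀ : Module.End ℂ (Fock p q r)) := fun i₀ h h' => by
    have := HasOpSum.single (f := fun i => (mulBase (if m = dualMode i then 1 else 0) *
      coordDeriv i : Module.End ℂ (Fock p q r))) i₀ (fun j hj => by
        rw [if_neg fun e => hj (h' j e), mulBase_zero, zero_mul])
    rwa [if_pos h, hone, one_mul] at this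
  rcases m with ⟨b, l⟩ | ⟨b, l⟩
  · rcases int_cases_pnat l with rfl | ⟨n, rfl⟩ | ⟨n, rfl⟩
    · refine ⟨0, hzero ?_, ?_⟩
      · rintro (⟨a, k⟩ | ⟨a, k⟩) <;> simp [dualMode]
      · simp [cur, creation, dualMode]
    · refine ⟨0, hzero ?_, ?_⟩
      · rintro (⟨a, k⟩ | ⟨a, k⟩) <;> simp only [dualMode, ne_eq, Sum.inl.injEq, Prod.mk.injEq,
          not_and, reduceCtorEq, not_false_eq_true]
        have := n.pos; have := k.pos
        omega
      · refine LinearMap.ext fun v => ?_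
        simp [cur, creation, dualMode]
        rfl
    · refine ⟨_, hsing (Sum.inl (b, n)) rfl ?_, ?_⟩
      · rintro (⟨a, k⟩ | ⟨a, k⟩) <;> simp only [dualMode, Sum.inl.injEq, Prod.mk.injEq, reduceCtorEq,
          false_imp_iff]
        rintro ⟨rfl, h⟩
        exact ⟨rfl, PNat.coe_inj.mp (by omega)⟩
      · have : ¬ (0 < -(n : ℤ)) := by omega
        simp only [cur, creation, dualMode, this]
        simp [coordDeriv]
  · rcases int_cases_pnat l with rfl | ⟨n, rfl⟩ | ⟨n, rfl⟩
    · refine ⟨_, hsing (Sum.inr (b, 0)) (by simp [dualMode]) ?_, ?_⟩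
      · rintro (⟨a, k⟩ | ⟨a, k⟩) <;> simp only [dualMode, Sum.inr.injEq, Prod.mk.injEq, reduceCtorEq,
          false_imp_iff]
        rintro ⟨rfl, h⟩
        exact ⟨rfl, by omega⟩
      · have : (∑ a, baseIncl p q r (if (Sum.inr (b, 0) : Mode r) = dualMode (Sum.inr (a, 0)) then 1
            else 0) * oddVar (Sum.inr (a, 0))) = oddVar (Sum.inr (b, 0)) := by
          rw [Finset.sum_eq_single b]
          · simp [dualMode]
          · intro a _ ha
            simp [dualMode, Ne.symm ha]
          · simp
        rw [this]
        refine LinearMap.ext fun v => ?_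
        simp [cur, creation, modeG_zero, coordDeriv, add_comm]
    · refine ⟨0, hzero ?_, ?_⟩
      · rintro (⟨a, k⟩ | ⟨a, k⟩) <;> simp only [dualMode, ne_eq, Sum.inr.injEq, Prod.mk.injEq,
          not_and, reduceCtorEq, not_false_eq_true]
        have := n.pos
        omega
      · refine LinearMap.ext fun v => ?_
        simp [cur, creation, dualMode]
    · refine ⟨_, hsing (Sum.inr (b, n)) rfl ?_, ?_⟩
      · rintro (⟨a, k⟩ | ⟨a, k⟩) <;> simp only [dualMode, Sum.inr.injEq, Prod.mk.injEq, reduceCtorEq,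
          false_imp_iff]
        rintro ⟨rfl, h⟩
        exact ⟨rfl, by omega⟩
      · have : ¬ (0 < -(n : ℤ)) := by omega
        have h2 := n.pos
        simp only [cur, creation, dualMode, this]
        simp [coordDeriv]

open Classical in
-- The left side is the whole exponential series of log `Φ` on a current, which stops at second
-- order. Besides the derivative `dOp` it contains the halves `½ θ^{a,0}` carried by the zero modes;
-- together with the creation operator they make up `src`.
theorem expInner_opPhi_cur (m : Mode r) :
    cur m + innerDer (opPhi S) (cur m) +
      (1 / 2 : ℂ) • innerDer (opPhi S) (innerDer (opPhi S) (cur m)) =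
      dOp S m + LinearMap.mulLeft ℂ (src S m) := by
  obtain ⟨D, hD, hcur⟩ := cur_eq (p := p) (q := q) m
  have h1 : HasOpSum (fun i => mulBase ((i.2 : ℂ)⁻¹ • regEven S m i) * modeJ i.1 i.2 +
      mulBase (regOdd S m i) * modeG i.1 i.2) (innerDer (opPhi S) (cur m) +
        (1 / 2 : ℂ) • innerDer (opPhi S) (innerDer (opPhi S) (cur m))) := by
    rw [innerDer_opPhi_cur_two]
    refine ((innerDer_opPhi_cur S m).add ((HasOpSum.sum Finset.univ fun c _ =>
      (innerDer_opPhi_cur S (Sum.inr (c, 0))).mul_left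
        (mulBase (polOdd S m (c, 0)))).smul (1 / 2))).congr fun i => ?_
    simp only [mul_add, Finset.sum_add_distrib, ← mul_assoc, mulBase_mul, regEven, regOdd,
      mulBase_add, mulBase_smul, mulBase_sum, smul_add, add_mul, Finset.sum_mul, smul_mul_assoc,
      mul_smul_comm, Finset.smul_sum]
    simp only [smul_comm (1 / 2 : ℂ)]
    abel
  -- The multiplication halves of the zero modes, one per disc.
  have hθ := HasOpSum.finset_sum (f := fun i : Fin r × ℕ => (if i.2 = 0 then
      (1 / 2 : ℂ) • (mulBase (regOdd S m i) * LinearMap.mulLeft ℂ (oddVar (Sum.inr i))) else 0 :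
        Module.End ℂ (Fock p q r))) (Finset.univ ×ˢ {0})
      (fun i hi => if_neg fun h0 => hi (Finset.mem_product.mpr ⟨Finset.mem_univ _, by simp [h0]⟩))
  have hJ : HasOpSum (fun i : Fin r × ℕ+ => mulBase ((i.2 : ℂ)⁻¹ • regEven S m (i.1, (i.2 : ℕ))) *
      evenDeriv (Sum.inr i)) (opSum fun i : Fin r × ℕ+ =>
        mulBase ((i.2 : ℂ)⁻¹ • regEven S m (i.1, (i.2 : ℕ))) * evenDeriv (Sum.inr i) :
          Module.End ℂ (Fock p q r)) := by
    refine hasOpSum_opSum fun v => ((evenDeriv_finite v).preimage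
      Sum.inr_injective.injOn).subset fun i hi => ?_
    by_contra hn
    exact hi (by simp [Function.notMem_support.mp hn])
  have hG : HasOpSum (fun i : Fin r × ℕ => mulBase (regOdd S m i) *
      oddDeriv (Sum.inr i)) (opSum fun i : Fin r × ℕ =>
        mulBase (regOdd S m i) * oddDeriv (Sum.inr i) : Module.End ℂ (Fock p q r)) := by
    refine hasOpSum_opSum fun v => ((oddDeriv_finite v).preimage
      Sum.inr_injective.injOn).subset fun i hi => ?_
    by_contra hn
    exact hi (by simp [Function.notMem_support.mp hn])
  -- The index `k = 0` may be added or dropped because `J_{a,0} = 0`.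
  have hJ' : HasOpSum (fun i : Fin r × ℕ => mulBase ((i.2 : ℂ)⁻¹ • regEven S m i) *
      modeJ i.1 i.2) (opSum fun i : Fin r × ℕ+ =>
        mulBase ((i.2 : ℂ)⁻¹ • regEven S m (i.1, (i.2 : ℕ))) * evenDeriv (Sum.inr i) :
          Module.End ℂ (Fock p q r)) := by
    refine HasOpSum.extend (fun i : Fin r × ℕ+ => (i.1, (i.2 : ℕ))) ?_ ?_ ?_
    · rintro ⟨a, k⟩ ⟨b, l⟩ h
      simpa using h
    · exact hJ.congr fun i => by simp
    · rintro ⟨a, k⟩ hk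
      have : k = 0 := by
        by_contra h0
        exact hk ⟨(a, ⟨k, Nat.pos_of_ne_zero h0⟩), rfl⟩
      subst this
      simp
  have hG' : ∀ i : Fin r × ℕ, mulBase (regOdd S m i) * modeG i.1 i.2 =
      (mulBase (regOdd S m i) * oddDeriv (Sum.inr i) + (if i.2 = 0 then
      (1 / 2 : ℂ) • (mulBase (regOdd S m i) * LinearMap.mulLeft ℂ (oddVar (Sum.inr i))) else 0) :
        Module.End ℂ (Fock p q r)) := by
    rintro ⟨a, k⟩
    by_cases h0 : k = 0
    · subst h0
      rw [if_pos rfl, Nat.cast_zero, modeG_zero, mul_add, mul_smul_comm, add_comm]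
    · obtain ⟨n, rfl⟩ : ∃ n : ℕ+, k = n := ⟨⟨k, Nat.pos_of_ne_zero h0⟩, rfl⟩
      rw [if_neg h0, modeG_pos, add_zero]
  have h4 := h1.unique ((hJ'.add (hG.add hθ)).congr fun i => by rw [hG'])
  have h5 := (hD.add (hJ.sumElim hG)).congr
    (g := fun i => mulBase (S.dxi i m) * coordDeriv i) (by
      rintro (i | i)
      · rw [dxi_inl, mulBase_add, add_mul]; rfl
      · rw [dxi_inr, mulBase_add, add_mul]; rfl)
  rw [(hasOpSum_dOp S m).unique h5, add_assoc, h4, hcur, Finset.sum_product]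
  refine LinearMap.ext fun v => ?_
  simp only [Finset.sum_singleton, if_true, LinearMap.add_apply, LinearMap.sum_apply,
    LinearMap.smul_apply, Module.End.mul_apply, mulBase_apply, LinearMap.mulLeft_apply, src,
    dxi_inr, map_add, add_mul, Finset.sum_add_distrib, smul_add, Finset.smul_sum, Finset.sum_mul,
    smul_mul_assoc, mul_assoc]
  abel

theorem dOp_apply (m : Mode r) (f : Fock p q r) :
    dOp S m f = ∑ᶠ i, baseIncl p q r (S.dxi i m) * coordDeriv i f :=
  (hasOpSum_dOp S m f).2

theorem dOp_finite (m : Mode r) (f : Fock p q r) :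
    (Function.support fun i => baseIncl p q r (S.dxi i m) * coordDeriv i f).Finite :=
  (hasOpSum_dOp S m f).1

theorem polEven_parity' (m : Mode r) (i : Fin r × ℕ) : HasParity (par m) (regEven S m i) := by
  refine (polEven_parity S m i).add (HasParity.smul _ (HasParity.sum _ fun c _ => ?_))
  exact ((polOdd_parity S m (c, 0)).mul (polEven_parity S (Sum.inr (c, 0)) i)).congr
    (by simp [par]; omega)

theorem polOdd_parity' (m : Mode r) (i : Fin r × ℕ) : HasParity (par m + 1) (regOdd S m i) := by
  refine (polOdd_parity S m i).add (HasParity.smul _ (HasParity.sum _ fun c _ => ?_))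
  exact ((polOdd_parity S m (c, 0)).mul (polOdd_parity S (Sum.inr (c, 0)) i)).congr
    (by simp [par])

theorem par_dualMode (i : Coord r) : par (dualMode i) = par i := by
  rcases i with i | i <;> rfl

theorem dxi_parity (i : Coord r) (m : Mode r) : HasParity (par i + par m) (S.dxi i m) := by
  classical
  have hd : HasParity (par i + par m) (if m = dualMode i then (1 : BaseRing p q) else 0) := by
    split_ifs with h
    · rw [h, par_dualMode]
      exact HasParity.one.congr (by omega)
    · exact HasParity.zero _
  rcases i with i | i
  · rw [dxi_inl]
    exact hd.add (HasParity.smul _ ((polEven_parity' S m _).congr (by simp [par])))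
  · rw [dxi_inr]
    exact hd.add ((polOdd_parity' S m _).congr (by simp [par]; omega))

end Dressed


/-- Sign comparisons are reduced to polynomial identities modulo 2. -/
theorem neg_one_pow_congr {a b : ℕ} (h : (a : ZMod 2) = b) : (-1 : ℂ) ^ a = (-1) ^ b := by
  rw [neg_one_pow_eq_pow_mod_two, (ZMod.natCast_eq_natCast_iff' a b 2).mp h,
    ← neg_one_pow_eq_pow_mod_two]

/-! ### The polarised derivations and their supercommutation -/

section Derivation

variable {p q r : ℕ} (S : CurveData p q r)

theorem HasParity.dOp {d : ℕ} {f : Fock p q r} (m : Mode r) (hf : HasParity d f) :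
    HasParity (par m + d) (dOp S m f) := by
  rw [dOp_apply]
  refine HasParity.finsum fun i => ((dxi_parity S i m).baseIncl.mul (hf.coordDeriv i)).congr ?_
  omega

/-- The coefficient of parity `par i + par m` and the derivative of parity `par i` combine to an
operator of parity `par m` in every summand, so the sum is a superderivation. -/
theorem dOp_mul {d : ℕ} {f : Fock p q r} (m : Mode r) (hf : HasParity d f) (g : Fock p q r) :
    dOp S m (f * g) = dOp S m f * g + (-1 : ℂ) ^ (par m * d) • (f * dOp S m g) := by
  have h1 := (hasOpSum_dOp S m).mul_right (LinearMap.mulLeft ℂ f)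
  have h2 := ((hasOpSum_dOp S m).mul_left (LinearMap.mulLeft ℂ f)).smul ((-1 : ℂ) ^ (par m * d))
  have h3 : HasOpSum (fun i => LinearMap.mulLeft ℂ (baseIncl p q r (S.dxi i m) * coordDeriv i f))
      (LinearMap.mulLeft ℂ (dOp S m f)) := by
    intro v
    refine ⟨(dOp_finite S m f).subset fun i hi => ?_, ?_⟩
    · by_contra hn
      exact hi (by simp [Function.notMem_support.mp hn])
    · change dOp S m f * v = _
      rw [dOp_apply]
      exact (AddMonoidHom.mulRight v).map_finsum (dOp_finite S m f)
  have h4 := h1.unique ((h3.add h2).congr fun i => by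
    refine LinearMap.ext fun v => ?_
    change baseIncl p q r (S.dxi i m) * coordDeriv i (f * v) =
      baseIncl p q r (S.dxi i m) * coordDeriv i f * v +
        (-1 : ℂ) ^ (par m * d) • (f * (baseIncl p q r (S.dxi i m) * coordDeriv i v))
    rw [coordDeriv_mul i hf, mul_add, mul_smul_comm, ← mul_assoc, ← mul_assoc, ← mul_assoc,
      hf.mul_comm (dxi_parity S i m).baseIncl, smul_mul_assoc, smul_smul, ← pow_add]
    congr 2
    refine neg_one_pow_congr ?_
    push_cast
    generalize (par i : ZMod 2) = x, (par m : ZMod 2) = y, (d : ZMod 2) = z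
    revert x y z
    decide)
  exact congrArg (fun T => T g) h4

@[simp] theorem dOp_baseIncl (m : Mode r) (c : BaseRing p q) : dOp S m (baseIncl p q r c) = 0 := by
  rw [dOp_apply]
  simp [coordDeriv_baseIncl]

@[simp] theorem dOp_one (m : Mode r) : dOp S m (1 : Fock p q r) = 0 := by
  simpa using dOp_baseIncl S m 1

theorem dOp_coordVar (m : Mode r) (i : Coord r) :
    dOp S m (coordVar i) = baseIncl p q r (S.dxi i m) := by
  classical
  rw [dOp_apply, finsum_eq_single _ i]
  · simp [coordDeriv_coordVar]
  · intro j hj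
    simp [coordDeriv_coordVar, hj]

theorem dOp_dOp (m m' : Mode r) (f : Fock p q r) : dOp S m (dOp S m' f) =
    ∑ i ∈ (coordDeriv_finite f).toFinset, ∑ j ∈ (coordDeriv_finite f).toFinset,
      (-1 : ℂ) ^ (par i * (par j + par m')) •
        (baseIncl p q r (S.dxi i m * S.dxi j m') * coordDeriv i (coordDeriv j f)) := by
  have e : ∀ i j : Coord r, baseIncl p q r (S.dxi i m) *
      coordDeriv i (baseIncl p q r (S.dxi j m') * coordDeriv j f) =
      (-1 : ℂ) ^ (par i * (par j + par m')) • (baseIncl p q r (S.dxi i m * S.dxi j m') *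
        coordDeriv i (coordDeriv j f)) := fun i j => by
    rw [coordDeriv_mul i (dxi_parity S j m').baseIncl, coordDeriv_baseIncl, zero_mul, zero_add,
      mul_smul_comm, ← mul_assoc, map_mul]
  have h1 : dOp S m' f = ∑ j ∈ (coordDeriv_finite f).toFinset,
      baseIncl p q r (S.dxi j m') * coordDeriv j f := by
    rw [dOp_apply]
    refine finsum_eq_sum_of_support_subset _ fun j hj => ?_
    by_contra hn
    exact hj (by simp_all)
  rw [dOp_apply, h1]
  simp only [map_sum, Finset.mul_sum, e]
  refine finsum_eq_sum_of_support_subset _ fun i hi => ?_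
  by_contra hn
  have h0 : coordDeriv i f = 0 := by simpa using hn
  exact hi (Finset.sum_eq_zero fun j _ => by rw [coordDeriv_comm, h0]; simp)

/-- The coefficients are constant for the derivatives, so supercommutation of coefficients and of
partial derivatives suffices; the parities of the summation indices drop out of the sign. -/
theorem dOp_comm (m m' : Mode r) (f : Fock p q r) :
    dOp S m (dOp S m' f) = (-1 : ℂ) ^ (par m * par m') • dOp S m' (dOp S m f) := by
  rw [dOp_dOp, dOp_dOp, Finset.sum_comm, Finset.smul_sum]
  refine Finset.sum_congr rfl fun j _ => ?_
  rw [Finset.smul_sum]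
  refine Finset.sum_congr rfl fun i _ => ?_
  rw [(dxi_parity S i m).mul_comm (dxi_parity S j m'), coordDeriv_comm i j, map_smul,
    smul_mul_assoc, mul_smul_comm, smul_smul, smul_smul, smul_smul, ← pow_add, ← pow_add,
    ← pow_add]
  congr 1
  refine neg_one_pow_congr ?_
  push_cast
  generalize (par i : ZMod 2) = x, (par m : ZMod 2) = y, (par j : ZMod 2) = z,
    (par m' : ZMod 2) = w
  revert x y z w
  decide

theorem creation_parity (m : Mode r) : HasParity (par m) (creation m : Fock p q r) := by
  rcases m with ⟨b, l⟩ | ⟨b, l⟩ <;> simp only [creation] <;> split_ifs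
  exacts [(HasParity.evenVar _).smul _, HasParity.zero _, HasParity.oddVar _, HasParity.zero _]

theorem src_parity (m : Mode r) : HasParity (par m) (src S m) := by
  refine (creation_parity m).add ((HasParity.sum _ fun a _ => ?_).smul _)
  exact ((dxi_parity S _ m).baseIncl.mul (HasParity.oddVar _)).congr (by simp [par]; omega)

end Derivation

/-! ### Conjugation by the partition function -/

section PartitionFunction

variable {p q r : ℕ} (S : CurveData p q r) (Z : FreeEnergies p q r)

namespace FreeEnergies

/-- The coefficients of `log Z`. -/
def freeEnergy (χ : ℕ) : Fock p q r :=
  ∑ g ∈ Finset.range (χ + 2), ∑ n ∈ Finset.Icc 1 (χ + 2),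
    if 2 * g + n = χ + 2 then Z.poly g n else 0

theorem prod_coordVar_parity {n : ℕ} (i : Fin n → Coord r) : HasParity (∑ k, par (i k))
    (List.ofFn fun k => (coordVar (i k) : Fock p q r)).prod := by
  induction n with
  | zero => simpa using HasParity.one
  | succ n ih =>
    rw [List.ofFn_succ, List.prod_cons, Fin.sum_univ_succ]
    exact (HasParity.coordVar _).mul (ih _)

theorem poly_even (g n : ℕ) : HasParity 0 (Z.poly g n) := by
  exact HasParity.smul _ (HasParity.finsum fun i =>
    ((prod_coordVar_parity i).mul (Z.parity g n i).baseIncl).congr (by omega))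

theorem freeEnergy_even (χ : ℕ) : HasParity 0 (Z.freeEnergy χ) := by
  refine HasParity.sum _ fun g _ => HasParity.sum _ fun n _ => ?_
  split_ifs
  exacts [Z.poly_even g n, HasParity.zero _]

/-- Minus the logarithm of the partition function. -/
def negLog : PowerSeries (Module.End ℂ (Fock p q r)) :=
  -PowerSeries.mk fun χ => LinearMap.mulLeft ℂ (Z.freeEnergy χ)

theorem neg_logZ : -Z.logZ = toHOp p q r Z.negLog := by
  rw [negLog, map_neg]
  rfl

/-- The coefficients of the multiplication part of the conjugate of a current. -/
def current (m : Mode r) : ℕ → Fock p q r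
  | 0 => baseIncl p q r (S.omega01 m)
  | 1 => src S m + dOp S m (Z.freeEnergy 0)
  | d + 2 => dOp S m (Z.freeEnergy (d + 1))

theorem current_parity (m : Mode r) (d : ℕ) : HasParity (par m) (Z.current S m d) := by
  rcases d with _ | _ | d
  · exact (omega01_parity S m).baseIncl
  · exact (src_parity S m).add ((Z.freeEnergy_even 0).dOp S m)
  · exact (Z.freeEnergy_even _).dOp S m

/-- The series is `-log Z`, hence the bracket appears with the order reversed. -/
theorem innerDer_negLog_monomial (n : ℕ) (A : Module.End ℂ (Fock p q r)) (d : ℕ) :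
    PowerSeries.coeff d (innerDer Z.negLog (PowerSeries.monomial n A)) =
      if n ≤ d then innerDer A (LinearMap.mulLeft ℂ (Z.freeEnergy (d - n))) else 0 := by
  have : PowerSeries.monomial n A = PowerSeries.C A * PowerSeries.X ^ n := by
    ext1 d
    rw [PowerSeries.coeff_C_mul, PowerSeries.coeff_X_pow, PowerSeries.coeff_monomial]
    split_ifs <;> simp
  rw [this, innerDer_mul', innerDer_X_pow, mul_zero, add_zero, PowerSeries.coeff_mul_X_pow']
  split_ifs with h
  · rw [innerDer_apply, innerDer_apply, map_sub, PowerSeries.coeff_mul_C, PowerSeries.coeff_C_mul,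
      negLog, map_neg, PowerSeries.coeff_mk, neg_mul, mul_neg]
    abel
  · rfl

theorem innerDer_mulLeft (f : Fock p q r) (χ : ℕ) :
    innerDer (LinearMap.mulLeft ℂ f) (LinearMap.mulLeft ℂ (Z.freeEnergy χ)) = 0 := by
  refine LinearMap.ext fun v => ?_
  change f * (Z.freeEnergy χ * v) - Z.freeEnergy χ * (f * v) = 0
  have h := (even_part_mul (Z.freeEnergy χ) f).1
  rw [Z.freeEnergy_even, pow_zero, one_smul, ← two_smul ℂ (Z.freeEnergy χ), smul_mul_assoc,
    mul_smul_comm] at h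
  rw [← mul_assoc, ← mul_assoc, smul_right_injective _ (two_ne_zero (α := ℂ)) h, sub_self]

theorem innerDer_negLog_mk (f : ℕ → Fock p q r) :
    innerDer Z.negLog (PowerSeries.mk fun d => LinearMap.mulLeft ℂ (f d)) = 0 := by
  ext1 d
  rw [innerDer_apply, map_sub, PowerSeries.coeff_mul, PowerSeries.coeff_mul,
    ← Finset.Nat.sum_antidiagonal_swap, ← Finset.sum_sub_distrib, map_zero]
  refine Finset.sum_eq_zero fun e _ => ?_
  have := Z.innerDer_mulLeft (f e.1) e.2
  rw [innerDer_apply] at this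
  simp only [negLog, map_neg, PowerSeries.coeff_mk, Prod.fst_swap, Prod.snd_swap, neg_mul,
    mul_neg]
  rw [sub_neg_eq_add, neg_add_eq_sub, this]

theorem innerDer_dOp (m : Mode r) (χ : ℕ) :
    innerDer (dOp S m) (LinearMap.mulLeft ℂ (Z.freeEnergy χ)) =
      LinearMap.mulLeft ℂ (dOp S m (Z.freeEnergy χ)) := by
  refine LinearMap.ext fun v => ?_
  change dOp S m (Z.freeEnergy χ * v) - Z.freeEnergy χ * dOp S m v =
    dOp S m (Z.freeEnergy χ) * v
  rw [dOp_mul S m (Z.freeEnergy_even χ)]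
  simp

theorem innerDer_monomial_zero {A : Type*} [Ring A] [Algebra ℂ A] (y a : A) (n : ℕ) :
    innerDer (PowerSeries.monomial 0 y) (PowerSeries.monomial n a) =
      PowerSeries.monomial n (innerDer y a) := by
  rw [innerDer_apply, innerDer_apply, PowerSeries.monomial_mul_monomial,
    PowerSeries.monomial_mul_monomial, zero_add, add_zero, map_sub]

/-- The constant `ω_{0,1}(m)` produced by `T` commutes with log `Φ`, so only the `ħ`-linear part is
deformed. -/
theorem polarised_cur (m : Mode r) :
    (innerDer (PowerSeries.monomial 0 (opPhi S)) ^ 3) (shiftOne (opT S) (cur m)) = 0 ∧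
    expInner 3 (PowerSeries.monomial 0 (opPhi S)) (shiftOne (opT S) (cur m)) =
      PowerSeries.monomial 1 (dOp S m + LinearMap.mulLeft ℂ (src S m)) +
        PowerSeries.monomial 0 (mulBase (S.omega01 m)) := by
  have h0 := innerDer_opPhi_mulBase S (omega01_parity S m)
  refine ⟨?_, ?_⟩
  · simp only [pow_succ', pow_zero, Module.End.mul_apply, Module.End.one_apply, shiftOne, map_add,
      innerDer_monomial_zero, innerDer_opT_cur, innerDer_opPhi_cur_three, h0, map_zero, add_zero]
  · rw [expInner_apply, Finset.sum_range_succ, Finset.sum_range_succ, Finset.sum_range_one,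
      ← expInner_opPhi_cur]
    simp only [pow_succ', pow_zero, Module.End.mul_apply, Module.End.one_apply, shiftOne, map_add,
      innerDer_monomial_zero, innerDer_opT_cur, h0, map_zero, add_zero, monomial_smul]
    norm_num
    abel

/-- The conjugate of a current by the dilaton shift, the change of polarisation and the partition
function. -/
theorem dressOne_cur (m : Mode r) :
    DressOneFinite (opT S) (opPhi S) Z.negLog (cur m) ∧
    dressOne (opT S) (opPhi S) Z.negLog (cur m) = PowerSeries.monomial 1 (dOp S m) +
      PowerSeries.mk fun d => LinearMap.mulLeft ℂ (Z.current S m d) := by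
  have hd : innerDer Z.negLog (PowerSeries.monomial 1 (dOp S m + LinearMap.mulLeft ℂ (src S m)) +
        PowerSeries.monomial 0 (mulBase (S.omega01 m))) =
      PowerSeries.mk fun d => LinearMap.mulLeft ℂ
        (if 1 ≤ d then dOp S m (Z.freeEnergy (d - 1)) else 0) := by
    ext1 d
    rw [map_add, map_add, map_add, map_add, map_add, innerDer_negLog_monomial, innerDer_negLog_monomial,
      innerDer_negLog_monomial, innerDer_dOp, mulBase, innerDer_mulLeft, innerDer_mulLeft,
      PowerSeries.coeff_mk]
    split_ifs <;> first | omega | simp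
  have hd2 := Z.innerDer_negLog_mk fun d => if 1 ≤ d then dOp S m (Z.freeEnergy (d - 1)) else 0
  refine ⟨⟨?_, (polarised_cur S m).1, ?_⟩, ?_⟩
  · rw [pow_two, Module.End.mul_apply, innerDer_opT_cur,
      innerDer_opT_mulBase S (omega01_parity S m)]
  · rw [(polarised_cur S m).2, pow_two, Module.End.mul_apply, hd, hd2]
  · rw [dressOne, (polarised_cur S m).2, expInner_apply, Finset.sum_range_succ,
      Finset.sum_range_one, pow_one, hd]
    ext1 d
    simp only [pow_zero, Module.End.one_apply, Nat.factorial, Nat.cast_one, inv_one, one_smul,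
      map_add, PowerSeries.coeff_mk, PowerSeries.coeff_monomial, mulBase, mul_one]
    rcases d with _ | _ | d
    · simp [current]
    · refine LinearMap.ext fun v => ?_
      simp [current, add_mul, add_assoc]
    · simp [current]

/-- The action of the conjugate of a product of two currents on the vacuum. -/
theorem coeff_dress_cur_mul (A B : Mode r) (d : ℕ) :
    PowerSeries.coeff d (dress (opT S) (opPhi S) Z.negLog (cur A * cur B)) 1 =
      ∑ e ∈ Finset.HasAntidiagonal.antidiagonal d, Z.current S A e.1 * Z.current S B e.2 +
        if 1 ≤ d then dOp S A (Z.current S B (d - 1)) else 0 := by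
  have h : ∀ (m : Mode r) (e : ℕ) (v : Fock p q r),
      PowerSeries.coeff e (dressOne (opT S) (opPhi S) Z.negLog (cur m)) v =
        Z.current S m e * v + if e = 1 then dOp S m v else 0 := fun m e v => by
    rw [(Z.dressOne_cur S m).2, map_add, PowerSeries.coeff_mk, PowerSeries.coeff_monomial, add_comm]
    split_ifs <;> simp
  rw [dress_mul (Z.dressOne_cur S A).1 (Z.dressOne_cur S B).1, PowerSeries.coeff_mul,
    LinearMap.sum_apply]
  -- On `1` the right factor reduces to its multiplication part. The left factor then multiplies
  -- this, and in degree 1 also differentiates it.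
  have h1 : ∀ e : ℕ × ℕ, ((PowerSeries.coeff e.1 (dressOne (opT S) (opPhi S) Z.negLog (cur A))) *
      (PowerSeries.coeff e.2 (dressOne (opT S) (opPhi S) Z.negLog (cur B)))) 1 =
      Z.current S A e.1 * Z.current S B e.2 +
        if e.1 = 1 then dOp S A (Z.current S B e.2) else 0 := fun e => by
    rw [Module.End.mul_apply, h B, h A, dOp_one, ite_self, add_zero, mul_one]
  simp only [h1, Finset.sum_add_distrib]
  congr 1
  split_ifs with hd
  · rw [Finset.sum_eq_single (1, d - 1)]
    · simp
    · rintro ⟨a, b⟩ he hne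
      rw [if_neg]
      rintro rfl
      have := Finset.HasAntidiagonal.mem_antidiagonal.mp he
      exact hne (by ext <;> simp at this ⊢; omega)
    · intro hn
      exact absurd (Finset.HasAntidiagonal.mem_antidiagonal.mpr (by simp; omega)) hn
  · refine Finset.sum_eq_zero fun e he => if_neg ?_
    have := Finset.HasAntidiagonal.mem_antidiagonal.mp he
    omega

end FreeEnergies

end PartitionFunction


/-! ### Normal ordering and the super Virasoro constraints -/

section Constraints

variable {p q r : ℕ} (S : CurveData p q r) (Z : FreeEnergies p q r)

/-- The vacuum expectation value of a product of two modes `J`. -/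
def vevJ (k l : ℤ) : ℂ := if k + l = 0 ∧ 0 < k then (k : ℂ) else 0

/-- The vacuum expectation value of a product of two modes `Γ`. -/
def vevG (k l : ℤ) : ℂ :=
  if k + l = 0 then (if 0 < k then (1 : ℂ) else if k = 0 then 1 / 2 else 0) else 0

/-- The commutator equals the difference of the two vacuum expectation values. -/
theorem normJJ_symm (a : Fin r) (k l : ℤ) :
    (normJJ a k l : Module.End ℂ (Fock p q r)) = normJJ a l k := by
  have h : (if a = a ∧ k + l = 0 then (k : ℂ) else 0) + vevJ l k = vevJ k l := by
    unfold vevJ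
    by_cases hkl : k + l = 0
    · obtain rfl : l = -k := by omega
      rcases lt_trichotomy k 0 with hk | rfl | hk
      · simp [hk, hk.not_gt]
      · simp
      · simp [hk, hk.not_gt]
    · simp [hkl, add_comm l k]
  change _ - vevJ k l • 1 = _ - vevJ l k • 1
  rw [modeJ_comm, ← h, add_smul]
  abel

/-- The anticommutator equals the sum of the two vacuum expectation values; for the zero mode this
is `1 = ½ + ½`. -/
theorem normGG_antisymm (a : Fin r) (k l : ℤ) :
    (normGG a k l : Module.End ℂ (Fock p q r)) = -normGG a l k := by
  have h : (if a = a ∧ k + l = 0 then (1 : ℂ) else 0) = vevG k l + vevG l k := by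
    unfold vevG
    by_cases hkl : k + l = 0
    · obtain rfl : l = -k := by omega
      rcases lt_trichotomy k 0 with hk | rfl | hk
      · simp [hk, hk.not_gt, hk.ne]
      · norm_num
      · simp [hk, hk.not_gt, hk.ne']
    · simp [hkl, add_comm l k]
  change _ - vevG k l • 1 = -(_ - vevG l k • 1)
  rw [modeG_anticomm, h, add_smul]
  abel

/-- The two indices have constant sum, so for large `|j|` one of them is large while the other is
nonpositive. -/
theorem hasOpSum_pairs {f : ℤ → ℤ → Module.End ℂ (Fock p q r)} (c : ℤ → ℂ) (N : ℤ)
    (h : ∀ v, ∃ B : ℤ, ∀ k l, B < l → k ≤ 0 → f k l v = 0)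
    (h' : ∀ v, ∃ B : ℤ, ∀ k l, B < k → l ≤ 0 → f k l v = 0) :
    HasOpSum (fun j : ℤ => c j • f (-j) (N + j)) (opSum fun j : ℤ => c j • f (-j) (N + j)) := by
  refine hasOpSum_opSum fun v => ?_
  obtain ⟨B, hB⟩ := h v
  obtain ⟨B', hB'⟩ := h' v
  refine (Set.finite_Icc (min (-B') (-N)) (max 0 (B - N))).subset fun j hj => ?_
  by_contra hn
  refine hj ?_
  change c j • f (-j) (N + j) v = 0
  rw [Set.mem_Icc, not_and_or] at hn
  rcases hn with hn | hn
  · rw [hB' _ _ (by omega) (by omega), smul_zero]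
  · rw [hB _ _ (by omega) (by omega), smul_zero]

theorem normJJ_bdd (a : Fin r) (v : Fock p q r) :
    ∃ B : ℤ, ∀ k l, B < l → k ≤ 0 → normJJ a k l v = 0 := by
  obtain ⟨B, hB⟩ := modes_bdd v
  refine ⟨B, fun k l hl hk => ?_⟩
  simp [normJJ, (hB a l hl).1, hk.not_gt]

theorem normGG_bdd (a : Fin r) (v : Fock p q r) :
    ∃ B : ℤ, ∀ k l, B < l → k ≤ 0 → normGG a k l v = 0 := by
  obtain ⟨B, hB⟩ := modes_bdd v
  refine ⟨B, fun k l hl hk => ?_⟩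
  change modeG a k (modeG a l v) - vevG k l • v = 0
  rw [(hB a l hl).2, vevG, if_neg hk.not_gt]
  split_ifs <;> first | omega | simp

theorem modeJ_modeG_bdd (a : Fin r) (v : Fock p q r) :
    ∃ B : ℤ, ∀ k l : ℤ, 
      (B < l → (modeJ a k * modeG a l : Module.End ℂ (Fock p q r)) v = 0) ∧
      (B < k → (modeJ a k * modeG a l : Module.End ℂ (Fock p q r)) v = 0) := by
  obtain ⟨B, hB⟩ := modes_bdd v
  refine ⟨B, fun k l => ⟨fun h => by simp [(hB a l h).2], fun h => ?_⟩⟩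
  rw [modeJ_modeG]
  simp [(hB a k h).1]

theorem hasOpSum_normJJ (a : Fin r) (c : ℤ → ℂ) (N : ℤ) :
    HasOpSum (fun j : ℤ => (c j • normJJ a (-j) (N + j) : Module.End ℂ (Fock p q r)))
      (opSum fun j : ℤ => c j • normJJ a (-j) (N + j)) :=
  hasOpSum_pairs c N (normJJ_bdd a) fun v => by
    obtain ⟨B, hB⟩ := normJJ_bdd a v
    exact ⟨B, fun k l hk hl => by rw [normJJ_symm, hB l k hk hl]⟩

theorem hasOpSum_normGG (a : Fin r) (c : ℤ → ℂ) (N : ℤ) :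
    HasOpSum (fun j : ℤ => (c j • normGG a (-j) (N + j) : Module.End ℂ (Fock p q r)))
      (opSum fun j : ℤ => c j • normGG a (-j) (N + j)) :=
  hasOpSum_pairs c N (normGG_bdd a) fun v => by
    obtain ⟨B, hB⟩ := normGG_bdd a v
    exact ⟨B, fun k l hk hl => by rw [normGG_antisymm, LinearMap.neg_apply, hB l k hk hl, neg_zero]⟩

theorem hasOpSum_JG (a : Fin r) (c : ℤ → ℂ) (N : ℤ) :
    HasOpSum (fun j : ℤ => (c j • (modeJ a (-j) * modeG a (N + j)) : Module.End ℂ (Fock p q r)))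
      (opSum fun j : ℤ => c j • (modeJ a (-j) * modeG a (N + j))) :=
  hasOpSum_pairs (f := fun k l => modeJ a k * modeG a l) c N
    (fun v => let ⟨B, hB⟩ := modeJ_modeG_bdd a v; ⟨B, fun k l h _ => (hB k l).1 h⟩)
    (fun v => let ⟨B, hB⟩ := modeJ_modeG_bdd a v; ⟨B, fun k l h _ => (hB k l).2 h⟩)

/-- The substitution `j ↦ -j - 2n` exchanges the two modes and preserves `(-1)^j`, so antisymmetry
makes the sum equal to its negative. The shift by `n` in the weight `j + n` of `L` can thus be
dropped, which leaves the weight of the Casimir operator. -/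
theorem opSum_normGG_eq_zero (a : Fin r) (n : ℤ) :
    opSum (fun j : ℤ => ((-1 : ℂ) ^ j • normGG a (-j) (2 * n + j) :
      Module.End ℂ (Fock p q r))) = 0 := by
  have h := hasOpSum_normGG (p := p) (q := q) a (fun j => (-1 : ℂ) ^ j) (2 * n)
  refine LinearMap.ext fun v => ?_
  set e : ℤ ≃ ℤ := (Equiv.neg ℤ).trans (Equiv.addRight (-(2 * n)))
  have h1 := (h v).2
  rw [← finsum_comp_equiv e] at h1
  have h2 : ∀ j : ℤ, ((-1 : ℂ) ^ e j • normGG a (-e j) (2 * n + e j) :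
      Module.End ℂ (Fock p q r)) v = -((-1 : ℂ) ^ j • normGG a (-j) (2 * n + j) :
      Module.End ℂ (Fock p q r)) v := fun j => by
    have e1 : e j = -j + -(2 * n) := rfl
    have e2 : -e j = 2 * n + j := by rw [e1]; ring
    have e3 : 2 * n + e j = -j := by rw [e1]; ring
    have e4 : (-1 : ℂ) ^ e j = (-1) ^ j := by
      rw [e1, zpow_add₀ (by norm_num), zpow_neg, zpow_neg, (even_two_mul n).neg_one_zpow,
        inv_one, mul_one, ← inv_zpow]
      norm_num
    rw [e2, e3, e4, normGG_antisymm, smul_neg]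
    rfl
  simp only [h2] at h1
  rw [finsum_neg_distrib, ← (h v).2] at h1
  rw [LinearMap.zero_apply]
  have h3 := eq_neg_iff_add_eq_zero.mp h1
  rw [← two_smul ℂ] at h3
  exact (smul_eq_zero.mp h3).resolve_left two_ne_zero

theorem opL_eq (a : Fin r) (n : ℤ) : (opL a n : Module.End ℂ (Fock p q r)) =
    (1 / 2 : ℂ) • opSum (fun j : ℤ => (-1 : ℂ) ^ (j - 1) • normJJ a (-j) (2 * n + j)) +
    (1 / 2 : ℂ) • opSum (fun j : ℤ => ((-1 : ℂ) ^ j * (j : ℂ)) • normGG a (-j) (2 * n + j)) +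
    (if n = 0 then (1 / 4 : ℂ) else 0) • 1 := by
  have h := (hasOpSum_normGG (p := p) (q := q) a (fun j => (-1 : ℂ) ^ j * (j : ℂ)) (2 * n)).add
    ((hasOpSum_normGG (p := p) (q := q) a (fun j => (-1 : ℂ) ^ j) (2 * n)).smul (n : ℂ))
  rw [opSum_normGG_eq_zero, smul_zero, add_zero] at h
  rw [opL, (h.congr (g := fun j : ℤ => ((-1 : ℂ) ^ j * ((j : ℂ) + n)) • normGG a (-j) (2 * n + j))
    fun j => by rw [smul_smul, ← add_smul]; congr 1; ring).opSum_eq]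

namespace FreeEnergies

/-- The coefficients of the action of the conjugate of a product of two currents on the vacuum. -/
def quad (A B : Mode r) (d : ℕ) : Fock p q r :=
  ∑ e ∈ Finset.HasAntidiagonal.antidiagonal d, Z.current S A e.1 * Z.current S B e.2 +
    if 1 ≤ d then dOp S A (Z.current S B (d - 1)) else 0

/-- The same for the normal ordered product. -/
def normQuad (A B : Mode r) (d : ℕ) : Fock p q r :=
  Z.quad S A B d - if d = 2 then baseIncl p q r (ramondB B A) else 0

theorem dress_normal {A B : Mode r} {c : ℂ} (hc : algebraMap ℂ (BaseRing p q) c = ramondB B A) :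
    DressFinite (opT S) (opPhi S) Z.negLog (cur A * cur B - c • 1) ∧
    ∀ d, PowerSeries.coeff d (dress (opT S) (opPhi S) Z.negLog (cur A * cur B - c • 1)) 1 =
      Z.normQuad S A B d := by
  rw [sub_eq_add_neg, ← neg_smul]
  refine ⟨(DressFinite.mul (Z.dressOne_cur S A).1 (Z.dressOne_cur S B).1).add
    (DressFinite.one.smul _), fun d => ?_⟩
  rw [dress_add, dress_smul, dress_one, map_add, LinearMap.add_apply, coeff_dress_cur_mul,
    normQuad, ← hc, AlgHom.commutes, Algebra.algebraMap_eq_smul_one, sub_eq_add_neg]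
  congr 1
  change (-c) • (PowerSeries.coeff d (PowerSeries.X ^ 2 :
    PowerSeries (Module.End ℂ (Fock p q r)))) 1 = _
  rw [PowerSeries.coeff_X_pow]
  split_ifs <;> simp

/-- Normal ordering subtracts precisely the expanded standard bidifferential. Its arguments are
reversed: an expectation value requires the left mode to annihilate, so the left differential has
the pole. -/
theorem vevJ_eq (a : Fin r) (j N : ℤ) : algebraMap ℂ (BaseRing p q) (vevJ (-j) (-N + j)) =
    ramondB (Sum.inl (a, N - j) : Mode r) (Sum.inl (a, j)) := by
  simp only [vevJ, ramondB]
  by_cases h : N = 0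
  · subst h
    by_cases h' : j < 0
    · rw [if_pos (by omega), if_pos (by simp [h'])]
      simp
    · rw [if_neg (by omega), if_neg (by simp [h']), map_zero]
  · rw [if_neg (by omega), if_neg (by omega), map_zero]

theorem vevG_eq (a : Fin r) (j N : ℤ) : algebraMap ℂ (BaseRing p q) (vevG (-j) (-N + j)) =
    ramondB (Sum.inr (a, N - j) : Mode r) (Sum.inr (a, j)) := by
  simp only [vevG, ramondB]
  by_cases h : N = 0
  · subst h
    rcases lt_trichotomy j 0 with h' | rfl | h'
    · rw [if_pos (by omega), if_pos (by omega), if_pos (by simp), if_pos (by omega), map_one]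
    · simp
    · rw [if_pos (by omega), if_neg (by omega), if_neg (by omega), if_pos (by simp),
        if_neg (by omega), if_neg (by omega), map_zero]
  · rw [if_neg (by omega), if_neg (by omega), map_zero]

variable {S Z}

/-- Conjugation is compatible with pointwise finite sums, so the sum can be evaluated term by term
on the vacuum. -/
theorem normQuad_finsum {A B : ℤ → Mode r} {vev : ℤ → ℂ} {w : ℤ → ℂ}
    (hv : ∀ j, algebraMap ℂ (BaseRing p q) (vev j) = ramondB (B j) (A j))
    {Q : Module.End ℂ (Fock p q r)}
    (h : HasOpSum (fun j => w j • (cur (A j) * cur (B j) - vev j • 1)) Q) :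
    DressFinite (opT S) (opPhi S) Z.negLog Q ∧ ∀ d,
      (Function.support fun j => w j • Z.normQuad S (A j) (B j) d).Finite ∧
      PowerSeries.coeff d (dress (opT S) (opPhi S) Z.negLog Q) 1 =
        ∑ᶠ j, w j • Z.normQuad S (A j) (B j) d := by
  refine ⟨DressFinite.hasOpSum (fun j => (Z.dress_normal S (hv j)).1.smul _) h, fun d => ?_⟩
  have h1 := (HasPSum.dress (opT S) (opPhi S) Z.negLog h) d 1
  have e : ∀ j, (PowerSeries.coeff d (dress (opT S) (opPhi S) Z.negLog
      (w j • (cur (A j) * cur (B j) - vev j • 1)))) 1 = w j • Z.normQuad S (A j) (B j) d :=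
    fun j => by
      rw [dress_smul, ← (Z.dress_normal S (hv j)).2 d]
      rfl
  simpa only [e] using h1

theorem normQuad_JJ (Z : FreeEnergies p q r) (S : CurveData p q r) (a : Fin r) (N : ℤ)
    (w : ℤ → ℂ) :
    DressFinite (opT S) (opPhi S) Z.negLog (opSum fun j => w j • normJJ a (-j) (-N + j)) ∧ ∀ d,
      (Function.support fun j =>
        w j • Z.normQuad S (Sum.inl (a, j)) (Sum.inl (a, N - j)) d).Finite ∧
      PowerSeries.coeff d (dress (opT S) (opPhi S) Z.negLog
        (opSum fun j => w j • normJJ a (-j) (-N + j))) 1 =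
        ∑ᶠ j, w j • Z.normQuad S (Sum.inl (a, j)) (Sum.inl (a, N - j)) d := by
  refine normQuad_finsum (vevJ_eq a · N) ((hasOpSum_normJJ a w (-N)).congr fun j => ?_)
  simp only [cur, Sum.elim_inl]
  rw [show -(N - j) = -N + j by ring]
  rfl

theorem normQuad_GG (Z : FreeEnergies p q r) (S : CurveData p q r) (a : Fin r) (N : ℤ)
    (w : ℤ → ℂ) :
    DressFinite (opT S) (opPhi S) Z.negLog (opSum fun j => w j • normGG a (-j) (-N + j)) ∧ ∀ d,
      (Function.support fun j =>
        w j • Z.normQuad S (Sum.inr (a, j)) (Sum.inr (a, N - j)) d).Finite ∧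
      PowerSeries.coeff d (dress (opT S) (opPhi S) Z.negLog
        (opSum fun j => w j • normGG a (-j) (-N + j))) 1 =
        ∑ᶠ j, w j • Z.normQuad S (Sum.inr (a, j)) (Sum.inr (a, N - j)) d := by
  refine normQuad_finsum (vevG_eq a · N) ((hasOpSum_normGG a w (-N)).congr fun j => ?_)
  simp only [cur, Sum.elim_inr]
  rw [show -(N - j) = -N + j by ring]
  rfl

theorem normQuad_JG (Z : FreeEnergies p q r) (S : CurveData p q r) (a : Fin r) (N : ℤ)
    (w : ℤ → ℂ) :
    DressFinite (opT S) (opPhi S) Z.negLog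
      (opSum fun j => w j • (modeJ a (-j) * modeG a (-N + j))) ∧ ∀ d,
      (Function.support fun j =>
        w j • Z.normQuad S (Sum.inl (a, j)) (Sum.inr (a, N - j)) d).Finite ∧
      PowerSeries.coeff d (dress (opT S) (opPhi S) Z.negLog
        (opSum fun j => w j • (modeJ a (-j) * modeG a (-N + j)))) 1 =
        ∑ᶠ j, w j • Z.normQuad S (Sum.inl (a, j)) (Sum.inr (a, N - j)) d := by
  refine normQuad_finsum (vev := fun _ => 0) (fun j => by simp [ramondB])
    ((hasOpSum_JG a w (-N)).congr fun j => ?_)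
  simp only [cur, Sum.elim_inr, Sum.elim_inl]
  rw [show -(N - j) = -N + j by ring, zero_smul, sub_zero]

theorem coeff_dress_eq_zero {Q : Module.End ℂ (Fock p q r)}
    (hQ : DressFinite (opT S) (opPhi S) Z.negLog Q)
    (h : Z.IsAnnihilatedBy (S.conj (HahnSeries.single 2 Q))) (d : ℕ) :
    PowerSeries.coeff d (dress (opT S) (opPhi S) Z.negLog Q) 1 = 0 :=
  coeff_conj_apply S Z (logT_eq S) (logPhi_eq S) Z.neg_logZ hQ h d

/-- The super Virasoro constraints, even part. -/
theorem finsum_normQuad_even {a : Fin r} {n : ℤ}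
    (h : Z.IsAnnihilatedBy (S.conj (HahnSeries.single 2 (opL a n)))) (d : ℕ) :
    ∑ᶠ j : ℤ, (-1 : ℂ) ^ j • Z.normQuad S (Sum.inl (a, j)) (Sum.inl (a, -(2 * n) - j)) d -
      ∑ᶠ j : ℤ, ((-1 : ℂ) ^ j * (j : ℂ)) •
        Z.normQuad S (Sum.inr (a, j)) (Sum.inr (a, -(2 * n) - j)) d =
      if n = 0 ∧ d = 2 then (1 / 2 : ℂ) • 1 else 0 := by
  have h1 := normQuad_JJ Z S a (-(2 * n)) (fun j => (-1 : ℂ) ^ (j - 1))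
  have h2 := normQuad_GG Z S a (-(2 * n)) (fun j => (-1 : ℂ) ^ j * (j : ℂ))
  simp only [neg_neg] at h1 h2
  have h3 := coeff_dress_eq_zero (Q := opL a n) (by
    rw [opL_eq]
    exact ((h1.1.smul _).add (h2.1.smul _)).add (DressFinite.one.smul _)) h d
  rw [opL_eq, dress_add, dress_add, dress_smul, dress_smul, dress_smul, dress_one, map_add,
    map_add, LinearMap.add_apply, LinearMap.add_apply] at h3
  have hs : ∀ (c : ℂ) (F : PowerSeries (Module.End ℂ (Fock p q r))),
      (PowerSeries.coeff d (c • F)) 1 = c • (PowerSeries.coeff d F) 1 := fun _ _ => rfl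
  rw [hs, hs, hs, (h1.2 d).2, (h2.2 d).2, PowerSeries.coeff_X_pow] at h3
  have e : ∀ j : ℤ, (-1 : ℂ) ^ (j - 1) = -1 * (-1) ^ j := fun j => by
    rw [zpow_sub_one₀ (by norm_num)]; norm_num
  simp only [e, mul_smul] at h3 ⊢
  rw [← smul_finsum] at h3
  have h5 : (2 : ℂ) • ((if n = 0 then (1 / 4 : ℂ) else 0) •
      (if d = 2 then (1 : Module.End ℂ (Fock p q r)) else 0) 1) =
      (if n = 0 ∧ d = 2 then (1 / 2 : ℂ) • (1 : Fock p q r) else 0) := by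
    by_cases hn : n = 0 <;> by_cases hd : d = 2 <;> simp [hn, hd, smul_smul]
    norm_num
  rw [← h5]
  -- The factor `-2` removes the `½` and the sign in `(-1)^{j-1}`; it turns the constant `¼` into
  -- `½` on the right side.
  linear_combination (norm := module) (-2 : ℂ) • h3

/-- The super Virasoro constraints, odd part. -/
theorem finsum_normQuad_odd {a : Fin r} {n : ℤ}
    (h : Z.IsAnnihilatedBy (S.conj (HahnSeries.single 2 (opG a n)))) (d : ℕ) :
    ∑ᶠ j : ℤ, (-1 : ℂ) ^ j •
      Z.normQuad S (Sum.inl (a, j)) (Sum.inr (a, -(2 * n + 1) - j)) d = 0 := by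
  have h1 := normQuad_JG Z S a (-(2 * n + 1)) (fun j => (-1 : ℂ) ^ (j - 1))
  simp only [neg_neg] at h1
  have h3 := coeff_dress_eq_zero (Q := opG a n) h1.1 h d
  rw [opG, (h1.2 d).2] at h3
  have e : ∀ j : ℤ, (-1 : ℂ) ^ (j - 1) = -1 * (-1) ^ j := fun j => by
    rw [zpow_sub_one₀ (by norm_num)]; norm_num
  simp only [e, mul_smul] at h3
  rw [← smul_finsum] at h3
  simpa using h3

/-- The constraints from the modes themselves. -/
theorem dOp_freeEnergy_eq_zero {m : Mode r} (hm : cur m = (dOp S m : Module.End ℂ (Fock p q r)))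
    (h : Z.IsAnnihilatedBy (HahnSeries.single 1 (cur m))) (χ : ℕ) :
    dOp S m (Z.freeEnergy χ) = 0 := by
  have hd : innerDer Z.negLog (PowerSeries.monomial 1 (dOp S m)) =
      PowerSeries.mk fun d => LinearMap.mulLeft ℂ
        (if 1 ≤ d then dOp S m (Z.freeEnergy (d - 1)) else 0) := by
    ext1 d
    rw [innerDer_negLog_monomial, innerDer_dOp, PowerSeries.coeff_mk]
    split_ifs <;> simp
  have h1 := h ((χ + 1 : ℕ) : ℤ)
  rw [neg_logZ, hm, show (1 : ℤ) = ((1 : ℕ) : ℤ) from rfl, ← toHOp_monomial,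
    conjExp_toHOp (N := 2) (by rw [pow_two, Module.End.mul_apply, hd, innerDer_negLog_mk]),
    expInner_apply, Finset.sum_range_succ, Finset.sum_range_one, pow_one, hd] at h1
  rw [toHOp, HahnSeries.ofPowerSeries_apply_coeff] at h1
  -- The operator part itself, in degree 1, kills the vacuum; only `∂_m F_χ` is left.
  have h2 : ((if χ = 0 then dOp S m else 0 : Module.End ℂ (Fock p q r))) 1 = 0 := by
    split_ifs <;> simp
  simpa [PowerSeries.coeff_monomial, h2] using h1

end FreeEnergies

end Constraints


/-! ### Setting the variables to zero -/

section Vacuum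

variable {p q r : ℕ}

/-- The projection of the polynomial algebra to the base ring, setting all variables to zero. -/
def vacuum (p q r : ℕ) : Fock p q r →ₐ[ℂ] BaseRing p q :=
  Algebra.TensorProduct.map (MvPolynomial.aeval (Sum.elim MvPolynomial.X 0))
    (ExteriorAlgebra.map (Finsupp.lcomapDomain Sum.inl Sum.inl_injective))

theorem vacuum_baseIncl (c : BaseRing p q) : vacuum p q r (baseIncl p q r c) = c := by
  induction c using SuperPoly.induction with
  | one => simp
  | add f g hf hg => simp [hf, hg]
  | smul c f hf => simp [hf]
  | even i f hf =>
    rw [map_mul, map_mul, hf, baseIncl_evenVar]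
    simp [vacuum, evenVar]
  | odd o f hf =>
    rw [map_mul, map_mul, hf, baseIncl_oddVar]
    congr 1
    simp only [vacuum, oddVar, Algebra.TensorProduct.map_tmul, map_one, ExteriorAlgebra.map_apply_ι]
    congr 2
    ext i
    simp [Finsupp.single_apply]

theorem vacuum_coordVar (i : Coord r) : vacuum p q r (coordVar i) = 0 := by
  rcases i with i | i
  · simp [vacuum, coordVar, evenVar]
  · simp only [vacuum, coordVar, oddVar, Sum.elim_inr, Algebra.TensorProduct.map_tmul, map_one,
      ExteriorAlgebra.map_apply_ι]
    have : Finsupp.lcomapDomain (R := ℂ) (M := ℂ) (Sum.inl : Fin q → Fin q ⊕ Fin r × ℕ)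
        Sum.inl_injective (Finsupp.single (Sum.inr i) 1) = 0 := by
      ext j
      simp
    rw [this, map_zero, TensorProduct.tmul_zero]

end Vacuum

/-! ### Polynomials with supersymmetric coefficients -/

section Symmetric

variable {p q r : ℕ} {ι : Type} (v : ι → Coord r)

/-- The symmetry of the coefficients of a polynomial. -/
def IsSupersymm {n : ℕ} (G : (Fin n → ι) → BaseRing p q) : Prop :=
  ∀ (i : Fin n → ι) (k : ℕ) (hk : k + 1 < n),
    G (i ∘ Equiv.swap ⟨k, by omega⟩ ⟨k + 1, hk⟩) =
      (-1 : ℂ) ^ (par (v (i ⟨k, by omega⟩)) * par (v (i ⟨k + 1, hk⟩))) • G i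

variable {v}

theorem cons_comp_swap {n : ℕ} (j : ι) (i : Fin n → ι) (k : ℕ) (hk : k + 1 < n) :
    Fin.cons (α := fun _ => ι) j (i ∘ Equiv.swap ⟨k, by omega⟩ ⟨k + 1, hk⟩) =
      Fin.cons (α := fun _ => ι) j i ∘
        Equiv.swap (⟨k + 1, by omega⟩ : Fin (n + 1)) ⟨k + 1 + 1, by omega⟩ := by
  funext x
  have e1 : (⟨k + 1, by omega⟩ : Fin (n + 1)) = Fin.succ ⟨k, by omega⟩ := rfl
  have e2 : (⟨k + 1 + 1, by omega⟩ : Fin (n + 1)) = Fin.succ ⟨k + 1, hk⟩ := rfl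
  rw [e1, e2]
  refine Fin.cases ?_ (fun x => ?_) x
  · rw [Function.comp_apply, Equiv.swap_apply_of_ne_of_ne (Fin.succ_ne_zero _).symm
      (Fin.succ_ne_zero _).symm]
    rfl
  · rw [Fin.cons_succ, Function.comp_apply, Function.comp_apply,
      (Fin.succ_injective n).swap_apply, Fin.cons_succ]

theorem IsSupersymm.cons {n : ℕ} {G : (Fin (n + 1) → ι) → BaseRing p q} (hG : IsSupersymm v G)
    (j : ι) : IsSupersymm v fun i : Fin n → ι => G (Fin.cons j i) := by
  intro i k hk
  refine (congrArg G (cons_comp_swap j i k hk)).trans ?_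
  exact hG (Fin.cons j i) (k + 1) (by omega)

theorem IsSupersymm.cons_cons {n : ℕ} {G : (Fin (n + 2) → ι) → BaseRing p q}
    (hG : IsSupersymm v G) (j k : ι) (i : Fin n → ι) :
    G (Fin.cons j (Fin.cons k i)) =
      (-1 : ℂ) ^ (par (v j) * par (v k)) • G (Fin.cons k (Fin.cons j i)) := by
  have h := hG (Fin.cons k (Fin.cons j i)) 0 (by omega)
  rw [mul_comm]
  refine Eq.trans (congrArg G ?_) h
  funext x
  refine Fin.cases ?_ (fun x => Fin.cases ?_ (fun x => ?_) x) x
  · exact (congrArg (Fin.cons k (Fin.cons j i) : Fin (n + 2) → ι)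
      (Equiv.swap_apply_left (0 : Fin (n + 2)) 1)).symm
  · exact (congrArg (Fin.cons k (Fin.cons j i) : Fin (n + 2) → ι)
      (Equiv.swap_apply_right (0 : Fin (n + 2)) 1)).symm
  · rw [Function.comp_apply, Equiv.swap_apply_of_ne_of_ne]
    · rfl
    · exact fun h => by simpa using congrArg Fin.val h
    · exact fun h => by simpa using congrArg Fin.val h

variable [Fintype ι]

/-- The polynomial with given coefficients, without the factorial. -/
def symPoly (v : ι → Coord r) {n : ℕ} (G : (Fin n → ι) → BaseRing p q) : Fock p q r :=
  ∑ i : Fin n → ι, (List.ofFn fun k => coordVar (v (i k))).prod * baseIncl p q r (G i)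

theorem sum_cons {M : Type*} [AddCommMonoid M] {n : ℕ} (f : (Fin (n + 1) → ι) → M) :
    ∑ i, f i = ∑ j, ∑ i : Fin n → ι, f (Fin.cons j i) := by
  rw [← (Fin.consEquiv fun _ => ι).sum_comp, Fintype.sum_prod_type]
  rfl

theorem symPoly_succ {n : ℕ} (G : (Fin (n + 1) → ι) → BaseRing p q) :
    symPoly v G = ∑ j, coordVar (v j) * symPoly v fun i => G (Fin.cons j i) := by
  rw [symPoly, sum_cons]
  refine Finset.sum_congr rfl fun j _ => ?_
  rw [symPoly, Finset.mul_sum]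
  refine Finset.sum_congr rfl fun i _ => ?_
  simp [List.ofFn_succ, mul_assoc]

theorem symPoly_zero (G : (Fin 0 → ι) → BaseRing p q) :
    symPoly v G = baseIncl p q r (G Fin.elim0) := by
  rw [symPoly, Fintype.sum_unique, List.ofFn_zero, List.prod_nil, one_mul]
  congr 2

theorem symPoly_smul {n : ℕ} (c : ℂ) (G : (Fin n → ι) → BaseRing p q) :
    symPoly v (fun i => c • G i) = c • symPoly v G := by
  simp [symPoly, Finset.smul_sum]

theorem vacuum_symPoly_succ {n : ℕ} (G : (Fin (n + 1) → ι) → BaseRing p q) :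
    vacuum p q r (symPoly v G) = 0 := by
  rw [symPoly_succ, map_sum]
  exact Finset.sum_eq_zero fun j _ => by rw [map_mul, vacuum_coordVar, zero_mul]

open Classical in
-- By supersymmetry each of the `n + 1` slots contributes the same, as the matching index can be
-- brought to the front.
theorem coordDeriv_symPoly (hv : Function.Injective v) {n : ℕ}
    {G : (Fin (n + 1) → ι) → BaseRing p q} (hG : IsSupersymm v G) (j : ι) :
    coordDeriv (v j) (symPoly v G) = ((n : ℂ) + 1) • symPoly v fun i => G (Fin.cons j i) := by
  induction n with
  | zero =>
    rw [symPoly_succ, map_sum, Finset.sum_eq_single j]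
    · simp only [symPoly_zero]
      rw [coordDeriv_mul _ (HasParity.coordVar _), coordDeriv_coordVar, if_pos rfl,
        coordDeriv_baseIncl]
      simp
    · intro i _ hi
      simp only [symPoly_zero]
      rw [coordDeriv_mul _ (HasParity.coordVar _), coordDeriv_coordVar,
        if_neg fun h => hi (hv h).symm, coordDeriv_baseIncl]
      simp
    · simp
  | succ n ih =>
    rw [symPoly_succ, map_sum]
    have h1 : ∀ i, coordDeriv (v j) (coordVar (v i) * symPoly v fun k => G (Fin.cons i k)) =
        (if i = j then symPoly v fun k => G (Fin.cons i k) else 0) +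
          ((n : ℂ) + 1) • (coordVar (v i) *
            symPoly v fun k => G (Fin.cons j (Fin.cons i k))) := fun i => by
      rw [coordDeriv_mul _ (HasParity.coordVar _), coordDeriv_coordVar, ih (hG.cons i)]
      congr 1
      · by_cases h : i = j
        · simp [h]
        · rw [if_neg h, if_neg fun h' => h (hv h').symm, zero_mul]
      -- The sign of the derivative passing the first variable is cancelled by the sign of
      -- exchanging the first two indices.
      · simp only [hG.cons_cons i j, symPoly_smul]
        rw [mul_smul_comm, mul_smul_comm, mul_comm (par (v i)),
          smul_comm ((n : ℂ) + 1) ((-1 : ℂ) ^ (par (v j) * par (v i))), smul_smul,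
          ← pow_add, ← two_mul, pow_mul]
        simp
    simp only [h1, Finset.sum_add_distrib, Finset.sum_ite_eq', Finset.mem_univ, if_true]
    rw [← Finset.smul_sum, ← symPoly_succ fun i => G (Fin.cons j i)]
    push_cast
    module

theorem coordDeriv_symPoly_eq_zero {n : ℕ} {G : (Fin n → ι) → BaseRing p q} {j : Coord r}
    (hj : j ∉ Set.range v) : coordDeriv j (symPoly v G) = 0 := by
  classical
  induction n with
  | zero => rw [symPoly_zero, coordDeriv_baseIncl]
  | succ n ih =>
    rw [symPoly_succ, map_sum]
    refine Finset.sum_eq_zero fun i _ => ?_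
    rw [coordDeriv_mul _ (HasParity.coordVar _), coordDeriv_coordVar,
      if_neg fun h => hj ⟨i, h.symm⟩, ih]
    simp

end Symmetric


theorem finsum_eq_of_injective {α β M : Type*} [AddCommMonoid M] (e : α → β)
    (he : Function.Injective e) {f : β → M} (h : ∀ i ∉ Set.range e, f i = 0) :
    ∑ᶠ i, f i = ∑ᶠ j, f (e j) := by
  classical
  rw [← finsum_mem_range he, finsum_mem_def]
  refine finsum_congr fun i => ?_
  by_cases hi : i ∈ Set.range e
  · rw [Set.indicator_of_mem hi]
  · rw [Set.indicator_of_notMem hi, h i hi]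

/-! ### Stable multidifferentials as iterated derivatives -/

section Stable

variable {p q r : ℕ} (S : CurveData p q r)

/-- Iterated derivations dual to the basis differentials. -/
def dSeq (l : List (Mode r)) : Module.End ℂ (Fock p q r) :=
  (l.map (dOp S)).reverse.prod

@[simp] theorem dSeq_nil : dSeq S ([] : List (Mode r)) = (1 : Module.End ℂ (Fock p q r)) := rfl

theorem dSeq_cons (m : Mode r) (l : List (Mode r)) (f : Fock p q r) :
    dSeq S (m :: l) f = dSeq S l (dOp S m f) := by
  simp [dSeq]

theorem dSeq_baseIncl (c : BaseRing p q) {l : List (Mode r)} (hl : l ≠ []) :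
    dSeq S l (baseIncl p q r c) = 0 := by
  cases l with
  | nil => exact absurd rfl hl
  | cons m l => rw [dSeq_cons, dOp_baseIncl, map_zero]

variable {ι : Type} [Fintype ι] (v : ι → Coord r)

theorem baseIncl_mul_symPoly {d n : ℕ} {c : BaseRing p q} (hc : HasParity d c)
    (G : (Fin n → ι) → BaseRing p q) : baseIncl p q r c * symPoly v G =
      symPoly v fun i => (-1 : ℂ) ^ (d * ∑ k, par (v (i k))) • (c * G i) := by
  rw [symPoly, symPoly, Finset.mul_sum]
  refine Finset.sum_congr rfl fun i _ => ?_
  rw [← mul_assoc, hc.baseIncl.mul_comm (FreeEnergies.prod_coordVar_parity fun k => v (i k)),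
    smul_mul_assoc, map_smul, mul_smul_comm, map_mul, mul_assoc]

theorem symPoly_sum {n : ℕ} {κ : Type} (s : Finset κ) (G : κ → (Fin n → ι) → BaseRing p q) :
    symPoly v (fun i => ∑ j ∈ s, G j i) = ∑ j ∈ s, symPoly v (G j) := by
  simp only [symPoly, map_sum, Finset.mul_sum]
  exact Finset.sum_comm

/-- The coefficients of the derivative of a polynomial. -/
def derivCoeff (m : Mode r) {n : ℕ} (G : (Fin (n + 1) → ι) → BaseRing p q)
    (i : Fin n → ι) : BaseRing p q :=
  ∑ j, (-1 : ℂ) ^ ((par (v j) + par m) * ∑ k, par (v (i k))) • (S.dxi (v j) m * G (Fin.cons j i))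

variable {v}

theorem IsSupersymm.derivCoeff {n : ℕ} {G : (Fin (n + 1) → ι) → BaseRing p q}
    (hG : IsSupersymm v G) (m : Mode r) : IsSupersymm v (derivCoeff S v m G) := by
  intro i k hk
  simp only [SuperTR.derivCoeff, Finset.smul_sum]
  refine Finset.sum_congr rfl fun j _ => ?_
  have h := hG.cons j i k hk
  have e := Equiv.sum_comp (Equiv.swap (⟨k, by omega⟩ : Fin n) ⟨k + 1, hk⟩) fun l => par (v (i l))
  simp only [Function.comp_apply]
  rw [e]
  change _ • (_ * (fun i => G (Fin.cons j i)) (i ∘ _)) = _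
  rw [h, mul_smul_comm, smul_comm]

theorem dOp_symPoly (hv : Function.Injective v) {n : ℕ}
    {G : (Fin (n + 1) → ι) → BaseRing p q} (hG : IsSupersymm v G) (m : Mode r) :
    dOp S m (symPoly v G) = ((n : ℂ) + 1) • symPoly v (derivCoeff S v m G) := by
  rw [dOp_apply, finsum_eq_of_injective v hv fun i hi => by
    rw [coordDeriv_symPoly_eq_zero hi, mul_zero], finsum_eq_sum_of_fintype]
  simp only [coordDeriv_symPoly hv hG, mul_smul_comm, baseIncl_mul_symPoly v (dxi_parity S _ m)]
  rw [← Finset.smul_sum, ← symPoly_sum]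
  rfl

variable (v) in
/-- The differential with given coefficients in the polarised basis. -/
def symDiff {n : ℕ} (G : (Fin n → ι) → BaseRing p q) (m : Fin n → Mode r) : BaseRing p q :=
  ∑ i : Fin n → ι,
    (-1 : ℂ) ^ (∑ k : Fin n, ∑ l ∈ Finset.Ioi k, (par (v (i k)) + par (m k)) * par (m l)) •
      ((List.ofFn fun k => S.dxi (v (i k)) (m k)).prod * G i)

theorem prod_dxi_parity {n : ℕ} (i : Fin n → Coord r) (m : Fin n → Mode r) :
    HasParity (∑ k, (par (i k) + par (m k))) (List.ofFn fun k => S.dxi (i k) (m k)).prod := by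
  induction n with
  | zero => simpa using HasParity.one
  | succ n ih =>
    rw [List.ofFn_succ, List.prod_cons, Fin.sum_univ_succ]
    exact (dxi_parity S _ _).mul (ih (fun k => i k.succ) fun k => m k.succ)

/-- The sign from moving all coefficients to the right can be generated one variable at a time, in
the same way as by successive derivations. -/
theorem symDiff_succ {n : ℕ} (G : (Fin (n + 1) → ι) → BaseRing p q) (m : Fin (n + 1) → Mode r) :
    symDiff S v G m = symDiff S v (derivCoeff S v (m 0) G) fun k => m k.succ := by
  rw [symDiff, sum_cons, Finset.sum_comm, symDiff]
  refine Finset.sum_congr rfl fun i _ => ?_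
  rw [derivCoeff, Finset.mul_sum, Finset.smul_sum]
  refine Finset.sum_congr rfl fun j _ => ?_
  rw [List.ofFn_succ, List.prod_cons, Fin.sum_univ_succ, Fin.sum_Ioi_zero]
  simp only [Fin.sum_Ioi_succ, Fin.cons_zero, Fin.cons_succ]
  rw [mul_smul_comm, ← mul_assoc, (dxi_parity S (v j) (m 0)).mul_comm
    (prod_dxi_parity S (fun k => v (i k)) fun k => m k.succ), smul_mul_assoc, smul_smul, smul_smul,
    ← pow_add, ← pow_add, ← Finset.mul_sum]
  congr 1
  refine neg_one_pow_congr ?_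
  rw [Finset.sum_add_distrib]
  generalize ∑ k, par (v (i k)) = x, ∑ k : Fin n, par (m k.succ) = y, par (v j) = z, par (m 0) = w
  push_cast
  generalize (x : ZMod 2) = x, (y : ZMod 2) = y, (z : ZMod 2) = z, (w : ZMod 2) = w
  have h2 : (2 : ZMod 2) = 0 := rfl
  linear_combination (z * y + w * y) * h2

/-- Successive derivatives bring down the factors `n, n - 1, …, 1`, whose product cancels the `1/n!`
in the free energy. -/
theorem vacuum_dSeq_symPoly (hv : Function.Injective v) {n : ℕ}
    {G : (Fin n → ι) → BaseRing p q} (hG : IsSupersymm v G)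
    (m : Fin n → Mode r) :
    vacuum p q r (dSeq S (List.ofFn m) (symPoly v G)) = (n.factorial : ℂ) • symDiff S v G m := by
  induction n with
  | zero =>
    rw [List.ofFn_zero, dSeq_nil, Module.End.one_apply, symPoly_zero, vacuum_baseIncl, symDiff,
      Fintype.sum_unique]
    simp
    congr 1
  | succ n ih =>
    rw [List.ofFn_succ, dSeq_cons, dOp_symPoly S hv hG, map_smul, map_smul,
      ih (hG.derivCoeff S (m 0)), symDiff_succ, smul_smul, Nat.factorial_succ]
    push_cast
    rfl

/-- With too few derivatives a variable remains and is set to zero; with too many a constant is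
differentiated. -/
theorem vacuum_dSeq_symPoly_eq_zero (hv : Function.Injective v) {n : ℕ}
    {G : (Fin n → ι) → BaseRing p q} (hG : IsSupersymm v G) {l : List (Mode r)}
    (hl : l.length ≠ n) : vacuum p q r (dSeq S l (symPoly v G)) = 0 := by
  induction n generalizing l with
  | zero =>
    rw [symPoly_zero, dSeq_baseIncl S _ (by rintro rfl; exact hl rfl), map_zero]
  | succ n ih =>
    cases l with
    | nil => exact vacuum_symPoly_succ G
    | cons m l =>
      rw [dSeq_cons, dOp_symPoly S hv hG, map_smul, map_smul,
        ih (hG.derivCoeff S m) (by simpa using hl), smul_zero]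

end Stable

/-! ### The free energies: restriction to the finitely many indices that occur -/

namespace FreeEnergies

variable {p q r : ℕ} (S : CurveData p q r) (Z : FreeEnergies p q r)

open Classical in
/-- The indices which occur in a coefficient. -/
def indices (g n : ℕ) : Finset (Coord r) :=
  (Z.finite g n).toFinset.biUnion fun i => Finset.univ.image i

theorem F_eq_zero {g n : ℕ} {i : Fin n → Coord r}
    (hi : i ∉ Set.range fun j : Fin n → Z.indices g n => fun k => (j k : Coord r)) :
    Z.F g n i = 0 := by
  classical
  by_contra h
  refine hi ⟨fun k => ⟨i k, ?_⟩, rfl⟩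
  rw [indices, Finset.mem_biUnion]
  exact ⟨i, by simpa using h, Finset.mem_image_of_mem _ (Finset.mem_univ k)⟩

theorem restrict_injective {α : Type} (s : Set α) (n : ℕ) :
    Function.Injective fun (j : Fin n → s) k => (j k : α) := fun _ _ h =>
  funext fun k => Subtype.ext (congrFun h k)

theorem F_supersymm (g n : ℕ) : IsSupersymm (fun i : Z.indices g n => (i : Coord r))
    fun i : Fin n → Z.indices g n => Z.F g n fun k => i k :=
  fun i k hk => Z.swap g n (fun k => i k) k hk

theorem poly_eq (g n : ℕ) : Z.poly g n = ((n.factorial : ℂ)⁻¹) •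
    symPoly (fun i : Z.indices g n => (i : Coord r))
      fun i : Fin n → Z.indices g n => Z.F g n fun k => i k := by
  rw [poly, finsum_eq_of_injective _ (restrict_injective (Z.indices g n : Set (Coord r)) n)
    fun i hi => by rw [Z.F_eq_zero hi, map_zero, mul_zero], finsum_eq_sum_of_fintype]
  rfl

/-- The multidifferentials as iterated derivatives. -/
theorem vacuum_dSeq_poly (g n : ℕ) (m : Fin n → Mode r) :
    vacuum p q r (dSeq S (List.ofFn m) (Z.poly g n)) = stableDiff S Z g n m := by
  rw [poly_eq, map_smul, map_smul, vacuum_dSeq_symPoly S Subtype.val_injective (Z.F_supersymm g n),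
    smul_smul, inv_mul_cancel₀ (by exact_mod_cast n.factorial_ne_zero), one_smul, stableDiff,
    finsum_eq_of_injective _ (restrict_injective (Z.indices g n : Set (Coord r)) n)
    fun i hi => by rw [Z.F_eq_zero hi, mul_zero, smul_zero], finsum_eq_sum_of_fintype]
  rfl

theorem vacuum_dSeq_poly_eq_zero (g : ℕ) {n : ℕ} {l : List (Mode r)} (hl : l.length ≠ n) :
    vacuum p q r (dSeq S l (Z.poly g n)) = 0 := by
  rw [poly_eq, map_smul, map_smul, vacuum_dSeq_symPoly_eq_zero S Subtype.val_injective
    (Z.F_supersymm g n) hl, smul_zero]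

end FreeEnergies


/-! ### The fundamental bidifferential -/

section Bidifferential

variable {p q r : ℕ} (S : CurveData p q r)

theorem dxi_zero_inl (a b : Fin r) (l : ℤ) : S.dxi (Sum.inr (a, 0)) (Sum.inl (b, l)) =
    if 0 < l then S.φ b a l.toNat 0 else 0 := by
  simp [CurveData.dxi, S.V_zero_zero]

theorem dxi_zero_inr (a b : Fin r) (l : ℤ) : S.dxi (Sum.inr (a, 0)) (Sum.inr (b, l)) =
    (if b = a ∧ l = 0 then 1 else 0) + if 0 ≤ l then S.V a b 0 l.toNat else 0 := by
  simp [CurveData.dxi, S.V_zero_zero]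

theorem dOp_zeroModes (m m' : Mode r) :
    dOp S m' (∑ a, baseIncl p q r (S.dxi (Sum.inr (a, 0)) m) * oddVar (Sum.inr (a, 0))) =
      baseIncl p q r ((-1 : ℂ) ^ (par m' * (1 + par m)) •
        ∑ a, S.dxi (Sum.inr (a, 0)) m * S.dxi (Sum.inr (a, 0)) m') := by
  rw [map_sum, map_smul, map_sum, Finset.smul_sum]
  refine Finset.sum_congr rfl fun a _ => ?_
  rw [dOp_mul S m' (dxi_parity S (Sum.inr (a, 0)) m).baseIncl, dOp_baseIncl, zero_mul, zero_add,
    show (oddVar (Sum.inr (a, 0)) : Fock p q r) = coordVar (Sum.inr (a, 0)) from rfl,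
    dOp_coordVar, map_mul]
  rfl

theorem dOp_creation (m m' : Mode r) : dOp S m' (creation m) = baseIncl p q r (match m with
    | .inl (b, l) => if h : 0 < l then (l : ℂ) • S.dxi (Sum.inl (b, ⟨l.toNat, by omega⟩)) m' else 0
    | .inr (b, l) => if 0 < l then S.dxi (Sum.inr (b, l.toNat)) m' else 0) := by
  rcases m with ⟨b, l⟩ | ⟨b, l⟩
  · simp only [creation]
    split_ifs with h
    · rw [map_smul, map_smul]
      exact congrArg _ (dOp_coordVar S m' (Sum.inl (b, ⟨l.toNat, by omega⟩)))
    · simp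
  · simp only [creation]
    split_ifs with h
    · exact dOp_coordVar S m' (Sum.inr (b, l.toNat))
    · simp

theorem phi_anticomm (a b c d : Fin r) (k l k' l' : ℕ) :
    S.φ a b k l * S.φ c d k' l' = -(S.φ c d k' l' * S.φ a b k l) := by
  simpa using (S.φ_odd a b k l).mul_comm (S.φ_odd c d k' l')

/-- The derivative of the multiplication part of a current is the fundamental bidifferential. -/
theorem dOp_src (m m' : Mode r) :
    dOp S m' (src S m) = baseIncl p q r (ramondB m m' + S.regB m m') := by
  rw [src, map_add, map_smul, dOp_zeroModes, dOp_creation, ← map_smul, ← map_add]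
  congr 1
  rcases m with ⟨b, l⟩ | ⟨b, l⟩ <;> rcases m' with ⟨b', l'⟩ | ⟨b', l'⟩ <;>
    simp only [dxi_zero_inl, dxi_zero_inr]
  · by_cases hl : 0 < l
    · have hl0 : (l : ℂ) ≠ 0 := by exact_mod_cast hl.ne'
      have hl1 : ((l.toNat : ℕ) : ℤ) = l := by omega
      have hl2 : ((l.toNat : ℕ) : ℂ) = l := by exact_mod_cast congrArg (Int.cast (R := ℂ)) hl1
      simp only [hl, dif_pos, if_true, CurveData.dxi, CurveData.regB, ramondB,
        PNat.mk_coe, hl1, hl2, true_and, smul_add]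
      by_cases hl' : 0 < l'
      · have e : ¬ (b' = b ∧ l' = -l) := by omega
        have e' : ¬ (b = b' ∧ l' = -l) := by omega
        simp only [hl', if_true, e, e', if_false, zero_add, smul_zero]
        -- The `φφ` correction in `dξ` and the `φφ` term from the zero modes cancel because the `φ`
        -- anticommute.
        simp only [phi_anticomm S b _ b', Finset.sum_neg_distrib, smul_add, smul_smul, par,
          Sum.elim_inl, zero_mul, pow_zero, one_smul, mul_inv_cancel₀ hl0, smul_neg]
        rw [← mul_assoc, mul_inv_cancel₀ hl0]
        simp
      · simp only [hl', if_false, add_zero, mul_zero, Finset.sum_const_zero, smul_zero]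
        by_cases e : b' = b ∧ l' = -l
        · rw [if_pos e, if_pos ⟨e.1.symm, e.2⟩, Algebra.algebraMap_eq_smul_one]
        · rw [if_neg e, if_neg fun h => e ⟨h.1.symm, h.2⟩, smul_zero]
    · simp [hl, CurveData.regB, ramondB]
  · by_cases hl : 0 < l
    · have hl0 : (l : ℂ) ≠ 0 := by exact_mod_cast hl.ne'
      have hl2 : ((l.toNat : ℕ) : ℂ) = l := by
        exact_mod_cast congrArg (Int.cast (R := ℂ)) (Int.toNat_of_nonneg hl.le)
      -- The two `Vφ` terms cancel. The pole part of `dη_{c,0}` leaves `-½ φ` at `l' = 0`, which is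
      -- the factor `1 - δ/2` in the bidifferential.
      have hV : ∀ c, S.φ b c l.toNat 0 * S.V c b' 0 l'.toNat =
          S.V c b' 0 l'.toNat * S.φ b c l.toNat 0 := fun c => (V_comm S _ _ _ _ _).symm
      simp only [hl, dif_pos, if_true, CurveData.dxi, CurveData.regB,
        ramondB, PNat.mk_coe, hl2, true_and]
      by_cases hl' : 0 ≤ l'
      · simp only [hl', if_true, par, Sum.elim_inl, Sum.elim_inr, smul_smul, mul_inv_cancel₀ hl0,
          one_smul, mul_add, Finset.sum_add_distrib, hV]
        by_cases h0 : l' = 0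
        · subst h0
          simp
          module
        · simp [h0]
      · have h0 : l' ≠ 0 := by omega
        simp [hl', h0]
    · simp [hl, CurveData.regB, ramondB]
  · rcases lt_trichotomy l 0 with hl | rfl | hl
    · simp [hl.not_gt, hl.not_ge, hl.ne, CurveData.regB, ramondB]
    · by_cases hl' : 0 < l'
      · simp [hl', CurveData.regB, ramondB, par, S.V_zero_zero]
        module
      · simp [hl', CurveData.regB, ramondB]
    · by_cases hl' : 0 < l'
      · simp only [hl', hl, hl.le, hl.ne', CurveData.regB, CurveData.dxi, ramondB, par,
          S.V_antisymm _ b 0 l.toNat]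
        simp
      · simp [hl', CurveData.regB, CurveData.dxi, ramondB]
  · rcases lt_trichotomy l 0 with hl | rfl | hl
    · simp [hl.not_gt, hl.not_ge, hl.ne, CurveData.regB, ramondB]
    · by_cases h0 : l' = 0
      · subst h0
        by_cases hb : b = b'
        · subst hb
          -- The `½` of `Γ_{b,0}` is the constant term `½ [dθ₁][dθ₂]` of the expanded standard
          -- bidifferential.
          simp [CurveData.regB, ramondB, par, S.V_zero_zero, Algebra.algebraMap_eq_smul_one]
        · simp [CurveData.regB, ramondB, par, S.V_zero_zero, hb]
      · by_cases hl' : 0 ≤ l'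
        · simp [CurveData.regB, ramondB, par, S.V_zero_zero, h0, hl']
          module
        · simp [CurveData.regB, ramondB, par, S.V_zero_zero, h0, hl']
    · simp only [hl, hl.le, hl.ne', if_true, true_and, and_false, if_false, zero_add, sub_zero,
        CurveData.regB, ramondB, CurveData.dxi, par, Sum.elim_inr, S.V_antisymm _ b 0 l.toNat]
      have e : ((l.toNat : ℕ) : ℤ) = l := by omega
      simp only [e, @eq_comm _ b' b]
      by_cases hl' : 0 ≤ l'
      · have e2 : ¬ (l' = -l) := by omega
        by_cases h0 : l' = 0
        · subst h0
          simp [e2, mul_add, Finset.sum_add_distrib]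
          module
        · simp [e2, h0, hl']
      · have h0 : l' ≠ 0 := by omega
        simp [h0, hl']

end Bidifferential


/-! ### Iterated Leibniz rule -/

section Leibniz

variable {p q r : ℕ} (S : CurveData p q r)

/-- The exponent of the sign in the Leibniz rule. -/
def leibnizExp {n : ℕ} (m : Fin n → Mode r) (d : ℕ) (I J : Finset (Fin n)) : ℕ :=
  d * ∑ j ∈ J, par (m j) + ∑ i ∈ I, ∑ j ∈ J, if i < j then par (m i) * par (m j) else 0

/-- The derivation with the smallest index acts first. It hits the first factor, so the index joins
`I`, or it passes `f` and hits the second. Later derivations that hit the first factor pass it with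
no new sign in the exponent beyond inversions of `I` against its complement. -/
theorem dSeq_mul {n : ℕ} (m : Fin n → Mode r) (T : Finset (Fin n)) {d : ℕ} {f : Fock p q r}
    (hf : HasParity d f) (g : Fock p q r) :
    dSeq S (T.sort.map m) (f * g) = ∑ I ∈ T.powerset, (-1 : ℂ) ^ leibnizExp m d I (T \ I) •
      (dSeq S (I.sort.map m) f * dSeq S ((T \ I).sort.map m) g) := by
  induction T using Finset.induction_on_min generalizing f g d with
  | empty => simp [leibnizExp]
  | insert a T ha ih =>
    have haT : a ∉ T := fun h => lt_irrefl _ (ha a h)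
    rw [Finset.sort_insert _ (fun b hb => (ha b hb).le) haT, List.map_cons, dSeq_cons,
      dOp_mul S (m a) hf, map_add, map_smul, ih (hf.dOp S (m a)), ih hf,
      Finset.sum_powerset_insert haT, add_comm, Finset.smul_sum]
    refine congrArg₂ _ (Finset.sum_congr rfl fun I hI => ?_) (Finset.sum_congr rfl fun I hI => ?_)
    · have hIT := Finset.mem_powerset.mp hI
      have haI : a ∉ I := fun h => haT (hIT h)
      have haJ : a ∉ T \ I := fun h => haT (Finset.mem_sdiff.mp h).1
      rw [Finset.insert_sdiff_of_notMem _ haI, Finset.sort_insert _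
        (fun b hb => (ha b (Finset.mem_sdiff.mp hb).1).le) haJ, List.map_cons, dSeq_cons, smul_smul,
        ← pow_add]
      congr 2
      have : ∑ i ∈ I, ∑ j ∈ insert a (T \ I), (if i < j then par (m i) * par (m j) else 0) =
          ∑ i ∈ I, ∑ j ∈ T \ I, if i < j then par (m i) * par (m j) else 0 := by
        refine Finset.sum_congr rfl fun i hi => ?_
        rw [Finset.sum_insert haJ, if_neg (ha i (hIT hi)).not_gt, zero_add]
      rw [leibnizExp, leibnizExp, this, Finset.sum_insert haJ]
      ring
    · have hIT := Finset.mem_powerset.mp hI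
      have haI : a ∉ I := fun h => haT (hIT h)
      have hs : insert a T \ insert a I = T \ I := by
        ext x
        simp only [Finset.mem_sdiff, Finset.mem_insert]
        constructor
        · rintro ⟨h1 | h1, h2⟩
          · exact absurd (Or.inl h1) h2
          · exact ⟨h1, fun h => h2 (Or.inr h)⟩
        · rintro ⟨h1, h2⟩
          refine ⟨Or.inr h1, ?_⟩
          rintro (rfl | h)
          exacts [haT h1, h2 h]
      rw [hs, Finset.sort_insert _ (fun b hb => (ha b (hIT hb)).le) haI, List.map_cons, dSeq_cons]
      congr 2
      have : ∑ j ∈ T \ I, (if a < j then par (m a) * par (m j) else 0) =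
          par (m a) * ∑ j ∈ T \ I, par (m j) := by
        rw [Finset.mul_sum]
        exact Finset.sum_congr rfl fun j hj => if_pos (ha j (Finset.mem_sdiff.mp hj).1)
      rw [leibnizExp, leibnizExp, Finset.sum_insert haI, this]
      ring

theorem map_sort_univ {n : ℕ} (m : Fin n → Mode r) :
    (Finset.univ : Finset (Fin n)).sort.map m = List.ofFn m := by
  rw [Fin.sort_univ, List.ofFn_eq_map]

theorem map_sort_eq {n : ℕ} (m : Fin n → Mode r) (I : Finset (Fin n)) :
    I.sort.map m = List.ofFn (m ∘ I.orderEmbOfFin rfl) := by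
  rw [List.ofFn_eq_map, ← List.map_map, Finset.listMap_orderEmbOfFin_finRange]

end Leibniz

/-! ### Multidifferentials from the currents -/

namespace FreeEnergies

variable {p q r : ℕ} (S : CurveData p q r) (Z : FreeEnergies p q r)

/-- The number of derivatives selects `n`, and then `2g + n = χ + 2` selects `g`. -/
theorem vacuum_dSeq_freeEnergy {g n χ : ℕ} (h : 2 * g + n = χ + 2) (hn : 1 ≤ n)
    (m : Fin n → Mode r) :
    vacuum p q r (dSeq S (List.ofFn m) (Z.freeEnergy χ)) = stableDiff S Z g n m := by
  rw [freeEnergy, map_sum, map_sum, Finset.sum_eq_single g]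
  · rw [map_sum, map_sum, Finset.sum_eq_single n]
    · rw [if_pos h, vacuum_dSeq_poly]
    · intro n' _ hn'
      split_ifs
      · exact vacuum_dSeq_poly_eq_zero S Z g (by simpa using hn'.symm)
      · simp
    · intro hn'
      exact absurd (Finset.mem_Icc.mpr ⟨hn, by omega⟩) hn'
  · intro g' _ hg'
    rw [map_sum, map_sum]
    refine Finset.sum_eq_zero fun n' _ => ?_
    split_ifs
    · exact vacuum_dSeq_poly_eq_zero S Z g' (by simp; omega)
    · simp
  · intro hg
    exact absurd (Finset.mem_range.mpr (by omega)) hg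

theorem vacuum_dSeq_freeEnergy_eq_zero {χ : ℕ} {l : List (Mode r)}
    (h : ∀ g, 2 * g + l.length ≠ χ + 2) : vacuum p q r (dSeq S l (Z.freeEnergy χ)) = 0 := by
  rw [freeEnergy, map_sum, map_sum]
  refine Finset.sum_eq_zero fun g _ => ?_
  rw [map_sum, map_sum]
  refine Finset.sum_eq_zero fun n _ => ?_
  split_ifs with hg
  · exact vacuum_dSeq_poly_eq_zero S Z g fun e => h g (by omega)
  · simp

theorem vacuum_creation (m : Mode r) : vacuum p q r (creation m) = 0 := by
  rcases m with ⟨b, l⟩ | ⟨b, l⟩ <;> simp only [creation] <;> split_ifs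
  · rw [map_smul]
    exact (congrArg _ (vacuum_coordVar (Sum.inl (b, ⟨l.toNat, by omega⟩)))).trans (smul_zero _)
  · simp
  · exact vacuum_coordVar (Sum.inr (b, l.toNat))
  · simp

theorem vacuum_src (m : Mode r) : vacuum p q r (src S m) = 0 := by
  rw [src, map_add, vacuum_creation, map_smul, map_sum, Finset.sum_eq_zero, smul_zero, add_zero]
  intro a _
  rw [map_mul, show (oddVar (Sum.inr (a, 0)) : Fock p q r) = coordVar (Sum.inr (a, 0)) from rfl,
    vacuum_coordVar, mul_zero]

theorem vacuum_dSeq_src_eq_zero (m : Mode r) {l : List (Mode r)} (hl : l.length ≠ 1) :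
    vacuum p q r (dSeq S l (src S m)) = 0 := by
  rcases l with _ | ⟨m₁, _ | ⟨m₂, l⟩⟩
  · exact vacuum_src S m
  · exact absurd rfl hl
  · rw [dSeq_cons, dOp_src, dSeq_baseIncl S _ (List.cons_ne_nil _ _), map_zero]

/-- The multidifferentials as iterated derivatives of the currents. -/
theorem vacuum_dSeq_current (g n : ℕ) (m₀ : Mode r) (m : Fin n → Mode r) :
    vacuum p q r (dSeq S (List.ofFn m) (Z.current S m₀ (2 * g + n))) =
      omega S Z g (n + 1) (Fin.cons m₀ m) := by
  have hcons : List.ofFn (Fin.cons m₀ m : Fin (n + 1) → Mode r) = m₀ :: List.ofFn m := by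
    rw [List.ofFn_succ]; rfl
  have stable : ∀ χ, 2 * g + n = χ + 1 →
      vacuum p q r (dSeq S (List.ofFn m) (dOp S m₀ (Z.freeEnergy χ))) =
        stableDiff S Z g (n + 1) (Fin.cons m₀ m) := fun χ h => by
    rw [← dSeq_cons, ← hcons, Z.vacuum_dSeq_freeEnergy S (g := g) (by omega) (by omega)]
  -- The cases are `ω_{0,1}`, `ω_{0,2}`, where `src` contributes the bidifferential, and the
  -- derivatives of the free energies of positive degree.
  obtain h | ⟨h1, h2⟩ | ⟨d, h⟩ : 2 * g + n = 0 ∨ (g = 0 ∧ n = 1) ∨ ∃ d, 2 * g + n = d + 2 := by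
    rcases g with _ | g
    · rcases n with _ | _ | n
      · simp
      · simp
      · exact Or.inr (Or.inr ⟨n, by omega⟩)
    · exact Or.inr (Or.inr ⟨2 * g + n, by omega⟩)
  · obtain ⟨rfl, rfl⟩ : g = 0 ∧ n = 0 := by omega
    exact vacuum_baseIncl _
  · subst h1 h2
    have e : List.ofFn m = [m 0] := by simp
    change vacuum p q r (dSeq S (List.ofFn m) (src S m₀ + dOp S m₀ (Z.freeEnergy 0))) = _
    rw [map_add, map_add, stable 0 rfl, e, dSeq_cons, dOp_src, dSeq_nil, Module.End.one_apply,
      vacuum_baseIncl, add_assoc]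
    rfl
  · rw [h]
    refine (stable (d + 1) (by omega)).trans ?_
    rcases g with _ | g
    · obtain rfl : n = d + 2 := by omega
      rfl
    · rfl

theorem vacuum_dSeq_current_eq_zero (m₀ : Mode r) {l : List (Mode r)} {d : ℕ}
    (h : ∀ g, 2 * g + l.length ≠ d) : vacuum p q r (dSeq S l (Z.current S m₀ d)) = 0 := by
  rcases d with _ | _ | d
  · exact (congrArg _ (dSeq_baseIncl S _ (by rintro rfl; exact h 0 rfl))).trans (map_zero _)
  · change vacuum p q r (dSeq S l (src S m₀ + dOp S m₀ (Z.freeEnergy 0))) = _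
    have h0 : l.length ≠ 1 := fun e => h 0 (by omega)
    rw [map_add, map_add, vacuum_dSeq_src_eq_zero S _ h0, zero_add, ← dSeq_cons,
      Z.vacuum_dSeq_freeEnergy_eq_zero S fun g e => h g (by simp at e; omega)]
  · change vacuum p q r (dSeq S l (dOp S m₀ (Z.freeEnergy (d + 1)))) = _
    rw [← dSeq_cons, Z.vacuum_dSeq_freeEnergy_eq_zero S fun g e => h g (by simp at e; omega)]

theorem stableDiff_swap (g n : ℕ) (A B : Mode r) (m : Fin n → Mode r) :
    stableDiff S Z g (n + 2) (Fin.cons A (Fin.cons B m)) =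
      (-1 : ℂ) ^ (par A * par B) • stableDiff S Z g (n + 2) (Fin.cons B (Fin.cons A m)) := by
  have h : ∀ A B : Mode r, List.ofFn (Fin.cons A (Fin.cons B m) : Fin (n + 2) → Mode r) =
      A :: B :: List.ofFn m := fun A B => by
    rw [List.ofFn_succ, List.ofFn_succ]; rfl
  rw [← Z.vacuum_dSeq_poly, ← Z.vacuum_dSeq_poly, h, h, dSeq_cons, dSeq_cons, dSeq_cons, dSeq_cons,
    dOp_comm, map_smul, map_smul, mul_comm]

theorem regB_symm (A B : Mode r) :
    S.regB A B = (-1 : ℂ) ^ (par A * par B) • S.regB B A := by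
  rcases A with ⟨a, k⟩ | ⟨a, k⟩ <;> rcases B with ⟨b, l⟩ | ⟨b, l⟩
  · simp [CurveData.regB, par, S.B_symm a b, and_comm]
  · simp [CurveData.regB, par, and_comm]
  · simp [CurveData.regB, par, and_comm]
  · simp only [CurveData.regB, par, Sum.elim_inr, mul_one, pow_one, neg_smul, one_smul,
      S.V_antisymm a b, and_comm (a := 0 ≤ l)]
    split_ifs <;> simp
    try module

theorem omegaReg_eq (g n : ℕ) (m : Fin (n + 2) → Mode r) : omegaReg S Z g (n + 2) m =
    (if g = 0 ∧ n = 0 then S.regB (m 0) (m 1) else 0) + stableDiff S Z g (n + 2) m := by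
  rcases g with _ | g
  · rcases n with _ | n
    · rw [if_pos ⟨rfl, rfl⟩]; rfl
    · rw [if_neg (by omega), zero_add]; rfl
  · rw [if_neg (by omega), zero_add]; rfl

theorem omegaReg_swap (g n : ℕ) (A B : Mode r) (m : Fin n → Mode r) :
    omegaReg S Z g (n + 2) (Fin.cons A (Fin.cons B m)) =
      (-1 : ℂ) ^ (par A * par B) • omegaReg S Z g (n + 2) (Fin.cons B (Fin.cons A m)) := by
  rw [omegaReg_eq, omegaReg_eq, smul_add, ← stableDiff_swap]
  congr 1
  split_ifs
  · exact regB_symm S A B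
  · simp

theorem omega_eq_add_omegaReg (g n : ℕ) (A B : Mode r) (m : Fin n → Mode r) :
    omega S Z g (n + 2) (Fin.cons A (Fin.cons B m)) =
      (if g = 0 ∧ n = 0 then ramondB A B else 0) +
        omegaReg S Z g (n + 2) (Fin.cons A (Fin.cons B m)) := by
  rcases g with _ | g
  · rcases n with _ | n
    · rw [if_pos ⟨rfl, rfl⟩]; rfl
    · rw [if_neg (by omega), zero_add]; rfl
  · rw [if_neg (by omega), zero_add]; rfl

/-- A current of degree `e` hit by `|I|` derivations survives only if `e = 2g₁ + |I|`. So the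
splittings of the degree `2g + n` turn into splittings of `g`, for each `I`. -/
theorem vacuum_dSeq_current_mul (g n : ℕ) (A B : Mode r) (m : Fin n → Mode r) :
    (-1 : ℂ) ^ (par A * par B) • vacuum p q r (dSeq S (List.ofFn m)
      (∑ e ∈ Finset.HasAntidiagonal.antidiagonal (2 * g + n),
        Z.current S A e.1 * Z.current S B e.2)) =
      ∑ h ∈ Finset.HasAntidiagonal.antidiagonal g, ∑ I : Finset (Fin n),
        omegaProd S Z h.1 h.2 n I m A B := by
  have e1 : ∀ e : ℕ × ℕ, vacuum p q r (dSeq S (List.ofFn m)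
      (Z.current S A e.1 * Z.current S B e.2)) = ∑ I : Finset (Fin n),
        (-1 : ℂ) ^ leibnizExp m (par A) I Iᶜ •
          (vacuum p q r (dSeq S (I.sort.map m) (Z.current S A e.1)) *
            vacuum p q r (dSeq S (Iᶜ.sort.map m) (Z.current S B e.2))) := fun e => by
    rw [← map_sort_univ, dSeq_mul S m _ (Z.current_parity S A e.1), map_sum, Finset.powerset_univ]
    refine Finset.sum_congr rfl fun I _ => ?_
    rw [map_smul, map_mul, ← Finset.compl_eq_univ_sdiff]
  rw [map_sum, map_sum, Finset.sum_comm, Finset.smul_sum]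
  simp only [e1, Finset.smul_sum]
  rw [Finset.sum_comm]
  refine Finset.sum_congr rfl fun I _ => ?_
  have hc := I.card_add_card_compl
  rw [Fintype.card_fin] at hc
  have inj : Function.Injective fun h : ℕ × ℕ => (2 * h.1 + I.card, 2 * h.2 + Iᶜ.card) := by
    rintro ⟨a, b⟩ ⟨c, d⟩ h
    simp only [Prod.mk.injEq] at h ⊢
    omega
  symm
  refine Finset.sum_of_injOn (fun h : ℕ × ℕ => (2 * h.1 + I.card, 2 * h.2 + Iᶜ.card)) inj.injOn
    ?_ ?_ ?_
  · intro h hh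
    simp only [Finset.mem_coe, Finset.HasAntidiagonal.mem_antidiagonal] at hh ⊢
    omega
  · rintro ⟨a, b⟩ he hn
    rw [Finset.HasAntidiagonal.mem_antidiagonal] at he
    simp only at he
    have : (∀ g₁, 2 * g₁ + I.card ≠ a) ∨ (∀ g₂, 2 * g₂ + Iᶜ.card ≠ b) := by
      by_contra hcon
      push Not at hcon
      obtain ⟨⟨g₁, h1⟩, g₂, h2⟩ := hcon
      refine hn ⟨(g₁, g₂), ?_, by simp [h1, h2]⟩
      simp only [Finset.mem_coe, Finset.HasAntidiagonal.mem_antidiagonal]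
      omega
    rcases this with h | h
    · rw [Z.vacuum_dSeq_current_eq_zero S A (by simpa using h), zero_mul, smul_zero, smul_zero]
    · rw [Z.vacuum_dSeq_current_eq_zero S B (by simpa using h), mul_zero, smul_zero, smul_zero]
  · rintro ⟨g₁, g₂⟩ _
    simp only [map_sort_eq, vacuum_dSeq_current]
    rw [omegaProd, smul_smul, ← pow_add]
    congr 1
    refine neg_one_pow_congr ?_
    -- The Leibniz sign counts pairs with `i < j` and `omegaProd` those with `j < i`; together they
    -- give the full product of parities.
    have hsum : (∑ i ∈ I, par (m i)) * ∑ j ∈ Iᶜ, par (m j) =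
        (∑ i ∈ I, ∑ j ∈ Iᶜ, if i < j then par (m i) * par (m j) else 0) +
          ∑ i ∈ I, ∑ j ∈ Iᶜ, if j < i then par (m i) * par (m j) else 0 := by
      rw [Finset.sum_mul_sum, ← Finset.sum_add_distrib]
      refine Finset.sum_congr rfl fun i hi => ?_
      rw [← Finset.sum_add_distrib]
      refine Finset.sum_congr rfl fun j hj => ?_
      have hij : i ≠ j := fun h => (Finset.mem_compl.mp hj) (h ▸ hi)
      rcases lt_or_gt_of_ne hij with h | h <;> simp [h, h.not_gt]
    rw [leibnizExp, add_mul, hsum]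
    push_cast
    generalize (∑ i ∈ I, ∑ j ∈ Iᶜ, if j < i then ((par (m i) : ZMod 2) * (par (m j) : ZMod 2)) else 0) = x
    have h2 : (2 : ZMod 2) = 0 := rfl
    linear_combination x * h2

/-- The quadratic expressions in the currents as multidifferentials. -/
theorem vacuum_dSeq_normQuad (g n : ℕ) (A B : Mode r) (m : Fin n → Mode r) :
    (-1 : ℂ) ^ (par A * par B) • vacuum p q r (dSeq S (List.ofFn m)
      (Z.normQuad S A B (2 * g + n))) =
      (∑ h ∈ Finset.HasAntidiagonal.antidiagonal g, ∑ I : Finset (Fin n),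
        omegaProd S Z h.1 h.2 n I m A B) +
      if g = 0 then 0 else omegaReg S Z (g - 1) (n + 2) (Fin.cons A (Fin.cons B m)) := by
  rw [normQuad, quad, add_sub_assoc, map_add, map_add, smul_add, vacuum_dSeq_current_mul]
  congr 1
  rcases g with _ | g
  -- In genus 0 this would be `n + 1` derivations on a current of degree `n - 1`, which is too many.
  · have h1 : vacuum p q r (dSeq S (List.ofFn m) (if 1 ≤ 2 * 0 + n then
        dOp S A (Z.current S B (2 * 0 + n - 1)) else 0)) = 0 := by
      split_ifs
      · rw [← dSeq_cons, Z.vacuum_dSeq_current_eq_zero S B fun g => by simp; omega]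
      · simp
    have h2 : vacuum p q r (dSeq S (List.ofFn m) (if 2 * 0 + n = 2 then
        baseIncl p q r (ramondB B A) else 0)) = 0 := by
      split_ifs with h
      · rw [dSeq_baseIncl S _ fun e => by simp at e; omega, map_zero]
      · simp
    rw [if_pos rfl, map_sub, map_sub, h1, h2, sub_zero, smul_zero]
  -- The derivation `∂_A` acts on the current of `B`, giving the differentials in the order `B, A`;
  -- exchanging them absorbs the prefactor.
  · rw [if_neg (Nat.succ_ne_zero g), omegaReg_swap, Nat.add_sub_cancel, if_pos (by omega)]
    congr 1
    have h : 2 * (g + 1) + n - 1 = 2 * g + (n + 1) := by omega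
    have hl : A :: List.ofFn m = List.ofFn (Fin.cons A m : Fin (n + 1) → Mode r) := by
      rw [List.ofFn_succ]; rfl
    rw [map_sub, map_sub, h, ← dSeq_cons, hl, vacuum_dSeq_current, omega_eq_add_omegaReg]
    have h2 : vacuum p q r (dSeq S (List.ofFn m) (if 2 * (g + 1) + n = 2 then
        baseIncl p q r (ramondB B A) else 0)) = if g = 0 ∧ n = 0 then ramondB B A else 0 := by
      by_cases h : g = 0 ∧ n = 0
      · obtain ⟨rfl, rfl⟩ := h
        simp [vacuum_baseIncl]
      · rw [if_neg h, if_neg (by omega), map_zero, map_zero]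
    rw [h2, add_sub_cancel_left]

end FreeEnergies


/-! ### Pullback orders and the Casimir operator in coefficients -/

section Casimir

variable {r : ℕ} {M : Type} [AddCommGroup M] [Module ℂ M]

/-- Relative to `[dφ]^d`, the powers `x^j` give even shifts of the exponent and `φ x^j` odd ones.
The remaining powers of `√2` are invertible, so vanishing outside these exponents is enough. -/
theorem isBigO_of_eq_zero {d : ℕ} {e : ℤ} {c₀ c₁ : ℤ → M}
    (h₀ : ∀ N : ℤ, (N < d + 2 * e ∨ ¬ Even (N - d)) → c₀ N = 0)
    (h₁ : ∀ N : ℤ, (N < d + 2 * e + 1 ∨ Even (N - d)) → c₁ N = 0) : IsBigO d e c₀ c₁ := by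
  have h2 : ((√2 : ℝ) : ℂ) ≠ 0 := by
    norm_num
  refine ⟨fun j => (((√2 : ℝ) : ℂ) ^ d)⁻¹ • c₀ (d + 2 * (e + j)),
    fun j => (((√2 : ℝ) : ℂ) ^ (d + 1))⁻¹ • c₁ (d + 2 * (e + j) + 1), fun N => ⟨?_, ?_⟩⟩
  · by_cases hN : N < d + 2 * e ∨ ¬ Even (N - d)
    · rw [h₀ N hN, finsum_eq_zero_of_forall_eq_zero]
      intro j
      rw [if_neg]
      rintro rfl
      rcases hN with hN | hN
      · omega
      · exact hN ⟨e + j, by ring⟩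
    · push Not at hN
      obtain ⟨hN, k, hk⟩ := hN
      obtain ⟨j, hj⟩ := Int.eq_ofNat_of_zero_le (a := k - e) (by omega)
      have hN' : N = d + 2 * (e + (j : ℤ)) := by omega
      rw [finsum_eq_single _ j fun i hi => if_neg fun h => hi (by omega), if_pos hN', smul_smul,
        mul_inv_cancel₀ (pow_ne_zero _ h2), one_smul, hN']
  · by_cases hN : N < d + 2 * e + 1 ∨ Even (N - d)
    · rw [h₁ N hN, finsum_eq_zero_of_forall_eq_zero]
      intro j
      rw [if_neg]
      rintro rfl
      rcases hN with hN | ⟨k, hk⟩ <;> omega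
    · push Not at hN
      obtain ⟨hN, h⟩ := hN
      obtain ⟨k, hk⟩ := Int.not_even_iff_odd.mp h
      obtain ⟨j, hj⟩ := Int.eq_ofNat_of_zero_le (a := k - e) (by omega)
      have hN' : N = d + 2 * (e + (j : ℤ)) + 1 := by omega
      rw [finsum_eq_single _ j fun i hi => if_neg fun h => hi (by omega), if_pos hN', smul_smul,
        mul_inv_cancel₀ (pow_ne_zero _ h2), one_smul, hN']

theorem neg_one_zpow_sub_of_even {N : ℤ} (hN : Even N) (k : ℤ) :
    (-1 : ℂ) ^ (N - k) = (-1) ^ k := by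
  rw [zpow_sub₀ (by norm_num), hN.neg_one_zpow, one_div, ← inv_zpow]
  norm_num

theorem neg_one_zpow_sub_of_odd {N : ℤ} (hN : Odd N) (k : ℤ) :
    (-1 : ℂ) ^ (N - k) = -(-1) ^ k := by
  rw [zpow_sub₀ (by norm_num), hN.neg_one_zpow, neg_div, one_div, ← inv_zpow]
  norm_num

variable (a : Fin r) (c : Mode r → Mode r → M)

/-- The two restrictions are exchanged by `(z | θ) ↦ (-z | -θ)`, so their difference is odd under
it. Only `z^N` with `N` odd and `θ z^N` with `N` even can occur, and there both restrictions
contribute equally, which cancels the `½`. -/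
theorem casimir_fst_even {N : ℤ} (hN : Even N) : (casimir a c).1 N = 0 := by
  change (1 / 2 : ℂ) • ((∑ᶠ k : ℤ, ((1 : ℂ) ^ k * (-1) ^ (N - k)) •
      -c (Sum.inl (a, k)) (Sum.inr (a, N - k))) -
    ∑ᶠ k : ℤ, ((-1 : ℂ) ^ k * (-(-1)) ^ (N - k)) • -c (Sum.inl (a, k)) (Sum.inr (a, N - k))) = 0
  simp only [neg_one_zpow_sub_of_even hN, neg_neg, one_zpow, one_mul, mul_one, sub_self, smul_zero]

theorem casimir_fst_odd {N : ℤ} (hN : Odd N) : (casimir a c).1 N =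
    ∑ᶠ k : ℤ, (-1 : ℂ) ^ k • c (Sum.inl (a, k)) (Sum.inr (a, N - k)) := by
  change (1 / 2 : ℂ) • ((∑ᶠ k : ℤ, ((1 : ℂ) ^ k * (-1) ^ (N - k)) •
      -c (Sum.inl (a, k)) (Sum.inr (a, N - k))) -
    ∑ᶠ k : ℤ, ((-1 : ℂ) ^ k * (-(-1)) ^ (N - k)) • -c (Sum.inl (a, k)) (Sum.inr (a, N - k))) = _
  simp only [neg_one_zpow_sub_of_odd hN, neg_neg, one_zpow, one_mul, mul_one, smul_neg, neg_smul,
    finsum_neg_distrib]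
  module

theorem casimir_snd_odd {N : ℤ} (hN : Odd N) : (casimir a c).2 N = 0 := by
  change (1 / 2 : ℂ) • (((1 : ℂ) • (∑ᶠ k : ℤ, ((1 : ℂ) ^ k * (-1) ^ (N - k)) •
      ((k : ℂ) • c (Sum.inr (a, k)) (Sum.inr (a, N - k)))) -
      (1 : ℂ) • (∑ᶠ k : ℤ, ((1 : ℂ) ^ k * (-1) ^ (N - k)) •
        -c (Sum.inl (a, k)) (Sum.inl (a, N - k)))) -
    ((-1 : ℂ) • (∑ᶠ k : ℤ, ((-1 : ℂ) ^ k * (-(-1)) ^ (N - k)) •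
      ((k : ℂ) • c (Sum.inr (a, k)) (Sum.inr (a, N - k)))) -
      (-1 : ℂ) • (∑ᶠ k : ℤ, ((-1 : ℂ) ^ k * (-(-1)) ^ (N - k)) •
        -c (Sum.inl (a, k)) (Sum.inl (a, N - k))))) = _
  simp only [neg_one_zpow_sub_of_odd hN, neg_neg, one_zpow, one_mul, mul_one, smul_neg, neg_smul,
    finsum_neg_distrib]
  module

theorem casimir_snd_even {N : ℤ} (hN : Even N) : (casimir a c).2 N =
    ∑ᶠ k : ℤ, (-1 : ℂ) ^ k • (k : ℂ) • c (Sum.inr (a, k)) (Sum.inr (a, N - k)) +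
      ∑ᶠ k : ℤ, (-1 : ℂ) ^ k • c (Sum.inl (a, k)) (Sum.inl (a, N - k)) := by
  change (1 / 2 : ℂ) • (((1 : ℂ) • (∑ᶠ k : ℤ, ((1 : ℂ) ^ k * (-1) ^ (N - k)) •
      ((k : ℂ) • c (Sum.inr (a, k)) (Sum.inr (a, N - k)))) -
      (1 : ℂ) • (∑ᶠ k : ℤ, ((1 : ℂ) ^ k * (-1) ^ (N - k)) •
        -c (Sum.inl (a, k)) (Sum.inl (a, N - k)))) -
    ((-1 : ℂ) • (∑ᶠ k : ℤ, ((-1 : ℂ) ^ k * (-(-1)) ^ (N - k)) •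
      ((k : ℂ) • c (Sum.inr (a, k)) (Sum.inr (a, N - k)))) -
      (-1 : ℂ) • (∑ᶠ k : ℤ, ((-1 : ℂ) ^ k * (-(-1)) ^ (N - k)) •
        -c (Sum.inl (a, k)) (Sum.inl (a, N - k))))) = _
  simp only [neg_one_zpow_sub_of_even hN, neg_neg, one_zpow, one_mul, mul_one, smul_neg,
    finsum_neg_distrib]
  module

end Casimir

/-! ### Annihilation modes and bounded poles -/

section Annihilators

variable {p q r : ℕ} (S : CurveData p q r)

/-- The basis differentials with a pole, or without zero mode. -/
def IsSingular : Mode r → Prop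
  | .inl m => m.2 ≤ 0
  | .inr m => m.2 < 0

variable {S}

theorem src_eq_zero {m : Mode r} (hm : IsSingular m) : src S m = 0 := by
  rcases m with ⟨b, l⟩ | ⟨b, l⟩
  · have h : ¬ (0 < l) := not_lt.mpr hm
    simp [src, creation, dxi_zero_inl, h]
  · have h : l < 0 := hm
    simp [src, creation, dxi_zero_inr, h.not_gt, h.not_ge, h.ne]

theorem innerDer_opPhi_singular {m : Mode r} (hm : IsSingular m) :
    innerDer (opPhi S) (cur m) = 0 := by
  rcases m with ⟨b, l⟩ | ⟨b, l⟩
  · have h : l ≤ 0 := hm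
    obtain ⟨k, rfl⟩ : ∃ k : ℕ, l = -(k : ℤ) := ⟨(-l).toNat, by omega⟩
    simp only [cur, Sum.elim_inl, neg_neg]
    exact innerDer_opPhi_modeJ S b k
  · have h : l < 0 := hm
    obtain ⟨k, rfl⟩ : ∃ k : ℕ, l = -(k : ℤ) := ⟨(-l).toNat, by omega⟩
    simp only [cur, Sum.elim_inr, neg_neg]
    exact innerDer_opPhi_modeG S b k (by omega)

/-- These modes commute with log `Φ` and have no multiplication part, so the polarised derivation is
the bare mode. -/
theorem cur_singular {m : Mode r} (hm : IsSingular m) :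
    cur m = (dOp S m : Module.End ℂ (Fock p q r)) := by
  have h := expInner_opPhi_cur S m
  rw [innerDer_opPhi_singular hm, map_zero, smul_zero, add_zero, add_zero, src_eq_zero hm] at h
  rw [h]
  refine LinearMap.ext fun v => ?_
  simp

variable (S) in
theorem dOp_bdd (f : Fock p q r) : ∃ K : ℤ, ∀ (a : Fin r) (k : ℤ), k < K →
    dOp S (Sum.inl (a, k)) f = 0 ∧ dOp S (Sum.inr (a, k)) f = 0 := by
  obtain ⟨B, hB⟩ := modes_bdd f
  refine ⟨-B, fun a k hk => ?_⟩
  rw [← cur_singular (show IsSingular (Sum.inl (a, k)) from show k ≤ 0 by omega),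
    ← cur_singular (show IsSingular (Sum.inr (a, k)) from show k < 0 by omega)]
  exact hB a (-k) (by omega)

namespace FreeEnergies

variable {Z : FreeEnergies p q r}

theorem omega_eq_zero {m₀ : Mode r} (h₀ : IsSingular m₀)
    (h : ∀ χ, dOp S m₀ (Z.freeEnergy χ) = 0) {g n : ℕ} (hgn : 2 * g + n ≠ 0)
    (m : Fin n → Mode r) : omega S Z g (n + 1) (Fin.cons m₀ m) = 0 := by
  rw [← vacuum_dSeq_current]
  have : Z.current S m₀ (2 * g + n) = 0 := by
    generalize 2 * g + n = d at hgn
    rcases d with _ | _ | d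
    · exact absurd rfl hgn
    · rw [current, src_eq_zero h₀, h, add_zero]
    · exact h _
  rw [this, map_zero, map_zero]

variable (S Z) in
theorem omegaReg_bdd (g n : ℕ) (m : Fin n → Mode r) : ∃ K : ℤ, ∀ (A B : Mode r) (a : Fin r)
    (k : ℤ), k < K → (A = Sum.inl (a, k) ∨ A = Sum.inr (a, k)) →
      omegaReg S Z g (n + 2) (Fin.cons A (Fin.cons B m)) = 0 := by
  obtain ⟨K, hK⟩ := dOp_bdd S (Z.poly g (n + 2))
  refine ⟨min K 0, fun A B a k hk hA => ?_⟩
  have h1 : k < K := by omega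
  have h2 : k < 0 := by omega
  have hl : List.ofFn (Fin.cons A (Fin.cons B m) : Fin (n + 2) → Mode r) =
      A :: B :: List.ofFn m := by
    rw [List.ofFn_succ, List.ofFn_succ]; rfl
  have h3 : dOp S A (Z.poly g (n + 2)) = 0 := by
    rcases hA with rfl | rfl
    exacts [(hK a k h1).1, (hK a k h1).2]
  have h4 : S.regB A B = 0 := by
    rcases hA with rfl | rfl <;> rcases B with B | B <;>
      simp [CurveData.regB, h2.not_gt, h2.not_ge]
  rw [omegaReg_eq, ← vacuum_dSeq_poly, hl, dSeq_cons, h3, map_zero, map_zero, add_zero]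
  split_ifs
  · exact h4
  · rfl

variable (S Z) in
-- The pole order is bounded in the first variable and, by symmetry, in the second, so only finitely
-- many pairs of exponents have sum `N`.
theorem omegaReg_finite (g n : ℕ) (m : Fin n → Mode r) (a : Fin r) (N : ℤ)
    {A B : ℤ → Mode r} (hA : ∀ k, A k = Sum.inl (a, k) ∨ A k = Sum.inr (a, k))
    (hB : ∀ k, B k = Sum.inl (a, k) ∨ B k = Sum.inr (a, k)) :
    (Function.support fun k =>
      omegaReg S Z g (n + 2) (Fin.cons (A k) (Fin.cons (B (N - k)) m))).Finite := by
  obtain ⟨K, hK⟩ := omegaReg_bdd S Z g n m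
  refine (Set.finite_Icc K (N - K)).subset fun k hk => ?_
  by_contra hn
  refine hk ?_
  rw [Set.mem_Icc, not_and_or] at hn
  rcases hn with hn | hn
  · exact hK _ _ a k (by omega) (hA k)
  · change omegaReg S Z g (n + 2) (Fin.cons (A k) (Fin.cons (B (N - k)) m)) = 0
    rw [omegaReg_swap, hK _ _ a (N - k) (by omega) (hB _), smul_zero]

end FreeEnergies

end Annihilators

/-! ### The loop equations -/

section LoopEquations

variable {p q r : ℕ} {S : SuperSpectralCurve p q r} {Z : FreeEnergies p q r}

open FreeEnergies

/-- The `σ_a`-anti-invariant modes cancel in the sum. The invariant ones of exponent below 1 are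
`J_{a,0} = 0` and the generators `J_{a,2j}`, `Γ_{a,2j-1}`, which kill `Z`; for `ω_{0,1}` the
assumption on the curve is used instead. -/
theorem loop1_eq_zero (hZ : Z.IsPartitionFunction S) (a : Fin r) (g n : ℕ) (m : Fin n → Mode r)
    {N : ℤ} :
    ((N < 1 ∨ Odd N) → loop1 S.toCurveData Z g n (Sum.inl (a, N)) m = 0) ∧
    ((N < 1 ∨ Even N) → loop1 S.toCurveData Z g n (Sum.inr (a, N)) m = 0) := by
  have h01 : ∀ m₀ : Mode r, N < 1 → (m₀ = Sum.inl (a, N) ∨ m₀ = Sum.inr (a, N)) →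
      2 * g + n = 0 → loop1 S.toCurveData Z g n m₀ m = 0 := fun m₀ hN hm h => by
    obtain ⟨rfl, rfl⟩ : g = 0 ∧ n = 0 := by omega
    exact S.linear a N hN m₀ hm
  have sgn : ∀ m₀ : Mode r, sigmaSign m₀ = -1 → loop1 S.toCurveData Z g n m₀ m = 0 :=
    fun m₀ h => by
      rw [loop1, h, neg_smul, one_smul, add_neg_cancel]
  refine ⟨fun h => ?_, fun h => ?_⟩
  · rcases Int.even_or_odd N with hN | hN
    · have hN1 : N < 1 := h.resolve_right (Int.not_odd_iff_even.mpr hN)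
      by_cases hgn : 2 * g + n = 0
      · exact h01 _ hN1 (Or.inl rfl) hgn
      · have hs : IsSingular (Sum.inl (a, N) : Mode r) := show N ≤ 0 by omega
        have := omega_eq_zero (S := S.toCurveData) (Z := Z) hs (fun χ => ?_) hgn m
        · rw [loop1, this, smul_zero, add_zero]
        by_cases h0 : N = 0
        · rw [← cur_singular hs, h0]
          simp [cur]
        · obtain ⟨j, rfl⟩ : ∃ j, N = -(2 * j) := by
            obtain ⟨k, hk⟩ := hN
            exact ⟨-k, by omega⟩
          refine dOp_freeEnergy_eq_zero (cur_singular hs) ?_ χ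
          have := hZ _ (SuperSpectralCurve.IsGenerator.J a j (by omega))
          rwa [cur, Sum.elim_inl, neg_neg]
    · refine sgn _ ?_
      rw [sigmaSign, Sum.elim_inl, hN.neg_one_zpow]
  · rcases Int.even_or_odd N with hN | hN
    · refine sgn _ ?_
      rw [sigmaSign, Sum.elim_inr, (hN.add_one).neg_one_zpow]
    · have hN1 : N < 1 := h.resolve_right (Int.not_even_iff_odd.mpr hN)
      by_cases hgn : 2 * g + n = 0
      · exact h01 _ hN1 (Or.inr rfl) hgn
      · obtain ⟨k, hk⟩ := hN
        obtain ⟨j, rfl⟩ : ∃ j, N = -(2 * j - 1) := ⟨-k, by omega⟩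
        have hs : IsSingular (Sum.inr (a, -(2 * j - 1)) : Mode r) :=
          show -(2 * j - 1) < 0 by omega
        have := omega_eq_zero (S := S.toCurveData) (Z := Z) hs (fun χ => ?_) hgn m
        · rw [loop1, this, smul_zero, add_zero]
        refine dOp_freeEnergy_eq_zero (cur_singular hs) ?_ χ
        have := hZ _ (SuperSpectralCurve.IsGenerator.G a j (by omega))
        rwa [cur, Sum.elim_inr, neg_neg]

variable (S Z) in
/-- The evaluation of a quadratic expression in the currents. -/
def evalAt {n : ℕ} (m : Fin n → Mode r) : Fock p q r →ₗ[ℂ] BaseRing p q :=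
  (vacuum p q r).toLinearMap ∘ₗ dSeq S.toCurveData (List.ofFn m)

theorem omegaProd_sum_eq (g n : ℕ) (A B : Mode r) (m : Fin n → Mode r) :
    ∑ h ∈ Finset.HasAntidiagonal.antidiagonal g, ∑ I : Finset (Fin n),
      omegaProd S.toCurveData Z h.1 h.2 n I m A B =
    (-1 : ℂ) ^ (par A * par B) • evalAt S m (Z.normQuad S.toCurveData A B (2 * g + n)) -
      if g = 0 then 0 else
        omegaReg S.toCurveData Z (g - 1) (n + 2) (Fin.cons A (Fin.cons B m)) :=
  eq_sub_of_add_eq (vacuum_dSeq_normQuad S.toCurveData Z g n A B m).symm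

/-- The product sum is infinite in shape and is finite only as the difference of two finite sums:
the normal ordered quadratic terms and the regular `ω_{g-1,n+2}`. -/
theorem finsum_omega_add (g n : ℕ) (m : Fin n → Mode r) (a : Fin r) (N : ℤ) (w : ℤ → ℂ)
    {A B : ℤ → Mode r} (hA : ∀ k, A k = Sum.inl (a, k) ∨ A k = Sum.inr (a, k))
    (hB : ∀ k, B k = Sum.inl (a, k) ∨ B k = Sum.inr (a, k)) {σ : ℂ}
    (hσ : ∀ k l, (-1 : ℂ) ^ (par (A k) * par (B l)) = σ)
    (hfin : (Function.support fun k =>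
      w k • Z.normQuad S.toCurveData (A k) (B (N - k)) (2 * g + n)).Finite) :
    (if g = 0 then 0 else ∑ᶠ k, w k •
      omegaReg S.toCurveData Z (g - 1) (n + 2) (Fin.cons (A k) (Fin.cons (B (N - k)) m))) +
    ∑ᶠ k, w k • ∑ h ∈ Finset.HasAntidiagonal.antidiagonal g, ∑ I : Finset (Fin n),
      omegaProd S.toCurveData Z h.1 h.2 n I m (A k) (B (N - k)) =
    σ • evalAt S m (∑ᶠ k, w k • Z.normQuad S.toCurveData (A k) (B (N - k)) (2 * g + n)) := by
  have h1 : evalAt S m (∑ᶠ k, w k • Z.normQuad S.toCurveData (A k) (B (N - k)) (2 * g + n)) =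
      ∑ᶠ k, evalAt S m (w k • Z.normQuad S.toCurveData (A k) (B (N - k)) (2 * g + n)) :=
    (evalAt S m).toAddMonoidHom.map_finsum hfin
  have hfin1 : (Function.support fun k => σ • evalAt S m
      (w k • Z.normQuad S.toCurveData (A k) (B (N - k)) (2 * g + n))).Finite :=
    hfin.subset fun k hk h => hk (by
      have h' : w k • Z.normQuad S.toCurveData (A k) (B (N - k)) (2 * g + n) = 0 := h
      change σ • evalAt S m _ = 0
      rw [h', map_zero, smul_zero])
  have hfin2 : (Function.support fun k => w k • if g = 0 then 0 else omegaReg S.toCurveData Z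
      (g - 1) (n + 2) (Fin.cons (A k) (Fin.cons (B (N - k)) m))).Finite :=
    (omegaReg_finite S.toCurveData Z (g - 1) n m a N hA hB).subset fun k hk h => hk (by
      change w k • (if g = 0 then 0 else _) = 0
      have h' : omegaReg S.toCurveData Z (g - 1) (n + 2)
        (Fin.cons (A k) (Fin.cons (B (N - k)) m)) = 0 := h
      rw [h', ite_self, smul_zero])
  have h2 : ∀ k, w k • ∑ h ∈ Finset.HasAntidiagonal.antidiagonal g, ∑ I : Finset (Fin n),
      omegaProd S.toCurveData Z h.1 h.2 n I m (A k) (B (N - k)) =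
      σ • evalAt S m (w k • Z.normQuad S.toCurveData (A k) (B (N - k)) (2 * g + n)) -
        w k • if g = 0 then 0 else omegaReg S.toCurveData Z (g - 1) (n + 2)
          (Fin.cons (A k) (Fin.cons (B (N - k)) m)) := fun k => by
    rw [omegaProd_sum_eq, hσ, smul_sub, map_smul, smul_comm]
  rw [h1, smul_finsum, finsum_congr h2, finsum_sub_distrib hfin1 hfin2]
  split_ifs
  · simp
  · abel

theorem loop2_fst_eq_zero (hZ : Z.IsPartitionFunction S) (a : Fin r) (g n : ℕ)
    (m : Fin n → Mode r) {N : ℤ} (hN : N < S.s a ∨ Even N) :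
    (loop2 S.toCurveData Z a g n m).1 N = 0 := by
  rcases Int.even_or_odd N with hN' | hN'
  · simp only [loop2, casimirOmega, Prod.fst_add, Pi.add_apply]
    rw [casimir_fst_even _ _ hN', add_zero]
    split_ifs
    · rfl
    · simp [casimir_fst_even _ _ hN', casimirRamond]
    · simp [casimir_fst_even _ _ hN']
  · have hN1 : N < S.s a := hN.resolve_right (Int.not_even_iff_odd.mpr hN')
    have hs : Odd (S.s a) := (S.s_isLeast a).1.1
    have h1 := finsum_omega_add (S := S) (Z := Z) g n m a N (fun k => (-1 : ℂ) ^ k)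
      (A := fun k => Sum.inl (a, k)) (B := fun k => Sum.inr (a, k)) (σ := 1)
      (fun _ => Or.inl rfl) (fun _ => Or.inr rfl) (fun _ _ => by simp [par])
      ((normQuad_JG Z S.toCurveData a N fun j => (-1 : ℂ) ^ j).2 (2 * g + n)).1
    have h2 : ∑ᶠ k : ℤ, (-1 : ℂ) ^ k •
        Z.normQuad S.toCurveData (Sum.inl (a, k)) (Sum.inr (a, N - k)) (2 * g + n) = 0 := by
      obtain ⟨x, hx⟩ := hs
      obtain ⟨y, hy⟩ := hN'
      -- With `s = 2x + 1` and `N = 2y + 1`, the operator `G_{a,-N}` has generator index `j = x -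
      -- y`, and `j ≥ 1` means `N < s`.
      have h := finsum_normQuad_odd (hZ _ (SuperSpectralCurve.IsGenerator.SG a (x - y) (-y - 1)
        (by omega) (by omega))) (2 * g + n)
      rwa [show -(2 * (-y - 1) + 1) = N by omega] at h
    rw [h2, map_zero, smul_zero] at h1
    refine Eq.trans ?_ h1
    simp only [loop2, casimirOmega, Prod.fst_add, Pi.add_apply, casimir_fst_odd _ _ hN']
    congr 1
    split_ifs
    · rfl
    · simp [casimir_fst_odd _ _ hN', casimirRamond]
    · simp [casimir_fst_odd _ _ hN']

theorem loop2_snd_eq_zero (hZ : Z.IsPartitionFunction S) (a : Fin r) (g n : ℕ)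
    (m : Fin n → Mode r) {N : ℤ} (hN : N < S.s a + 1 ∨ Odd N) :
    (loop2 S.toCurveData Z a g n m).2 N = 0 := by
  rcases Int.even_or_odd N with hN' | hN'
  swap
  · have hN0 : N ≠ 0 := by rintro rfl; exact absurd hN' (by decide)
    simp only [loop2, casimirOmega, Prod.snd_add, Pi.add_apply]
    rw [casimir_snd_odd _ _ hN', add_zero]
    split_ifs
    · rfl
    · simp [casimir_snd_odd _ _ hN', casimirRamond, hN0]
    · simp [casimir_snd_odd _ _ hN']
  · have hN1 : N < S.s a + 1 := hN.resolve_right (Int.not_odd_iff_even.mpr hN')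
    have hs : Odd (S.s a) := (S.s_isLeast a).1.1
    have hJ := finsum_omega_add (S := S) (Z := Z) g n m a N (fun k => (-1 : ℂ) ^ k)
      (A := fun k => Sum.inl (a, k)) (B := fun k => Sum.inl (a, k)) (σ := 1)
      (fun _ => Or.inl rfl) (fun _ => Or.inl rfl) (fun _ _ => by simp [par])
      ((normQuad_JJ Z S.toCurveData a N fun j => (-1 : ℂ) ^ j).2 (2 * g + n)).1
    -- Here `σ = -1`, as both differentials are odd. It turns the difference in the even constraint
    -- into the sum in the Casimir operator.
    have hG := finsum_omega_add (S := S) (Z := Z) g n m a N (fun k => (-1 : ℂ) ^ k * (k : ℂ))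
      (A := fun k => Sum.inr (a, k)) (B := fun k => Sum.inr (a, k)) (σ := -1)
      (fun _ => Or.inr rfl) (fun _ => Or.inr rfl) (fun _ _ => by simp [par])
      ((normQuad_GG Z S.toCurveData a N fun j => (-1 : ℂ) ^ j * (j : ℂ)).2 (2 * g + n)).1
    obtain ⟨x, hx⟩ := hs
    obtain ⟨y, hy⟩ := hN'
    -- With `s = 2x + 1` and `N = 2y`, the operator `L_{a,-N}` has generator index `j = x + 1 - y`,
    -- and `j ≥ 1` means `N < s + 1`.
    have h := finsum_normQuad_even (hZ _ (SuperSpectralCurve.IsGenerator.L a (x + 1 - y) (-y)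
      (by omega) (by omega))) (2 * g + n)
    rw [show -(2 * -y) = N by omega] at h
    -- A constant survives no derivation, so it contributes only for `n = 0`, and then degree 2
    -- means `g = 1`.
    have hE : evalAt S m (if -y = 0 ∧ 2 * g + n = 2 then (1 / 2 : ℂ) • 1 else 0) =
        if N = 0 ∧ g = 1 ∧ n = 0 then algebraMap ℂ (BaseRing p q) (1 / 2) else 0 := by
      by_cases hc : -y = 0 ∧ 2 * g + n = 2
      · rw [if_pos hc, map_smul, Algebra.algebraMap_eq_smul_one]
        by_cases hn : n = 0
        · subst hn
          rw [if_pos ⟨by omega, by omega, rfl⟩]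
          simp [evalAt]
        · rw [if_neg (by omega)]
          have := dSeq_baseIncl S.toCurveData (1 : BaseRing p q) (l := List.ofFn m)
            (fun e => by simp at e; omega)
          rw [map_one] at this
          simp [evalAt, this]
      · rw [if_neg hc, if_neg (by omega), map_zero]
    have h2 := congrArg (evalAt S m) h
    rw [map_sub, hE] at h2
    have hsum := congrArg₂ (· + ·) hJ hG
    simp only [one_smul, neg_smul, ← sub_eq_add_neg] at hsum
    rw [h2] at hsum
    have hy' : Even N := ⟨y, hy⟩
    have hR : (casimirRamond p q).2 N = if N = 0 then algebraMap ℂ (BaseRing p q) (-1 / 2) else 0 :=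
      rfl
    simp only [loop2, casimirOmega, Prod.snd_add, Pi.add_apply, casimir_snd_even _ _ hy']
    by_cases hg : g = 0
    · simp only [hg, if_true] at hsum ⊢
      simp only [mul_smul, zero_add] at hsum ⊢
      rw [if_neg (by omega)] at hsum
      rw [add_comm] at hsum
      exact (zero_add _).trans hsum
    · simp only [hg, if_false] at hsum ⊢
      simp only [mul_smul] at hsum
      -- The Casimir `-½` of the standard bidifferential cancels the `½` that comes from the
      -- constant in `L_{a,0}`.
      have hδ : (if g - 1 = 0 ∧ n = 0 then casimirRamond p q else 0).2 N =
          -(if N = 0 ∧ g = 1 ∧ n = 0 then algebraMap ℂ (BaseRing p q) (1 / 2) else 0) := by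
        by_cases hc : g - 1 = 0 ∧ n = 0
        · rw [if_pos hc, hR]
          by_cases hN0 : N = 0
          · rw [if_pos hN0, if_pos ⟨hN0, by omega, hc.2⟩, ← map_neg]
            norm_num
          · rw [if_neg hN0, if_neg fun h => hN0 h.1, neg_zero]
        · rw [if_neg hc, if_neg (by omega), neg_zero]
          rfl
      rw [Prod.snd_add, Pi.add_apply, hδ, casimir_snd_even _ _ hy', ← hsum]
      abel

end LoopEquations

end SuperTR

end

theorem mainTheorem2 {p q r : ℕ} (S : SuperTR.SuperSpectralCurve p q r)
    (Z : SuperTR.FreeEnergies p q r) (hZ : Z.IsPartitionFunction S) (a : Fin r) (g n : ℕ) :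
    SuperTR.IsBigO 1 0
        (fun N : ℤ => SuperTR.loop1 S.toCurveData Z g n (Sum.inr (a, N)))
        (fun N : ℤ => SuperTR.loop1 S.toCurveData Z g n (Sum.inl (a, N))) ∧
      SuperTR.IsBigO 3 ((S.s a - 3) / 2)
        (fun (N : ℤ) (m : Fin n → SuperTR.Mode r) => (SuperTR.loop2 S.toCurveData Z a g n m).1 N)
        (fun (N : ℤ) (m : Fin n → SuperTR.Mode r) =>
          (SuperTR.loop2 S.toCurveData Z a g n m).2 N) := by
  refine ⟨SuperTR.isBigO_of_eq_zero (fun N hN => funext fun m => ?_)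
    (fun N hN => funext fun m => ?_), SuperTR.isBigO_of_eq_zero (fun N hN => funext fun m => ?_)
    (fun N hN => funext fun m => ?_)⟩
  · refine (SuperTR.loop1_eq_zero hZ a g n m).2 (hN.imp (fun h => ?_) fun h => ?_)
    · push_cast at h
      omega
    · by_contra hc
      obtain ⟨k, hk⟩ := Int.not_even_iff_odd.mp hc
      exact h ⟨k, by push_cast; omega⟩
  · refine (SuperTR.loop1_eq_zero hZ a g n m).1 ?_
    rcases Int.even_or_odd N with h | h
    · obtain ⟨k, hk⟩ := h
      refine Or.inl ?_
      rcases hN with hN | ⟨l, hl⟩ <;> push_cast at * <;> omega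
    · exact Or.inr h
  · refine SuperTR.loop2_fst_eq_zero hZ a g n m ?_
    rcases Int.even_or_odd N with h | ⟨k, hk⟩
    · exact Or.inr h
    · refine Or.inl ?_
      rcases hN with hN | hN
      -- For `s = 1` and `s = 3` the integer division is exact, so the order bound `3 + 2 · ((s - 3)
      -- / 2)` is `s`.
      · rcases S.s_mem a with h | h <;> rw [h] at hN ⊢ <;> push_cast at hN <;> omega
      · exact absurd ⟨k - 1, by push_cast; omega⟩ hN
  · refine SuperTR.loop2_snd_eq_zero hZ a g n m ?_
    rcases Int.even_or_odd N with ⟨k, hk⟩ | h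
    · refine Or.inl ?_
      rcases hN with hN | ⟨l, hl⟩
      · rcases S.s_mem a with h | h <;> rw [h] at hN ⊢ <;> push_cast at hN <;> omega
      · push_cast at hl
        omega
    · exact Or.inr h
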